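/- Let $n,m\in\mathbb N$ with $m\ge 1$, and let $P=(P_j(D))_{j=1}^N$ and $Q=(Q_j(D))_{j=1}^M$ be two systems of linear partial differential operators with constant complex coefficients on $\mathbb R^n$ ($D_k=-i\partial_{x_k}$), each operator of both systems being of order exactly $m$. Assume: (i) $P$ and $Q$ satisfy condition $(\mathscr H)$, where $P$ satisfies $(\mathscr H)$ if there are $C>0$ and $\gamma\ge m$ with $$\sum_{j=1}^N|\partial_\xi^\alpha P_j(\xi)|\le C\Big(1+\sum_{j=1}^N|P_j(\xi)|\Big)^{1-|\alpha|/\gamma}\qquad\forall\alpha\in\mathbb N_0^n,\ \xi\in\mathbb R^n;$$ $\gamma_P\ge m$ denotes the smallest such $\gamma$ (the infimum of all such $\gamma$, which is attained), and $\gamma_Q$ is defined likewise; (ii) $P$ and $Q$ are $1$-equally strong, i.e. for some $C>0$ and all $\xi\in\mathbb R^n$, $\sum_{j}|Q_j(\xi)|\le C(1+\sum_{j}|P_j(\xi)|)$ and $\sum_{j}|P_j(\xi)|\le C(1+\sum_{j}|Q_j(\xi)|)$. Let $\Omega\subseteq\mathbb R^n$ be open, and let $\omega:[0,\infty)\to[0,\infty)$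 be a non-quasianalytic weight function, i.e. continuous, increasing (in the wide sense), with $(\alpha)$ $\omega(2t)\le L(\omega(t)+1)$ for some $L>0$ and all $t\ge0$; $(\beta)$ $\int_1^\infty\omega(t)t^{-2}\,dt<\infty$; $(\gamma)$ $\log t=o(\omega(t))$ as $t\to\infty$; $(\delta)$ $t\mapsto\omega(e^t)$ is convex on $\mathbb R$. For a weight $\sigma$ put $\varphi_\sigma^*(y)=\sup_{t\ge0}\{yt-\sigma(e^t)\}$ for $y\ge 0$, and for $K\subset\Omega$ compact, $\lambda>0$ and $u\in C^\infty(\Omega)$ (complex-valued) put $$p^P_{K,\lambda}(u)=\sup_{\beta\in\mathbb N_0^N}\|P_1(D)^{\beta_1}\cdots P_N(D)^{\beta_N}u\|_{L^2(K)}\,e^{-\lambda\varphi_\sigma^*(|\beta|m/\lambda)}.$$ Let $\mathcal E^P_{(\sigma)}(\Omega)$ (Beurling case) be the set of $u\in C^\infty(\Omega)$ such that $p^P_{K,\lambda}(u)<\infty$ for all compact $K\subset\Omega$ and all $\lambda>0$, and let $\mathcal E^P_{\{\sigma\}}(\Omega)$ (Roumieu case) be the set of $u\in C^\infty(\Omega)$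 such that for every compact $K\subset\Omega$ there is an integer $\ell\ge1$ with $p^P_{K,1/\ell}(u)<\infty$. Define the spaces for $Q$ in the same way. Then $\gamma_P=\gamma_Q$, and for every $s\ge\gamma_P/m=\gamma_Q/m$ and $\omega'(t)=\omega(t^{1/s})$, $$\mathcal E^P_{(\omega')}(\Omega)=\mathcal E^Q_{(\omega')}(\Omega)\qquad\text{and}\qquad \mathcal E^P_{\{\omega'\}}(\Omega)=\mathcal E^Q_{\{\omega'\}}(\Omega).$$ -/

import Mathlib

noncomputable section

namespace IterateSystems

/-- Composition `f₁ ∘ f₂ ∘ ⋯ ∘ f_k` of a finite family of self-maps, where the `j`-th map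
is the `e j`-th iterate of `f j`. -/
def iterComp {k : ℕ} {X : Type*} (f : Fin k → X → X) (e : Fin k → ℕ) : X → X :=
  (List.ofFn fun j => (f j)^[e j]).foldr (fun g h => g ∘ h) id

/-- The operator `D_j = -i ∂_{x_j}`. -/
def D {n : ℕ} (j : Fin n) (u : EuclideanSpace ℝ (Fin n) → ℂ) :
    EuclideanSpace ℝ (Fin n) → ℂ :=
  fun x => -Complex.I * fderiv ℝ u x (EuclideanSpace.single j 1)

/-- The operator `p(D) = ∑_α a_α D^α` with symbol `p(ξ) = ∑_α a_α ξ^α`. -/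
def polyOp {n : ℕ} (p : MvPolynomial (Fin n) ℂ) (u : EuclideanSpace ℝ (Fin n) → ℂ) :
    EuclideanSpace ℝ (Fin n) → ℂ :=
  fun x => ∑ α ∈ p.support, p.coeff α * iterComp D (fun j => α j) u x

/-- The iterate `P^β = P_1(D)^{β_1} ∘ ⋯ ∘ P_N(D)^{β_N}` of the system `P`. -/
def sysIter {n N : ℕ} (P : Fin N → MvPolynomial (Fin n) ℂ) (β : Fin N → ℕ)
    (u : EuclideanSpace ℝ (Fin n) → ℂ) : EuclideanSpace ℝ (Fin n) → ℂ :=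
  iterComp (fun j => polyOp (P j)) β u

/-- The system has order `m`: each of its operators has order `m`. -/
def HasOrder {n N : ℕ} (P : Fin N → MvPolynomial (Fin n) ℂ) (m : ℕ) : Prop :=
  ∀ j, (P j).totalDegree = m

/-- The value `p(ξ)` of a symbol at a real point `ξ`. -/
def symb {n : ℕ} (p : MvPolynomial (Fin n) ℂ) (ξ : EuclideanSpace ℝ (Fin n)) : ℂ :=
  MvPolynomial.eval (fun i => (ξ i : ℂ)) p

/-- The derivative `p^{(α)} = ∂_ξ^α p` of a symbol. -/
def symbDeriv {n : ℕ} (α : Fin n → ℕ) (p : MvPolynomial (Fin n) ℂ) :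
    MvPolynomial (Fin n) ℂ :=
  iterComp (fun i q => MvPolynomial.pderiv i q) α p

/-- The inequality of condition `(ℋ)` with exponent parameter `γ`. -/
def CondHWith {n N : ℕ} (P : Fin N → MvPolynomial (Fin n) ℂ) (γ : ℝ) : Prop :=
  ∃ C : ℝ, 0 < C ∧ ∀ (α : Fin n → ℕ) (ξ : EuclideanSpace ℝ (Fin n)),
    ∑ j, ‖symb (symbDeriv α (P j)) ξ‖
      ≤ C * (1 + ∑ j, ‖symb (P j) ξ‖) ^ (1 - ((∑ i, α i : ℕ) : ℝ) / γ)

/-- Condition `(ℋ)` for a system of order `m`. -/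
def CondH {n N : ℕ} (P : Fin N → MvPolynomial (Fin n) ℂ) (m : ℕ) : Prop :=
  ∃ γ : ℝ, (m : ℝ) ≤ γ ∧ CondHWith P γ

/-- The number `γ_P` of a system of order `m` satisfying `(ℋ)`: the smallest `γ ≥ m` for which
the inequality of `(ℋ)` holds. -/
def gammaOf {n N : ℕ} (P : Fin N → MvPolynomial (Fin n) ℂ) (m : ℕ) : ℝ :=
  sInf {γ : ℝ | (m : ℝ) ≤ γ ∧ CondHWith P γ}

/-- `Q` is `h`-weaker than `P`, written `Q ≺_h P`. -/
def HWeaker {n M N : ℕ} (h : ℝ) (Q : Fin M → MvPolynomial (Fin n) ℂ)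
    (P : Fin N → MvPolynomial (Fin n) ℂ) : Prop :=
  ∃ C : ℝ, 0 < C ∧ ∀ ξ : EuclideanSpace ℝ (Fin n),
    ∑ j, ‖symb (Q j) ξ‖ ≤ C * (1 + ∑ j, ‖symb (P j) ξ‖) ^ h

/-- `P` and `Q` are `h`-equally strong. -/
def EquallyStrong {n N M : ℕ} (h : ℝ) (P : Fin N → MvPolynomial (Fin n) ℂ)
    (Q : Fin M → MvPolynomial (Fin n) ℂ) : Prop :=
  HWeaker h P Q ∧ HWeaker h Q P

/-- Non-quasianalytic weight functions `ω : [0,∞) → [0,∞)`; only the values of `ω` on `[0,∞)`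
are used. -/
structure IsNQWeight (ω : ℝ → ℝ) : Prop where
  nonneg : ∀ t, 0 ≤ t → 0 ≤ ω t
  continuousOn : ContinuousOn ω (Set.Ici 0)
  monotoneOn : MonotoneOn ω (Set.Ici 0)
  alpha : ∃ L : ℝ, 0 < L ∧ ∀ t, 0 ≤ t → ω (2 * t) ≤ L * (ω t + 1)
  beta : MeasureTheory.IntegrableOn (fun t => ω t / t ^ 2) (Set.Ioi 1)
  gamma : Asymptotics.IsLittleO Filter.atTop Real.log ω
  delta : ConvexOn ℝ Set.univ (fun t => ω (Real.exp t))

/-- The Young conjugate `φ_ω^*(y) = sup_{t ≥ 0} (y t - φ_ω(t))` of `φ_ω(t) = ω(e^t)`. -/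
def youngConj (ω : ℝ → ℝ) (y : ℝ) : ℝ :=
  ⨆ t : Set.Ici (0 : ℝ), (y * (t : ℝ) - ω (Real.exp t))

/-- The semi-norm `p^P_{K,μ}(u) = sup_β ‖P^β u‖_{L²(K)} exp(-μ φ_ω^*(|β| m / μ))`, with values
in `[0,∞]`, for a system of order `m`. -/
def seminormP {n N : ℕ} (P : Fin N → MvPolynomial (Fin n) ℂ) (m : ℕ) (ω : ℝ → ℝ)
    (K : Set (EuclideanSpace ℝ (Fin n))) (μ : ℝ) (u : EuclideanSpace ℝ (Fin n) → ℂ) : ENNReal :=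
  ⨆ β : Fin N → ℕ,
    MeasureTheory.eLpNorm (sysIter P β u) 2 (MeasureTheory.volume.restrict K) *
      ENNReal.ofReal (Real.exp (-(μ * youngConj ω (((∑ j, β j : ℕ) : ℝ) * m / μ))))

/-- The Beurling space `ℰ^P_{(ω)}(Ω)` for a system of order `m`. Functions on the open set `Ω` are
represented by functions on the whole space, whose values off `Ω` play no role. -/
def beurling {n N : ℕ} (P : Fin N → MvPolynomial (Fin n) ℂ) (m : ℕ) (ω : ℝ → ℝ)
    (Ω : Set (EuclideanSpace ℝ (Fin n))) : Set (EuclideanSpace ℝ (Fin n) → ℂ) :=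
  {u | ContDiffOn ℝ ((⊤ : ℕ∞) : WithTop ℕ∞) u Ω ∧
    ∀ K : Set (EuclideanSpace ℝ (Fin n)), IsCompact K → K ⊆ Ω →
      ∀ μ : ℝ, 0 < μ → seminormP P m ω K μ u < ⊤}

/-- The Roumieu space `ℰ^P_{\{ω\}}(Ω)` for a system of order `m`. -/
def roumieu {n N : ℕ} (P : Fin N → MvPolynomial (Fin n) ℂ) (m : ℕ) (ω : ℝ → ℝ)
    (Ω : Set (EuclideanSpace ℝ (Fin n))) : Set (EuclideanSpace ℝ (Fin n) → ℂ) :=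
  {u | ContDiffOn ℝ ((⊤ : ℕ∞) : WithTop ℕ∞) u Ω ∧
    ∀ K : Set (EuclideanSpace ℝ (Fin n)), IsCompact K → K ⊆ Ω →
      ∃ l : ℕ, 0 < l ∧ seminormP P m ω K (1 / (l : ℝ)) u < ⊤}

end IterateSystems

end

/-! ### Algebraic Sard theorem. -/

namespace IterateSystems

/-! Write `f_P = 1 + ∑ |P_j|` for the size of the symbols, and likewise `f_Q`. The proof has three
ingredients.

Equality of the exponents. If `(ℋ)` holds for `P` with exponent `γ`, Taylor's formula shows that
`f_P` changes by at most a bounded factor within distance `f_P ^ (1/γ)`. By equal strength the same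
is true of `f_Q`. Since Taylor coefficients are linear combinations of values on a finite grid,
taking a grid of mesh comparable to `f_Q ^ (1/γ)` gives `(ℋ)` for `Q` with the same `γ`
(`CondHWith.of_equallyStrong`). So the admissible exponents, and their infima, coincide.

The infimum is attained (`condHWith_gammaOf`). This is needed because `s = γ_P / m` is allowed. Each
inequality in `(ℋ)` compares a polynomial `G` with a power of a polynomial `F`. The supremum of `G`
on a level set of `F` is a root of a polynomial whose coefficients depend on the level: suprema are
critical values, or limits of critical values at infinity, and critical values satisfy a polynomial
equation by an algebraic Sard theorem. By the Newton polygon such roots grow like one of finitely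
many powers, so bounds with exponent `θ + ε` for all `ε > 0` imply the bound with `θ`.

Inclusion of the spaces. Cutoffs, Plancherel and `(ℋ)` give `‖Q_i v‖_A ≤ C (∑ ‖P_j v‖ + t ^ (-γ)
‖v‖)` for `0 < t ≤ 1`, with norms over the `t`-neighbourhood of `A` on the right
(`CondHWith.exists_l2_le`); the commutator terms are absorbed by iterating over shrinking scales.
Using this `k` times with `t = δ / k` bounds `Q^β v`, `|β| = k`, by `C ^ k` times the largest `k ^
(γ (k - |α|)) ‖P^α v‖` with `|α| ≤ k` (`CondHWith.exists_iterate_le`). For `γ ≤ s m` the Young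
conjugate of `ω(t ^ (1/s))` absorbs these factors when the parameter is divided by a fixed constant
(`IsNQWeight.exists_absorb`). Exchanging `P` and `Q` gives equality. -/

open MvPolynomial in
/-- In characteristic zero, algebraically independent elements admit dual derivations. -/
theorem exists_derivation_dual {K L : Type} [Field K] [CharZero K] [Field L] [Algebra K L]
    {ι : Type} [DecidableEq ι] {y : ι → L} (hy : AlgebraicIndependent K y) (i : ι) :
    ∃ d : Derivation K L L, ∀ j, d (y j) = if j = i then 1 else 0 := by
  classical
  obtain ⟨s, hys, hs⟩ := exists_isTranscendenceBasis_superset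
    (s := Set.range y) hy.coe_range
  let S := MvPolynomial s K
  let algSL : Algebra S L := (aeval (Subtype.val : s → L) : S →ₐ[K] L).toRingHom.toAlgebra
  have hmap : ∀ p : S, algebraMap S L p = aeval (Subtype.val : s → L) p := fun p => rfl
  have : IsScalarTower K S L := IsScalarTower.of_algebraMap_eq fun r => by
    rw [hmap]; simp [S, MvPolynomial.algebraMap_eq]
  have hinj : Function.Injective (algebraMap S L) := hs.1
  have : FaithfulSMul S L := (faithfulSMul_iff_algebraMap_injective S L).mpr hinj
  have halg : Algebra.IsAlgebraic S L := by
    have := hs.isAlgebraic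
    refine Algebra.IsAlgebraic.ringHom_of_comp_eq (hs.1.aevalEquiv.symm : _ ≃+* _).toRingHom
      (RingHom.id L) (R := Algebra.adjoin K (Set.range (Subtype.val : s → L))) (A := L) ?_ ?_ ?_
    · exact hs.1.aevalEquiv.symm.injective
    · exact Function.surjective_id
    · ext x
      obtain ⟨p, rfl⟩ := hs.1.aevalEquiv.surjective x
      change algebraMap S L (hs.1.aevalEquiv.symm (hs.1.aevalEquiv p)) = _
      rw [AlgEquiv.symm_apply_apply, hmap]
      exact (hs.1.algebraMap_aevalEquiv p).symm
  let algFL : Algebra (FractionRing S) L := FractionRing.liftAlgebra S L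
  have : IsScalarTower S (FractionRing S) L := FractionRing.isScalarTower_liftAlgebra S L
  have : Algebra.IsAlgebraic (FractionRing S) L :=
    (IsFractionRing.comap_isAlgebraic_iff (A := S) (K := FractionRing S) (C := L)).mp halg
  have : CharZero S := inferInstance
  have : CharZero (FractionRing S) := inferInstance
  -- Algebraic extensions are separable in characteristic zero, so `L` is formally étale over the
  -- polynomial ring `S` on a transcendence basis. Hence the differentials of `L` are base changed
  -- from those of `S`, and every derivation `S → L` extends to `L`.
  have : Algebra.FormallyEtale (FractionRing S) L := Algebra.FormallyEtale.of_isSeparable _ L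
  have : Algebra.FormallyEtale S (FractionRing S) :=
    Algebra.FormallyEtale.of_isLocalization (nonZeroDivisors S)
  have : Algebra.FormallyEtale S L := Algebra.FormallyEtale.comp S (FractionRing S) L
  let d0 : Derivation K S L := mkDerivation K (fun a : s => if a.1 = y i then (1 : L) else 0)
  have hbc : IsBaseChange L (KaehlerDifferential.map K K S L) :=
    KaehlerDifferential.isBaseChange_of_formallyEtale K S L
  refine ⟨(hbc.lift d0.liftKaehlerDifferential).compDer (KaehlerDifferential.D K L), fun j => ?_⟩
  have hj : y j = algebraMap S L (X ⟨y j, hys ⟨j, rfl⟩⟩) := by rw [hmap]; simp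
  have h1 : KaehlerDifferential.D K L (y j) =
      KaehlerDifferential.map K K S L (KaehlerDifferential.D K S (X ⟨y j, hys ⟨j, rfl⟩⟩)) := by
    rw [KaehlerDifferential.map_D, ← hj]
  change hbc.lift d0.liftKaehlerDifferential (KaehlerDifferential.D K L (y j)) = _
  rw [h1, hbc.lift_eq, Derivation.liftKaehlerDifferential_comp_D]
  refine (mkDerivation_X K (fun a : s => if a.1 = y i then (1 : L) else 0) _).trans ?_
  simp only [hy.injective.eq_iff]

open MvPolynomial in
theorem derivation_aeval {K A σ : Type} [Field K] [CommRing A] [Algebra K A] [Fintype σ]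
    (d : Derivation K A A) (ξ : σ → A) (p : MvPolynomial σ K) :
    d (aeval ξ p) = ∑ l, aeval ξ (pderiv l p) * d (ξ l) := by
  classical
  induction p using MvPolynomial.induction_on with
  | C a => simp
  | add p q hp hq => simp [hp, hq, add_mul, Finset.sum_add_distrib]
  | mul_X p i hp =>
    have h1 : ∀ l, aeval ξ (pderiv l (p * X i)) * d (ξ l)
        = (if l = i then aeval ξ p * d (ξ l) else 0) +
          ξ i * (aeval ξ (pderiv l p) * d (ξ l)) := by
      intro l
      rw [pderiv_mul, pderiv_X, map_add, map_mul, map_mul, aeval_X]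
      rcases eq_or_ne l i with rfl | h
      · simp; ring
      · simp [h, h.symm]; ring
    rw [map_mul, aeval_X, Derivation.leibniz, hp, Finset.sum_congr rfl fun l _ => h1 l,
      Finset.sum_add_distrib, ← Finset.mul_sum]
    simp

-- Were the values independent, a derivation `d` dual to the value with index `i₀` would exist. It
-- sends `∑ c_i F_i(ξ)`, with the `c_i` held fixed, to `c i₀ = 1`, whereas the chain rule together
-- with `hg` gives `0`.
open MvPolynomial in
theorem not_algebraicIndependent_of_critical {L σ ι : Type} [Field L] [Algebra ℝ L] [Fintype σ]
    [Fintype ι] (F : ι → MvPolynomial σ ℝ) (i₀ : ι) (ξ : σ → L) (c : ι → L) (hc : c i₀ = 1)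
    (hg : ∀ l, ∑ i, c i * aeval ξ (pderiv l (F i)) = 0) :
    ¬ AlgebraicIndependent ℝ (fun i => aeval ξ (F i)) := by
  classical
  intro hy
  obtain ⟨d, hd⟩ := exists_derivation_dual hy i₀
  have h1 : ∑ i, c i * d (aeval ξ (F i)) = 1 := by
    simp [hd, hc]
  have h2 : ∑ i, c i * d (aeval ξ (F i)) = 0 := by
    simp only [derivation_aeval, Finset.mul_sum]
    rw [Finset.sum_comm]
    refine Finset.sum_eq_zero fun l _ => ?_
    simp only [← mul_assoc]
    rw [← Finset.sum_mul, hg, zero_mul]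
  exact one_ne_zero (h1.symm.trans h2)

open MvPolynomial in
/-- Algebraic Sard theorem: the critical values of a polynomial map satisfy a nontrivial
polynomial equation. -/
theorem exists_ne_zero_eval_critical_eq_zero {σ ι : Type} [Fintype σ] [Fintype ι]
    (F : ι → MvPolynomial σ ℝ) (i₀ : ι) :
    ∃ H : MvPolynomial ι ℝ, H ≠ 0 ∧ ∀ (x : σ → ℝ) (c : ι → ℝ), c i₀ = 1 →
      (∀ l, ∑ i, c i * eval x (pderiv l (F i)) = 0) → eval (fun i => eval x (F i)) H = 0 := by
  classical
  obtain ⟨F', hF'⟩ : ∃ F' : ι → MvPolynomial (σ ⊕ ι) ℝ, F' = fun i => rename Sum.inl (F i) :=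
    ⟨_, rfl⟩
  obtain ⟨g, hg⟩ : ∃ g : σ → MvPolynomial (σ ⊕ ι) ℝ,
    g = fun l => ∑ i, X (Sum.inr i) * rename Sum.inl (pderiv l (F i)) := ⟨_, rfl⟩
  obtain ⟨I, hI⟩ : ∃ I : Ideal (MvPolynomial (σ ⊕ ι) ℝ),
    I = Ideal.span (insert (X (Sum.inr i₀) - 1) (Set.range g)) := ⟨_, rfl⟩
  obtain ⟨T, hT⟩ : ∃ T : Submonoid (MvPolynomial (σ ⊕ ι) ℝ), T =
    (nonZeroDivisors (MvPolynomial ι ℝ)).map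
      (aeval F' : MvPolynomial ι ℝ →ₐ[ℝ] MvPolynomial (σ ⊕ ι) ℝ) := ⟨_, rfl⟩
  have hIc : X (Sum.inr i₀) - 1 ∈ I := hI ▸ Ideal.subset_span (by simp)
  have hIg : ∀ l, g l ∈ I := fun l => hI ▸ Ideal.subset_span (by simp)
  -- `I` is the ideal of critical pairs `(x, c)` normalised by `c i₀ = 1`, and `T` consists of the
  -- polynomials `H(F)` with `H ≠ 0`. If they are disjoint, a prime above `I` avoiding `T` has a
  -- generic point that is critical with algebraically independent values, which is impossible.
  -- Otherwise some `H(F)` lies in `I` and vanishes at every real critical pair.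
  by_cases hdis : Disjoint (I : Set (MvPolynomial (σ ⊕ ι) ℝ)) T
  · exfalso
    obtain ⟨p, hp, hIp, hpT⟩ := I.exists_le_prime_disjoint T hdis
    obtain ⟨φ, hφdef⟩ : ∃ φ : MvPolynomial (σ ⊕ ι) ℝ →ₐ[ℝ]
        FractionRing (MvPolynomial (σ ⊕ ι) ℝ ⧸ p), φ =
      (IsScalarTower.toAlgHom ℝ (MvPolynomial (σ ⊕ ι) ℝ ⧸ p) _).comp (Ideal.Quotient.mkₐ ℝ p) :=
      ⟨_, rfl⟩
    have hφ : ∀ a, φ a = 0 ↔ a ∈ p := by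
      intro a
      have : φ a = algebraMap _ _ (Ideal.Quotient.mk p a) := by rw [hφdef]; rfl
      rw [this, map_eq_zero_iff _ (IsFractionRing.injective (MvPolynomial (σ ⊕ ι) ℝ ⧸ p) _),
        Ideal.Quotient.eq_zero_iff_mem]
    have hren : ∀ q : MvPolynomial σ ℝ, φ (rename Sum.inl q) =
        aeval (fun l => φ (X (Sum.inl l))) q := by
      intro q
      have : φ.comp (rename Sum.inl) = aeval (fun l => φ (X (Sum.inl l))) := by
        ext; simp
      rw [← this]; rfl
    refine not_algebraicIndependent_of_critical F i₀ (fun l => φ (X (Sum.inl l)))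
      (fun i => φ (X (Sum.inr i))) ?_ ?_ ?_
    · have : φ (X (Sum.inr i₀) - 1) = 0 := (hφ _).2 (hIp hIc)
      rwa [map_sub, map_one, sub_eq_zero] at this
    · intro l
      have : φ (g l) = 0 := (hφ _).2 (hIp (hIg l))
      simpa only [hg, map_sum, map_mul, hren] using this
    · rw [algebraicIndependent_iff]
      intro H hH
      by_contra hne
      have h1 : φ (aeval F' H) = 0 := by
        rw [← hH, ← AlgHom.comp_apply, comp_aeval]
        simp only [hF', hren]
      rw [hφ] at h1
      exact Set.disjoint_left.mp hpT h1 (hT ▸ ⟨H, mem_nonZeroDivisors_of_ne_zero hne, rfl⟩)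
  · obtain ⟨a, haI, haT⟩ := Set.not_disjoint_iff.mp hdis
    rw [hT] at haT
    obtain ⟨H, hH, rfl⟩ := haT
    refine ⟨H, nonZeroDivisors.ne_zero hH, fun x c hc hl => ?_⟩
    have hker : I ≤ RingHom.ker (eval (Sum.elim x c)) := by
      rw [hI, Ideal.span_le]
      rintro _ (rfl | ⟨l, rfl⟩)
      · change eval _ _ = 0
        rw [map_sub, eval_X, map_one, Sum.elim_inr, hc, sub_self]
      · change eval _ _ = 0
        simp only [hg, map_sum, map_mul, eval_X, Sum.elim_inr, eval_rename, Sum.elim_comp_inl]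
        exact hl l
    have h0 : eval (Sum.elim x c) (aeval F' H) = 0 := hker haI
    have h1 : eval (Sum.elim x c) (aeval F' H) = eval (fun i => eval x (F i)) H := by
      rw [← coe_aeval_eq_eval, ← coe_aeval_eq_eval]
      change (aeval (Sum.elim x c)) ((aeval F') H) = aeval (fun i => eval x (F i)) H
      rw [← AlgHom.comp_apply, comp_aeval]
      congr 2
      funext i
      subst hF'
      change eval _ (rename Sum.inl (F i)) = _
      rw [eval_rename, Sum.elim_comp_inl]
    rw [← h1, h0]

end IterateSystems

/-! ### Polynomial relations at constrained extrema. -/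

namespace IterateSystems

-- Lagrange multipliers form a nonzero vector, but at degenerate points of the constraints no
-- particular entry is known to be nonzero. The product over all choices of normalised index covers
-- every case.
open MvPolynomial in
theorem exists_ne_zero_eval_critical_eq_zero' {σ ι : Type} [Fintype σ] [Fintype ι]
    (F : ι → MvPolynomial σ ℝ) :
    ∃ H : MvPolynomial ι ℝ, H ≠ 0 ∧ ∀ (x : σ → ℝ) (c : ι → ℝ), c ≠ 0 →
      (∀ l, ∑ i, c i * eval x (pderiv l (F i)) = 0) → eval (fun i => eval x (F i)) H = 0 := by
  choose H hne hH using exists_ne_zero_eval_critical_eq_zero F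
  refine ⟨∏ i, H i, Finset.prod_ne_zero_iff.2 fun i _ => hne i, fun x c hc hl => ?_⟩
  obtain ⟨i, hi⟩ := Function.ne_iff.1 hc
  rw [map_prod]
  refine Finset.prod_eq_zero (Finset.mem_univ i)
    (hH i x (fun k => (c i)⁻¹ * c k) (inv_mul_cancel₀ hi) fun l => ?_)
  simp only [mul_assoc]
  rw [← Finset.mul_sum, hl, mul_zero]

open MvPolynomial in
theorem hasStrictFDerivAt_eval {σ : Type} [Fintype σ] (p : MvPolynomial σ ℝ) (x : σ → ℝ) :
    HasStrictFDerivAt (fun z : σ → ℝ => eval z p)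
      (∑ l, eval x (pderiv l p) • ContinuousLinearMap.proj (R := ℝ) (φ := fun _ : σ => ℝ) l) x := by
  classical
  induction p using MvPolynomial.induction_on with
  | C a => simpa using hasStrictFDerivAt_const a x
  | add p q hp hq =>
    simp only [map_add, add_smul, Finset.sum_add_distrib]
    exact hp.add hq
  | mul_X p i hp =>
    have h1 : HasStrictFDerivAt (fun z : σ → ℝ => z i)
        (ContinuousLinearMap.proj (R := ℝ) (φ := fun _ : σ => ℝ) i) x :=
      (ContinuousLinearMap.proj (R := ℝ) (φ := fun _ : σ => ℝ) i).hasStrictFDerivAt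
    have h2 := hp.mul h1
    simp only [map_mul, eval_X]
    refine h2.congr_fderiv ?_
    have h3 : ∀ l, eval x (pderiv l (p * X i)) =
        (if l = i then eval x p else 0) + x i * eval x (pderiv l p) := by
      intro l
      rw [pderiv_mul, pderiv_X, map_add, map_mul, map_mul, eval_X]
      rcases eq_or_ne l i with rfl | h
      · simp; ring
      · simp [h, h.symm]; ring
    simp only [h3, add_smul, Finset.sum_add_distrib, mul_smul, ← Finset.smul_sum]
    simp

open MvPolynomial in
/-- The polynomial relation satisfied by constrained extrema. -/
theorem exists_ne_zero_eval_extremum {σ : Type} [Fintype σ] (k : ℕ)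
    (F : Fin (k + 1) → MvPolynomial σ ℝ) (i₀ : Fin (k + 1)) :
    ∃ H : MvPolynomial (Fin (k + 1)) ℝ, H ≠ 0 ∧ ∀ x : σ → ℝ,
      (∀ z : σ → ℝ, (∀ i, i ≠ i₀ → eval z (F i) = eval x (F i)) →
        eval z (F i₀) ≤ eval x (F i₀)) → eval (fun i => eval x (F i)) H = 0 := by
  classical
  obtain ⟨H, hne, hH⟩ := exists_ne_zero_eval_critical_eq_zero' F
  refine ⟨H, hne, fun x hx => ?_⟩
  have hext : IsLocalExtrOn (fun z => eval z (F i₀))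
      {z | ∀ i : {i // i ≠ i₀}, eval z (F i) = eval x (F i)} x := by
    refine Or.inr ?_
    refine Filter.eventually_inf_principal.2 (Filter.Eventually.of_forall fun z hz => ?_)
    exact hx z fun i hi => hz ⟨i, hi⟩
  obtain ⟨Λ, Λ₀, hΛ, hsum⟩ := IsLocalExtrOn.exists_multipliers_of_hasStrictFDerivAt
    (f := fun (i : {i // i ≠ i₀}) z => eval z (F i)) hext
    (fun i => hasStrictFDerivAt_eval (F i) x) (hasStrictFDerivAt_eval (F i₀) x)
  refine hH x (fun i => if h : i = i₀ then Λ₀ else Λ ⟨i, h⟩) ?_ fun l => ?_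
  · intro h0
    refine hΛ (Prod.ext (funext fun i => ?_) ?_)
    · simpa [i.2] using congrFun h0 i
    · simpa using congrFun h0 i₀
  · have h1 := congrArg (fun L => L (Pi.single l 1)) hsum
    simp only [_root_.add_apply, _root_.sum_apply,
      _root_.smul_apply, ContinuousLinearMap.proj_apply, Pi.single_apply,
      smul_eq_mul, mul_ite, mul_one, mul_zero, Finset.sum_ite_eq', Finset.mem_univ, if_true,
      _root_.zero_apply] at h1
    rw [← h1, Fintype.sum_eq_add_sum_subtype_ne _ i₀, add_comm]
    simp only [dite_true]
    congr 1
    exact Finset.sum_congr rfl fun i _ => by rw [dif_neg i.2]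

open MvPolynomial in
theorem exists_isTheta_eval (a : MvPolynomial (Fin 1) ℝ) (ha : a ≠ 0) :
    ∃ (d : ℕ) (c C r₀ : ℝ), 0 < c ∧ 0 < C ∧ ∀ r, r₀ ≤ r →
      c * r ^ d ≤ |eval ![r] a| ∧ |eval ![r] a| ≤ C * r ^ d := by
  set p : Polynomial ℝ := aeval (fun _ => Polynomial.X) a with hp
  have hev : ∀ r, p.eval r = eval ![r] a := by
    intro r
    have : (Polynomial.aeval r : Polynomial ℝ →ₐ[ℝ] ℝ) p = aeval ![r] a := by
      rw [hp, ← AlgHom.comp_apply, comp_aeval]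
      congr 2
      funext i
      fin_cases i; simp
    simpa [Polynomial.coe_aeval_eq_eval, coe_aeval_eq_eval] using this
  have hp0 : p ≠ 0 := by
    intro h
    refine ha (MvPolynomial.funext fun x => ?_)
    have : x = ![x 0] := by ext i; fin_cases i; rfl
    rw [this, ← hev, h]; simp
  have hlc : 0 < |p.leadingCoeff| := abs_pos.2 (Polynomial.leadingCoeff_ne_zero.2 hp0)
  have hθ := p.isEquivalent_atTop_lead
  obtain ⟨r1, h1⟩ := Filter.eventually_atTop.1 (hθ.isLittleO.bound (c := 1 / 2) (by norm_num))
  refine ⟨p.natDegree, |p.leadingCoeff| / 2, 2 * |p.leadingCoeff|, max r1 0, by positivity,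
    by positivity, fun r hr => ?_⟩
  have h2 := h1 r (le_trans (le_max_left _ _) hr)
  have hr0 : 0 ≤ r := le_trans (le_max_right _ _) hr
  simp only [Pi.sub_apply, Real.norm_eq_abs, abs_mul, abs_pow, abs_of_nonneg hr0] at h2
  rw [← hev]
  have h3 := abs_sub_abs_le_abs_sub (p.eval r) (p.leadingCoeff * r ^ p.natDegree)
  have h4 := abs_sub_abs_le_abs_sub (p.leadingCoeff * r ^ p.natDegree) (p.eval r)
  rw [abs_sub_comm (p.leadingCoeff * r ^ p.natDegree)] at h4
  simp only [abs_mul, abs_pow, abs_of_nonneg hr0] at h3 h4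
  have : 0 ≤ |p.leadingCoeff| * r ^ p.natDegree := by positivity
  constructor <;> nlinarith

end IterateSystems

/-! ### Newton polygon and growth of algebraic functions. -/

namespace IterateSystems

open MvPolynomial in
/-- Newton polygon: positive roots of a polynomial with polynomial coefficients grow like one of
finitely many powers of the parameter. -/
theorem exists_slopes_of_root (A : Polynomial (MvPolynomial (Fin 1) ℝ)) (hA : A ≠ 0) :
    ∃ (B : Finset ℝ) (K r₀ : ℝ), 1 ≤ r₀ ∧ ∀ r y, r₀ ≤ r → 0 < y →
      (A.map (eval ![r])).eval y = 0 → ∃ b ∈ B, |Real.log y - b * Real.log r| ≤ K := by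
  classical
  have hth : ∀ j : ℕ, ∃ (d : ℕ) (c C r₀ : ℝ), 0 < c ∧ 0 < C ∧ (j ∈ A.support → ∀ r, r₀ ≤ r →
      c * r ^ d ≤ |eval ![r] (A.coeff j)| ∧ |eval ![r] (A.coeff j)| ≤ C * r ^ d) := by
    intro j
    by_cases hj : j ∈ A.support
    · obtain ⟨d, c, C, r₀, hc, hC, h⟩ := exists_isTheta_eval _ (Polynomial.mem_support_iff.1 hj)
      exact ⟨d, c, C, r₀, hc, hC, fun _ => h⟩
    · exact ⟨0, 1, 1, 0, one_pos, one_pos, fun h => absurd h hj⟩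
  choose d c C r₀ hc hC hth using hth
  set S := A.support with hS
  have hSne : S.Nonempty := Polynomial.nonempty_support_iff.2 hA
  let slope : ℕ × ℕ → ℝ := fun p => ((d p.1 : ℝ) - d p.2) / ((p.2 : ℝ) - p.1)
  let K₁ : ℝ := ∑ j ∈ S, (|Real.log (c j)| + |Real.log (C j)|)
  refine ⟨(S ×ˢ S).image slope, 2 * K₁ + Real.log S.card, 1 + ∑ j ∈ S, |r₀ j|,
    le_add_of_nonneg_right (Finset.sum_nonneg fun _ _ => abs_nonneg _), ?_⟩
  intro r y hr hy hroot
  have hr1 : 1 ≤ r := le_trans (le_add_of_nonneg_right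
    (Finset.sum_nonneg fun _ _ => abs_nonneg _)) hr
  have hr0 : 0 < r := by linarith
  have hrj : ∀ j ∈ S, r₀ j ≤ r := fun j hj => by
    have := Finset.single_le_sum (f := fun j => |r₀ j|) (fun _ _ => abs_nonneg _) hj
    have := le_abs_self (r₀ j)
    linarith
  have hlog : ∀ j ∈ S, 0 < |eval ![r] (A.coeff j)| ∧
      |Real.log |eval ![r] (A.coeff j)| - d j * Real.log r| ≤ K₁ := by
    intro j hj
    obtain ⟨h1, h2⟩ := hth j hj r (hrj j hj)
    have hp : 0 < c j * r ^ d j := mul_pos (hc j) (pow_pos hr0 _)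
    have hpos := lt_of_lt_of_le hp h1
    refine ⟨hpos, ?_⟩
    have h3 := Real.log_le_log hp h1
    have h4 := Real.log_le_log hpos h2
    rw [Real.log_mul (hc j).ne' (pow_pos hr0 _).ne', Real.log_pow] at h3
    rw [Real.log_mul (hC j).ne' (pow_pos hr0 _).ne', Real.log_pow] at h4
    have h5 : |Real.log (c j)| + |Real.log (C j)| ≤ K₁ :=
      Finset.single_le_sum (f := fun j => |Real.log (c j)| + |Real.log (C j)|)
        (fun _ _ => by positivity) hj
    have := neg_abs_le (Real.log (c j))
    have := le_abs_self (Real.log (C j))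
    have := abs_nonneg (Real.log (c j))
    have := abs_nonneg (Real.log (C j))
    rw [abs_le]; constructor <;> linarith
  have hsum : ∑ j ∈ S, eval ![r] (A.coeff j) * y ^ j = 0 := by
    rw [← hroot, Polynomial.eval_map, Polynomial.eval₂_eq_sum, Polynomial.sum]
  -- The terms sum to zero, so the largest one is matched, up to the number of terms, by another
  -- one. Equating the two sizes, with coefficients comparable to `r ^ d i` and `r ^ d j`,
  -- determines `log y` up to a bounded error.
  obtain ⟨j, hj, hjmax⟩ := S.exists_max_image (fun j => |eval ![r] (A.coeff j)| * y ^ j) hSne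
  obtain ⟨i, hi, hij⟩ : ∃ i ∈ S.erase j, |eval ![r] (A.coeff j)| * y ^ j ≤
      S.card * (|eval ![r] (A.coeff i)| * y ^ i) := by
    by_contra! hcon
    have h1 : eval ![r] (A.coeff j) * y ^ j = - ∑ i ∈ S.erase j, eval ![r] (A.coeff i) * y ^ i := by
      rw [← Finset.add_sum_erase S _ hj] at hsum
      linarith
    have hpos : 0 < |eval ![r] (A.coeff j)| * y ^ j := mul_pos (hlog j hj).1 (pow_pos hy _)
    have h2 : |eval ![r] (A.coeff j)| * y ^ j ≤
        ∑ i ∈ S.erase j, |eval ![r] (A.coeff i)| * y ^ i := by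
      calc |eval ![r] (A.coeff j)| * y ^ j = |eval ![r] (A.coeff j) * y ^ j| := by
            rw [abs_mul, abs_of_pos (pow_pos hy j)]
        _ ≤ _ := by
            rw [h1, abs_neg]
            refine (Finset.abs_sum_le_sum_abs _ _).trans (Finset.sum_le_sum fun i _ => ?_)
            rw [abs_mul, abs_of_pos (pow_pos hy i)]
    have hcard : (0 : ℝ) < S.card := by exact_mod_cast Finset.card_pos.2 hSne
    have h3 : S.card * ∑ i ∈ S.erase j, |eval ![r] (A.coeff i)| * y ^ i ≤
        ((S.erase j).card : ℝ) * (|eval ![r] (A.coeff j)| * y ^ j) := by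
      rw [Finset.mul_sum, ← nsmul_eq_mul]
      exact Finset.sum_le_card_nsmul _ _ _ fun i hi => (hcon i hi).le
    rw [Finset.card_erase_of_mem hj, Nat.cast_sub (Finset.card_pos.2 hSne)] at h3
    push_cast at h3
    nlinarith
  obtain ⟨hne, hiS⟩ := Finset.mem_erase.1 hi
  refine ⟨slope (i, j), Finset.mem_image_of_mem _ (Finset.mem_product.2 ⟨hiS, hj⟩), ?_⟩
  obtain ⟨hip, hil⟩ := hlog i hiS
  obtain ⟨hjp, hjl⟩ := hlog j hj
  have hcard : (0 : ℝ) < S.card := by exact_mod_cast Finset.card_pos.2 hSne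
  have hcard1 : (1 : ℝ) ≤ S.card := by exact_mod_cast Finset.card_pos.2 hSne
  have e1 := Real.log_le_log (mul_pos hjp (pow_pos hy _)) hij
  have e2 := Real.log_le_log (mul_pos hip (pow_pos hy _)) (hjmax i hiS)
  rw [Real.log_mul hcard.ne' (mul_pos hip (pow_pos hy _)).ne', Real.log_mul hjp.ne' (pow_pos hy _).ne',
    Real.log_mul hip.ne' (pow_pos hy _).ne', Real.log_pow, Real.log_pow] at e1
  rw [Real.log_mul hjp.ne' (pow_pos hy _).ne',
    Real.log_mul hip.ne' (pow_pos hy _).ne', Real.log_pow, Real.log_pow] at e2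
  have hlc := Real.log_nonneg hcard1
  have h6 : |((j : ℝ) - i) * Real.log y - ((d i : ℝ) - d j) * Real.log r| ≤
      2 * K₁ + Real.log S.card := by
    rw [abs_le] at hil hjl ⊢
    constructor <;> linarith
  have hji : (j : ℝ) - i ≠ 0 := sub_ne_zero.2 (by exact_mod_cast hne.symm)
  -- Distinct integer exponents differ by at least one, so division by `j - i` does not enlarge the
  -- error.
  have hji1 : 1 ≤ |(j : ℝ) - i| := by
    have : (1 : ℤ) ≤ |(j : ℤ) - i| := Int.one_le_abs (sub_ne_zero.2 (by exact_mod_cast hne.symm))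
    exact_mod_cast this
  have h7 : Real.log y - slope (i, j) * Real.log r =
      (((j : ℝ) - i) * Real.log y - ((d i : ℝ) - d j) * Real.log r) / ((j : ℝ) - i) := by
    simp only [slope]; field_simp
  rw [h7, abs_div]
  exact (div_le_self (abs_nonneg _) hji1).trans h6

/-- A function whose values are positive roots of a polynomial with polynomial coefficients and
which grows at most like `r ^ (θ + ε)` for all `ε` grows at most like `r ^ θ`. -/
theorem exists_bound_of_root {X : Type*} (A : Polynomial (MvPolynomial (Fin 1) ℝ)) (hA : A ≠ 0)
    (r y : X → ℝ) (hr : ∀ x, 1 ≤ r x)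
    (hroot : ∀ x, 0 < y x → (A.map (MvPolynomial.eval ![r x])).eval (y x) = 0) (θ : ℝ)
    (hε : ∀ ε : ℝ, 0 < ε → ∃ C : ℝ, ∀ x, y x ≤ C * r x ^ (θ + ε)) :
    ∃ C : ℝ, 0 < C ∧ ∀ x, y x ≤ C * r x ^ θ := by
  obtain ⟨B, K, r₀, hr₀, hB⟩ := exists_slopes_of_root A hA
  -- As `B` is finite, there is a gap between `θ` and the next slope above it; `ε` is at most half
  -- of that gap.
  obtain ⟨ε, hεpos, hεB⟩ : ∃ ε : ℝ, 0 < ε ∧ ∀ b ∈ B, θ < b → θ + 2 * ε ≤ b := by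
    by_cases h : (B.filter (θ < ·)).Nonempty
    · obtain ⟨b, hb, hmin⟩ := (B.filter (θ < ·)).exists_min_image id h
      refine ⟨(b - θ) / 2, by linarith [(Finset.mem_filter.1 hb).2], fun b' hb' hlt => ?_⟩
      have := hmin b' (Finset.mem_filter.2 ⟨hb', hlt⟩)
      simp only [id] at this
      linarith
    · refine ⟨1, one_pos, fun b hb hlt => absurd ⟨b, Finset.mem_filter.2 ⟨hb, hlt⟩⟩ h⟩
  obtain ⟨C₀, hC₀⟩ := hε ε hεpos
  set C := max C₀ 1 with hCdef
  have hCpos : 0 < C := lt_of_lt_of_le one_pos (le_max_right _ _)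
  have hC : ∀ x, y x ≤ C * r x ^ (θ + ε) := fun x => (hC₀ x).trans
    (mul_le_mul_of_nonneg_right (le_max_left _ _) (Real.rpow_nonneg (by linarith [hr x]) _))
  -- For `log r > R`, a slope `b ≥ θ + 2ε` would contradict the bound with exponent `θ + ε`. For
  -- `log r ≤ R`, the surplus factor `r ^ ε` is at most `exp (ε R)`.
  set R := max (Real.log r₀) ((K + Real.log C) / ε) with hR
  refine ⟨max (C * Real.exp (ε * R)) (Real.exp K), lt_max_of_lt_right (Real.exp_pos _),
    fun x => ?_⟩
  have hr0 : 0 < r x := by linarith [hr x]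
  have hrθ : 0 ≤ r x ^ θ := Real.rpow_nonneg hr0.le _
  by_cases hy : 0 < y x
  swap
  · exact (not_lt.1 hy).trans (mul_nonneg (le_max_of_le_right (Real.exp_pos _).le) hrθ)
  by_cases hlog : Real.log (r x) ≤ R
  · refine (hC x).trans ?_
    rw [Real.rpow_add hr0, mul_comm (r x ^ θ), ← mul_assoc]
    refine mul_le_mul_of_nonneg_right (le_max_of_le_left ?_) hrθ
    refine mul_le_mul_of_nonneg_left ?_ hCpos.le
    rw [Real.rpow_def_of_pos hr0, Real.exp_le_exp]
    nlinarith
  · push Not at hlog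
    obtain ⟨b, hb, hbK⟩ := hB (r x) (y x) ((Real.log_le_log_iff (by linarith) hr0).1
      ((le_max_left _ _).trans hlog.le)) hy (hroot x hy)
    have h0 : 0 ≤ Real.log (r x) := Real.log_nonneg (hr x)
    have h1 : (K + Real.log C) / ε < Real.log (r x) := (le_max_right _ _).trans_lt hlog
    rw [div_lt_iff₀ hεpos] at h1
    have h2 := Real.log_le_log hy (hC x)
    rw [Real.log_mul hCpos.ne' (Real.rpow_pos_of_pos hr0 _).ne', Real.log_rpow hr0] at h2
    rw [abs_le] at hbK
    have hbθ : b ≤ θ := by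
      by_contra! hlt
      have := hεB b hb hlt
      nlinarith
    have h3 : Real.log (y x) ≤ K + θ * Real.log (r x) := by nlinarith
    rw [Real.log_le_iff_le_exp hy, Real.exp_add, mul_comm θ, ← Real.rpow_def_of_pos hr0] at h3
    exact h3.trans (mul_le_mul_of_nonneg_right (le_max_right _ _) hrθ)

end IterateSystems

/-! ### Suprema on level sets are algebraic functions of the level. -/

namespace IterateSystems

-- After division by the top power of the first variable, which tends to infinity, only the leading
-- coefficient survives in the limit.
open MvPolynomial Filter Topology in
theorem eval_leadingCoeff_eq_zero_of_seq (H : MvPolynomial (Fin 3) ℝ) (r M : ℝ) (ρ y : ℕ → ℝ)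
    (hρ : Tendsto ρ atTop atTop) (hy : Tendsto y atTop (𝓝 M))
    (h : ∀ k, eval ![ρ k, y k, r] H = 0) :
    eval ![M, r] (finSuccEquiv ℝ 2 H).leadingCoeff = 0 := by
  set p := finSuccEquiv ℝ 2 H with hp
  have hsum : ∀ k, ∑ j ∈ Finset.range (p.natDegree + 1),
      eval ![y k, r] (p.coeff j) * ρ k ^ j = 0 := by
    intro k
    have h1 : eval (Fin.cons (ρ k) ![y k, r] : Fin 3 → ℝ) H = 0 := h k
    rw [eval_eq_eval_mv_eval', Polynomial.eval_map, Polynomial.eval₂_eq_sum_range] at h1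
    exact h1
  have hev : ∀ j, Tendsto (fun k => eval ![y k, r] (p.coeff j)) atTop
      (𝓝 (eval ![M, r] (p.coeff j))) := by
    intro j
    refine ((MvPolynomial.continuous_eval (p.coeff j)).tendsto _).comp ?_
    rw [tendsto_pi_nhds]
    intro i
    fin_cases i
    · exact hy
    · exact tendsto_const_nhds
  have hlim : Tendsto (fun k => ∑ j ∈ Finset.range (p.natDegree + 1),
      eval ![y k, r] (p.coeff j) * (ρ k ^ j / ρ k ^ p.natDegree)) atTop
      (𝓝 (∑ j ∈ Finset.range (p.natDegree + 1),
        eval ![M, r] (p.coeff j) * (if j = p.natDegree then 1 else 0))) := by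
    refine tendsto_finsetSum _ fun j hj => (hev j).mul ?_
    split_ifs with hjd
    · subst hjd
      refine tendsto_const_nhds.congr' ?_
      filter_upwards [hρ.eventually_gt_atTop 0] with k hk
      rw [div_self (pow_pos hk _).ne']
    · have hlt : j < p.natDegree := by
        have := Finset.mem_range.1 hj
        omega
      exact (tendsto_pow_div_pow_atTop_zero hlt).comp hρ
  have h0 : Tendsto (fun k => ∑ j ∈ Finset.range (p.natDegree + 1),
      eval ![y k, r] (p.coeff j) * (ρ k ^ j / ρ k ^ p.natDegree)) atTop (𝓝 0) := by
    refine tendsto_const_nhds.congr fun k => ?_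
    simp only [← mul_div_assoc]
    rw [← Finset.sum_div, hsum, zero_div]
  have := tendsto_nhds_unique hlim h0
  simpa using this

open MvPolynomial Filter Topology in
/-- The supremum of a polynomial on the level sets of another one is an algebraic function of the
level. -/
theorem exists_relation_sup {n : ℕ} (F G : MvPolynomial (Fin n) ℝ) :
    ∃ A : Polynomial (MvPolynomial (Fin 1) ℝ), A ≠ 0 ∧ ∀ (x₀ : Fin n → ℝ) (M : ℝ),
      IsLUB {y | ∃ x, eval x F = eval x₀ F ∧ eval x G = y} M →
        (A.map (eval ![eval x₀ F])).eval M = 0 := by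
  -- The squared norm makes the sets `{F = r, N ≤ R}` compact. The relation `H₂` serves a supremum
  -- that is attained. For one that is approached only at infinity, `H₃` holds along maximisers with
  -- `N → ∞`, and its leading coefficient in `N` gives the relation in the limit.
  let N : MvPolynomial (Fin n) ℝ := ∑ l, X l ^ 2
  have hN : ∀ x, eval x N = ∑ l, x l ^ 2 := fun x => by simp [N]
  obtain ⟨H₂, hne₂, hH₂⟩ := exists_ne_zero_eval_extremum 1 ![G, F] 0
  obtain ⟨H₃, hne₃, hH₃⟩ := exists_ne_zero_eval_extremum 2 ![N, G, F] 1
  have hlc : (finSuccEquiv ℝ 2 H₃).leadingCoeff ≠ 0 := by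
    simpa using hne₃
  refine ⟨finSuccEquiv ℝ 1 (H₂ * (finSuccEquiv ℝ 2 H₃).leadingCoeff), ?_, fun x₀ M hM => ?_⟩
  · simpa using ⟨hne₂, hne₃⟩
  rw [← eval_eq_eval_mv_eval', map_mul, mul_eq_zero]
  set r := eval x₀ F with hr
  by_cases hatt : ∃ x, eval x F = r ∧ eval x G = M
  · left
    obtain ⟨x, hxF, hxG⟩ := hatt
    have h1 := hH₂ x fun z hz => by
      have h2 : eval z F = eval x F := by simpa using hz 1 (by decide)
      have h3 : eval z G ≤ M := hM.1 ⟨z, h2.trans hxF, rfl⟩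
      simpa [hxG] using h3
    convert h1 using 3
    funext i
    fin_cases i
    · simp [hxG]
    · simp [hxF]
  · right
    have hcompact : ∀ R : ℝ, IsCompact {x : Fin n → ℝ | eval x F = r ∧ eval x N ≤ R} := by
      intro R
      refine Metric.isCompact_of_isClosed_isBounded ?_ ?_
      · exact (isClosed_eq (MvPolynomial.continuous_eval F) continuous_const).inter
          (isClosed_le (MvPolynomial.continuous_eval N) continuous_const)
      · refine (Metric.isBounded_closedBall (x := (0 : Fin n → ℝ)) (r := 1 + |R|)).subset ?_
        rintro x ⟨-, hx⟩
        rw [mem_closedBall_zero_iff, pi_norm_le_iff_of_nonneg (by positivity)]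
        intro l
        rw [hN] at hx
        have h1 := Finset.single_le_sum (f := fun l => x l ^ 2) (fun _ _ => sq_nonneg _)
          (Finset.mem_univ l)
        have h2 : x l ^ 2 ≤ |R| := h1.trans (hx.trans (le_abs_self R))
        rw [Real.norm_eq_abs]
        refine abs_le_of_sq_le_sq (h2.trans ?_) (by positivity)
        nlinarith [abs_nonneg R]
    have hmax : ∀ R : ℝ, ∀ x', eval x' F = r → eval x' N ≤ R → ∃ x, eval x F = r ∧
        eval x N ≤ R ∧ ∀ z, eval z F = r → eval z N ≤ R → eval z G ≤ eval x G := by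
      intro R x' h1 h2
      obtain ⟨x, hx, hmx⟩ := (hcompact R).exists_isMaxOn ⟨x', h1, h2⟩
        (MvPolynomial.continuous_eval G).continuousOn
      exact ⟨x, hx.1, hx.2, fun z hz1 hz2 => hmx ⟨hz1, hz2⟩⟩
    have hlt : ∀ x, eval x F = r → eval x G < M := fun x hx =>
      lt_of_le_of_ne (hM.1 ⟨x, hx, rfl⟩) fun h => hatt ⟨x, hx, h⟩
    have hkey : ∀ k : ℕ, ∃ x, eval x F = r ∧ (k : ℝ) ≤ eval x N ∧ M - 1 / (k + 1) ≤ eval x G ∧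
        eval ![eval x N, eval x G, r] H₃ = 0 := by
      intro k
      -- On `{F = r, N ≤ k}` the values of `G` stay below some `m < M`, because the supremum is not
      -- attained. A maximiser with value above `m` must therefore satisfy `N ≥ k`.
      obtain ⟨m, hmM, hm⟩ : ∃ m < M, ∀ z, eval z F = r → eval z N ≤ k → eval z G ≤ m := by
        by_cases hne : ∃ x', eval x' F = r ∧ eval x' N ≤ k
        · obtain ⟨x', h1, h2⟩ := hne
          obtain ⟨x, h3, -, h4⟩ := hmax k x' h1 h2
          exact ⟨_, hlt x h3, h4⟩
        · push Not at hne
          exact ⟨M - 1, by linarith, fun z h1 h2 => absurd h2 (not_le.2 (hne z h1))⟩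
      have hlt2 : max m (M - 1 / (k + 1)) < M := max_lt hmM (by
        have : (0 : ℝ) < 1 / (k + 1) := by positivity
        linarith)
      obtain ⟨_, ⟨x', hx'F, rfl⟩, hx'⟩ := (lt_isLUB_iff hM).1 hlt2
      obtain ⟨x, hxF, hxN, hx⟩ := hmax (eval x' N) x' hx'F le_rfl
      have hge := hx x' hx'F le_rfl
      refine ⟨x, hxF, ?_, ?_, ?_⟩
      · by_contra! hcon
        have := hm x hxF hcon.le
        have := (le_max_left m (M - 1 / (k + 1))).trans_lt hx'
        linarith
      · have := (le_max_right m (M - 1 / (k + 1))).trans_lt hx'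
        linarith
      · have h1 := hH₃ x fun z hz => by
          have h2 : eval z F = eval x F := by simpa using hz 2 (by decide)
          have h3 : eval z N = eval x N := by simpa using hz 0 (by decide)
          simpa using hx z (h2.trans hxF) (h3.le.trans hxN)
        convert h1 using 3
        funext i
        fin_cases i
        · simp
        · simp
        · simp [hxF]
    choose x hxF hxN hxG hxH using hkey
    refine eval_leadingCoeff_eq_zero_of_seq H₃ r M (fun k => eval (x k) N) (fun k => eval (x k) G)
      (tendsto_atTop_mono hxN tendsto_natCast_atTop_atTop) ?_ hxH
    refine tendsto_of_tendsto_of_tendsto_of_le_of_le (g := fun k : ℕ => M - 1 / ((k : ℝ) + 1)) ?_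
      tendsto_const_nhds hxG fun k => (hlt _ (hxF k)).le
    simpa using (tendsto_const_nhds (x := M)).sub
      (tendsto_one_div_add_atTop_nhds_zero_nat (𝕜 := ℝ))

open MvPolynomial in
/-- If a nonnegative polynomial is dominated by all powers `F ^ (θ + ε)` of another polynomial,
then it is dominated by `F ^ θ`. -/
theorem exists_bound_rpow_of_forall_pos {n : ℕ} (F G : MvPolynomial (Fin n) ℝ)
    (hF : ∀ x, 1 ≤ eval x F) (θ : ℝ)
    (hε : ∀ ε : ℝ, 0 < ε → ∃ C : ℝ, ∀ x, eval x G ≤ C * eval x F ^ (θ + ε)) :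
    ∃ C : ℝ, 0 < C ∧ ∀ x, eval x G ≤ C * eval x F ^ θ := by
  obtain ⟨A, hA, hrel⟩ := exists_relation_sup F G
  have hbdd : ∀ x₀, BddAbove {y | ∃ x, eval x F = eval x₀ F ∧ eval x G = y} := by
    intro x₀
    obtain ⟨C, hC⟩ := hε 1 one_pos
    refine ⟨C * eval x₀ F ^ (θ + 1), ?_⟩
    rintro _ ⟨x, hx, rfl⟩
    rw [← hx]
    exact hC x
  have hlub : ∀ x₀, IsLUB {y | ∃ x, eval x F = eval x₀ F ∧ eval x G = y}
      (sSup {y | ∃ x, eval x F = eval x₀ F ∧ eval x G = y}) := fun x₀ =>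
    isLUB_csSup ⟨_, x₀, rfl, rfl⟩ (hbdd x₀)
  -- The Newton polygon is applied to the supremum of `G` on the level set through `x₀`. It inherits
  -- the bounds `hε`, since these depend on the point only through the value of `F`.
  obtain ⟨C, hC, h⟩ := exists_bound_of_root A hA (fun x₀ : Fin n → ℝ => eval x₀ F)
    (fun x₀ => sSup {y | ∃ x, eval x F = eval x₀ F ∧ eval x G = y}) hF
    (fun x₀ _ => hrel x₀ _ (hlub x₀)) θ fun ε hpos => by
      obtain ⟨C, hC⟩ := hε ε hpos
      refine ⟨C, fun x₀ => (hlub x₀).2 ?_⟩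
      rintro _ ⟨x, hx, rfl⟩
      rw [← hx]
      exact hC x
  exact ⟨C, hC, fun x => ((hlub x).1 ⟨x, rfl, rfl⟩).trans (h x)⟩

end IterateSystems

/-! ### Taylor coefficients of polynomials and an abstract Leibniz rule. -/

noncomputable section

namespace IterateSystems

open MvPolynomial

/-- The polynomial `p(X + Y)` as a polynomial in `Y` with coefficients in `ℂ[X]`. -/
def taylorShift (n : ℕ) :
    MvPolynomial (Fin n) ℂ →ₐ[ℂ] MvPolynomial (Fin n) (MvPolynomial (Fin n) ℂ) :=
  aeval fun i => C (X i) + X i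

/-- The Taylor coefficient `p^{(α)} / α!` of a polynomial. -/
def hasse {n : ℕ} (α : Fin n →₀ ℕ) (p : MvPolynomial (Fin n) ℂ) : MvPolynomial (Fin n) ℂ :=
  coeff α (taylorShift n p)

section hasse

variable {n : ℕ}

theorem hasse_zero_left (p : MvPolynomial (Fin n) ℂ) : hasse 0 p = p := by
  have h : ((constantCoeff : MvPolynomial (Fin n) (MvPolynomial (Fin n) ℂ) →+* _).comp
      (taylorShift n).toRingHom) = RingHom.id _ := by
    refine MvPolynomial.ringHom_ext (fun r => ?_) fun i => ?_
    · simp [taylorShift, MvPolynomial.algebraMap_apply, MvPolynomial.algebraMap_eq]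
    · simp [taylorShift]
  exact congrArg (fun g => g p) h

theorem pderiv_taylorShift (i : Fin n) (p : MvPolynomial (Fin n) ℂ) :
    pderiv i (taylorShift n p) = taylorShift n (pderiv i p) := by
  classical
  induction p using MvPolynomial.induction_on with
  | C a =>
    rw [pderiv_C, map_zero]
    simp [taylorShift, MvPolynomial.algebraMap_apply]
  | add p q hp hq => simp [hp, hq]
  | mul_X p j hp =>
    have h1 : taylorShift n (X j) = C (X j) + X j := by simp [taylorShift]
    have h2 : pderiv i (taylorShift n (X j)) = taylorShift n (pderiv i (X j)) := by
      rw [h1, map_add, pderiv_C, zero_add, pderiv_X, pderiv_X]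
      rcases eq_or_ne i j with rfl | h
      · simp
      · simp [h.symm]
    rw [map_mul, pderiv_mul (f := taylorShift n p), hp, h2, pderiv_mul (f := p), map_add, map_mul,
      map_mul]

theorem succ_mul_hasse_add_single (α : Fin n →₀ ℕ) (i : Fin n) (p : MvPolynomial (Fin n) ℂ) :
    ((α i : ℂ) + 1) • hasse (α + Finsupp.single i 1) p = hasse α (pderiv i p) := by
  rw [hasse, hasse, ← pderiv_taylorShift, coeff_pderiv, smul_eq_C_mul, mul_comm]
  simp

theorem hasse_eq_zero_of_totalDegree_lt {α : Fin n →₀ ℕ} {p : MvPolynomial (Fin n) ℂ}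
    (h : p.totalDegree < α.degree) : hasse α p = 0 := by
  refine coeff_eq_zero_of_totalDegree_lt (lt_of_le_of_lt ?_ h)
  rw [taylorShift, aeval_def, eval₂_eq']
  refine (totalDegree_finsetSum _ _).trans (Finset.sup_le fun s hs => ?_)
  refine (totalDegree_mul _ _).trans ?_
  rw [MvPolynomial.algebraMap_apply, totalDegree_C, zero_add]
  refine (totalDegree_finsetProd _ _).trans ?_
  refine le_trans (Finset.sum_le_sum (g := fun i => s i) fun i _ => ?_) ?_
  · refine (totalDegree_pow _ _).trans ?_
    have : (C (X i) + X i : MvPolynomial (Fin n) (MvPolynomial (Fin n) ℂ)).totalDegree ≤ 1 :=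
      (totalDegree_add _ _).trans (by simp)
    nlinarith
  · refine le_trans ?_ (le_totalDegree hs)
    rw [Finsupp.sum_fintype _ _ fun _ => rfl]

theorem hasse_iterate_pderiv (i : Fin n) (k : ℕ) (α : Fin n →₀ ℕ) :
    ∃ c : ℂ, c ≠ 0 ∧ ∀ p, hasse α ((pderiv i)^[k] p) = c • hasse (α + Finsupp.single i k) p := by
  induction k generalizing α with
  | zero => exact ⟨1, one_ne_zero, fun p => by simp⟩
  | succ k ih =>
    obtain ⟨c, hc, h⟩ := ih (α + Finsupp.single i 1)
    have hpos : ((α i : ℂ) + 1) ≠ 0 := by exact_mod_cast Nat.succ_ne_zero (α i)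
    refine ⟨((α i : ℂ) + 1) * c, mul_ne_zero hpos hc, fun p => ?_⟩
    rw [Function.iterate_succ_apply', ← succ_mul_hasse_add_single, h, smul_smul, add_assoc,
      ← Finsupp.single_add, add_comm 1 k]

/-- The factor is `α!`. Only its nonvanishing is recorded, which suffices for estimates up to
constants. -/
theorem exists_symbDeriv_eq_smul_hasse (α : Fin n → ℕ) :
    ∃ c : ℂ, c ≠ 0 ∧ ∀ p, symbDeriv α p = c • hasse (Finsupp.equivFunOnFinite.symm α) p := by
  have key : ∀ (l : List (Fin n)) (β : Fin n →₀ ℕ), ∃ c : ℂ, c ≠ 0 ∧ ∀ p,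
      hasse β ((l.map fun j => (fun q : MvPolynomial (Fin n) ℂ => pderiv j q)^[α j]).foldr
        (fun g h => g ∘ h) id p) = c • hasse (β + (l.map fun j => Finsupp.single j (α j)).sum) p := by
    intro l
    induction l with
    | nil => exact fun β => ⟨1, one_ne_zero, fun p => by simp⟩
    | cons j l ih =>
      intro β
      obtain ⟨c, hc, h⟩ := hasse_iterate_pderiv j (α j) β
      obtain ⟨c', hc', h'⟩ := ih (β + Finsupp.single j (α j))
      refine ⟨c * c', mul_ne_zero hc hc', fun p => ?_⟩
      rw [List.map_cons, List.foldr_cons, Function.comp_apply, h, h', smul_smul, List.map_cons,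
        List.sum_cons, add_assoc]
  obtain ⟨c, hc, h⟩ := key (List.finRange n) 0
  refine ⟨c, hc, fun p => ?_⟩
  rw [← hasse_zero_left (symbDeriv α p), symbDeriv, iterComp, List.ofFn_eq_map, h, zero_add]
  congr 2
  rw [← List.ofFn_eq_map, List.sum_ofFn]
  ext i
  simp [Finsupp.single_apply]

/-- Abstract Leibniz rule. -/
theorem leibniz_abstract {M : Type*} [AddCommGroup M] [Module ℂ M]
    (Φ : (Fin n →₀ ℕ) → MvPolynomial (Fin n) ℂ →ₗ[ℂ] M) (Ψ : MvPolynomial (Fin n) ℂ →ₗ[ℂ] M)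
    (δ : Fin n → M →ₗ[ℂ] M) (hΨ : ∀ i p, Ψ (p * X i) = δ i (Ψ p)) (h1 : Ψ 1 = Φ 0 1)
    (hΦ : ∀ α i p, δ i (Φ α p) = Φ (α + Finsupp.single i 1) p + Φ α (X i * p))
    (p : MvPolynomial (Fin n) ℂ) :
    Ψ p = ∑ α ∈ (taylorShift n p).support, Φ α (hasse α p) := by
  classical
  -- `Λ` replaces each monomial `a Y^α` by `Φ α a`. The point is `hΛ`: multiplication by `X_i + Y_i`
  -- becomes `δ i`, so `Ψ` and `Λ` after the shift obey the same recursion in `p`. Evaluation at a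
  -- sum and differentiation of a product are both instances.
  obtain ⟨Λ, hΛdef⟩ : ∃ Λ : MvPolynomial (Fin n) (MvPolynomial (Fin n) ℂ) → M,
    Λ = fun q => ∑ᶠ α, Φ α (coeff α q) := ⟨_, rfl⟩
  have hsupp : ∀ q, (Function.support fun α => Φ α (coeff α q)) ⊆ q.support := by
    intro q α hα
    rw [Finset.mem_coe, mem_support_iff]
    intro h
    exact hα (by simp [h])
  have hΛsum : ∀ q, Λ q = ∑ α ∈ q.support, Φ α (coeff α q) := fun q => by
    rw [hΛdef]; exact finsum_eq_sum_of_support_subset _ (hsupp q)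
  have hΛadd : ∀ q q', Λ (q + q') = Λ q + Λ q' := fun q q' => by
    simp only [hΛdef, coeff_add, map_add]
    exact finsum_add_distrib ((Finset.finite_toSet _).subset (hsupp q))
      ((Finset.finite_toSet _).subset (hsupp q'))
  have hΛmon : ∀ α a, Λ (monomial α a) = Φ α a := fun α a => by
    rw [hΛdef]
    simp only [coeff_monomial]
    rw [finsum_eq_single _ α fun β hβ => by simp [hβ.symm]]
    simp
  have hΛ : ∀ i q, Λ (q * (C (X i) + X i)) = δ i (Λ q) := by
    intro i q
    induction q using MvPolynomial.induction_on' with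
    | monomial α a =>
      have hX : monomial α a * X i = monomial (α + Finsupp.single i 1) a := by
        rw [X, monomial_mul, mul_one]
      rw [mul_add, hΛadd, hΛmon, hΦ, mul_comm, C_mul_monomial, hΛmon, hX, hΛmon, add_comm]
    | add q q' h h' => rw [add_mul, hΛadd, h, h', hΛadd, map_add]
  have : Ψ p = Λ (taylorShift n p) := by
    induction p using MvPolynomial.induction_on with
    | C a =>
      have h2 : taylorShift n (C a) = monomial 0 (C a) := by
        simp [taylorShift, MvPolynomial.algebraMap_apply, MvPolynomial.algebraMap_eq]
      have h3 : (C a : MvPolynomial (Fin n) ℂ) = a • 1 := by rw [smul_eq_C_mul, mul_one]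
      rw [h2, hΛmon, h3, map_smul, map_smul, h1]
    | add p q hp hq => rw [map_add, hp, hq, map_add, hΛadd]
    | mul_X p i hp =>
      have h2 : taylorShift n (X i) = C (X i) + X i := by simp [taylorShift]
      rw [hΨ, hp, map_mul, h2, hΛ]
  rw [this, hΛsum]; rfl

theorem eval_add_eq_sum_hasse (x y : Fin n → ℂ) (p : MvPolynomial (Fin n) ℂ) :
    eval (fun i => x i + y i) p =
      ∑ α ∈ (taylorShift n p).support, (∏ i, y i ^ α i) * eval x (hasse α p) := by
  have := leibniz_abstract (M := ℂ)
    (fun α => (LinearMap.lsmul ℂ ℂ (∏ i, y i ^ α i)).comp (aeval x).toLinearMap)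
    (aeval fun i => x i + y i).toLinearMap (fun i => LinearMap.lsmul ℂ ℂ (x i + y i))
    (fun i p => by simp only [AlgHom.toLinearMap_apply, map_mul, aeval_X, LinearMap.lsmul_apply,
      smul_eq_mul, mul_comm]) (by simp) (fun α i p => by
      simp only [LinearMap.coe_comp, Function.comp_apply, AlgHom.toLinearMap_apply, map_mul,
        aeval_X, LinearMap.lsmul_apply, smul_eq_mul, Finsupp.add_apply, pow_add,
        Finset.prod_mul_distrib]
      have : ∏ j, y j ^ (Finsupp.single i 1) j = y i := by
        rw [Finset.prod_eq_single i] <;> simp +contextual [eq_comm]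
      rw [this]; ring) p
  simpa [coe_aeval_eq_eval] using this

end hasse

end IterateSystems

end

/-! ### Condition `(ℋ)` by Taylor coefficients, and attainment of the infimum. -/

noncomputable section

namespace IterateSystems

open MvPolynomial

/-- The size `1 + ∑_j |P_j(ξ)|` of the symbols of a system. -/
def symbSize {n N : ℕ} (P : Fin N → MvPolynomial (Fin n) ℂ) (ξ : EuclideanSpace ℝ (Fin n)) : ℝ :=
  1 + ∑ j, ‖symb (P j) ξ‖

theorem one_le_symbSize {n N : ℕ} (P : Fin N → MvPolynomial (Fin n) ℂ)
    (ξ : EuclideanSpace ℝ (Fin n)) : 1 ≤ symbSize P ξ :=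
  le_add_of_nonneg_right (Finset.sum_nonneg fun _ _ => norm_nonneg _)

theorem norm_symb_le_symbSize {n N : ℕ} (P : Fin N → MvPolynomial (Fin n) ℂ) (j : Fin N)
    (ξ : EuclideanSpace ℝ (Fin n)) : ‖symb (P j) ξ‖ ≤ symbSize P ξ := by
  have := Finset.single_le_sum (f := fun j => ‖symb (P j) ξ‖) (fun _ _ => norm_nonneg _)
    (Finset.mem_univ j)
  simp only [symbSize]
  linarith

theorem symb_smul {n : ℕ} (c : ℂ) (p : MvPolynomial (Fin n) ℂ) (ξ : EuclideanSpace ℝ (Fin n)) :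
    symb (c • p) ξ = c * symb p ξ := by
  simp [symb, smul_eval]

theorem finite_degree_le (n m : ℕ) : {α : Fin n →₀ ℕ | α.degree ≤ m}.Finite := by
  refine (Set.finite_Iic (Finsupp.equivFunOnFinite.symm fun _ : Fin n => m)).subset fun α hα i => ?_
  exact (Finsupp.le_degree i α).trans hα

/-- Condition `(ℋ)` in terms of the Taylor coefficients of the symbols. -/
theorem condHWith_iff_hasse {n N m : ℕ} {P : Fin N → MvPolynomial (Fin n) ℂ} (hPm : HasOrder P m)
    (γ : ℝ) : CondHWith P γ ↔ ∀ α : Fin n →₀ ℕ, α.degree ≤ m → ∃ C : ℝ, 0 < C ∧ ∀ ξ j,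
      ‖symb (hasse α (P j)) ξ‖ ≤ C * symbSize P ξ ^ (1 - (α.degree : ℝ) / γ) := by
  constructor
  · rintro ⟨C, hC, h⟩ α -
    obtain ⟨c, hc, hcα⟩ := exists_symbDeriv_eq_smul_hasse α
    rw [show Finsupp.equivFunOnFinite.symm ⇑α = α from Equiv.symm_apply_apply _ α] at hcα
    refine ⟨‖c‖⁻¹ * C, by positivity, fun ξ j => ?_⟩
    have h1 := h α ξ
    have h2 := Finset.single_le_sum (f := fun j => ‖symb (symbDeriv α (P j)) ξ‖)
      (fun _ _ => norm_nonneg _) (Finset.mem_univ j)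
    have h3 := h2.trans h1
    simp only [hcα, symb_smul, norm_mul] at h3
    rw [← Finsupp.degree_eq_sum] at h3
    rw [mul_assoc, ← div_eq_inv_mul, le_div_iff₀' (norm_pos_iff.2 hc)]
    exact h3
  · intro h
    have h' : ∀ α : Fin n →₀ ℕ, ∃ C : ℝ, 0 < C ∧ (α.degree ≤ m → ∀ ξ j,
        ‖symb (hasse α (P j)) ξ‖ ≤ C * symbSize P ξ ^ (1 - (α.degree : ℝ) / γ)) := by
      intro α
      by_cases hα : α.degree ≤ m
      · obtain ⟨C, hC, h⟩ := h α hα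
        exact ⟨C, hC, fun _ => h⟩
      · exact ⟨1, one_pos, fun h => absurd h hα⟩
    choose C hC h' using h'
    have hc : ∀ α : Fin n → ℕ, ∃ c : ℂ, ∀ p, symbDeriv α p =
        c • hasse (Finsupp.equivFunOnFinite.symm α) p := fun α =>
      let ⟨c, _, h⟩ := exists_symbDeriv_eq_smul_hasse α
      ⟨c, h⟩
    choose c hc using hc
    -- Derivatives of order above `m` vanish, so finitely many constants can be added into one.
    set S := (finite_degree_le n m).toFinset with hS
    have hterm : ∀ α ∈ S, 0 ≤ N * (‖c α‖ * C α) := fun α _ => by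
      have := hC α
      positivity
    refine ⟨1 + ∑ α ∈ S, N * (‖c α‖ * C α), ?_, fun α ξ => ?_⟩
    · have := Finset.sum_nonneg hterm
      linarith
    · change _ ≤ _ * symbSize P ξ ^ _
      have hpos : 0 ≤ symbSize P ξ ^ (1 - ((∑ i, α i : ℕ) : ℝ) / γ) :=
        Real.rpow_nonneg (by linarith [one_le_symbSize P ξ]) _
      have hdeg : (Finsupp.equivFunOnFinite.symm α).degree = ∑ i, α i := by
        rw [Finsupp.degree_eq_sum]; rfl
      by_cases hα : ∑ i, α i ≤ m
      · have hmem : Finsupp.equivFunOnFinite.symm α ∈ S := by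
          rw [hS, Set.Finite.mem_toFinset, Set.mem_ofPred_eq, hdeg]; exact hα
        have h1 : ∑ j, ‖symb (symbDeriv α (P j)) ξ‖ ≤
            N * (‖c α‖ * C (Finsupp.equivFunOnFinite.symm α)) *
              symbSize P ξ ^ (1 - ((∑ i, α i : ℕ) : ℝ) / γ) := by
          have : ∀ j ∈ Finset.univ, ‖symb (symbDeriv α (P j)) ξ‖ ≤
              (‖c α‖ * C (Finsupp.equivFunOnFinite.symm α)) *
              symbSize P ξ ^ (1 - ((∑ i, α i : ℕ) : ℝ) / γ) := by
            intro j _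
            rw [hc, symb_smul, norm_mul, mul_assoc]
            refine mul_le_mul_of_nonneg_left ?_ (norm_nonneg _)
            have := h' (Finsupp.equivFunOnFinite.symm α) (hdeg ▸ hα) ξ j
            rwa [hdeg] at this
          refine (Finset.sum_le_card_nsmul _ _ _ this).trans ?_
          rw [Finset.card_univ, Fintype.card_fin, nsmul_eq_mul]
          exact (mul_assoc _ _ _).symm.le
        refine h1.trans (mul_le_mul_of_nonneg_right ?_ hpos)
        have h2 := Finset.single_le_sum (f := fun α : Fin n →₀ ℕ => N * (‖c α‖ * C α)) hterm hmem
        have h3 : c (Finsupp.equivFunOnFinite.symm α) = c α := rfl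
        rw [h3] at h2
        linarith
      · have h0 : ∀ j, symbDeriv α (P j) = 0 := fun j => by
          rw [hc, hasse_eq_zero_of_totalDegree_lt, smul_zero]
          rw [hPm j, hdeg]; omega
        simp only [h0, symb, map_zero, norm_zero, Finset.sum_const_zero]
        refine mul_nonneg ?_ hpos
        have := Finset.sum_nonneg hterm
        linarith

theorem exists_re_im_eval {n : ℕ} (p : MvPolynomial (Fin n) ℂ) :
    ∃ a b : MvPolynomial (Fin n) ℝ, ∀ x : Fin n → ℝ,
      eval (fun i => (x i : ℂ)) p = (eval x a : ℂ) + (eval x b : ℂ) * Complex.I := by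
  induction p using MvPolynomial.induction_on with
  | C z =>
    refine ⟨C z.re, C z.im, fun x => ?_⟩
    simp only [eval_C]
    exact (Complex.re_add_im z).symm
  | add p q hp hq =>
    obtain ⟨a, b, h⟩ := hp
    obtain ⟨a', b', h'⟩ := hq
    refine ⟨a + a', b + b', fun x => ?_⟩
    simp only [map_add, h, h', Complex.ofReal_add]
    ring
  | mul_X p i hp =>
    obtain ⟨a, b, h⟩ := hp
    refine ⟨a * X i, b * X i, fun x => ?_⟩
    simp only [map_mul, h, eval_X, Complex.ofReal_mul]
    ring

theorem exists_eval_eq_norm_sq {n : ℕ} (p : MvPolynomial (Fin n) ℂ) :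
    ∃ q : MvPolynomial (Fin n) ℝ, ∀ ξ : EuclideanSpace ℝ (Fin n),
      eval (fun i => ξ i) q = ‖symb p ξ‖ ^ 2 := by
  obtain ⟨a, b, h⟩ := exists_re_im_eval p
  refine ⟨a ^ 2 + b ^ 2, fun ξ => ?_⟩
  rw [symb, h fun i => ξ i, ← Complex.normSq_eq_norm_sq, Complex.normSq_add_mul_I]
  simp

theorem bddBelow_condHWith {n N m : ℕ} {P : Fin N → MvPolynomial (Fin n) ℂ} :
    BddBelow {γ : ℝ | (m : ℝ) ≤ γ ∧ CondHWith P γ} := ⟨m, fun _ h => h.1⟩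

theorem le_gammaOf {n N m : ℕ} {P : Fin N → MvPolynomial (Fin n) ℂ} (hP : CondH P m) :
    (m : ℝ) ≤ gammaOf P m :=
  le_csInf hP fun _ h => h.1

/-- The infimum defining `γ_P` is attained. -/
theorem condHWith_gammaOf {n N m : ℕ} (hm : 0 < m) {P : Fin N → MvPolynomial (Fin n) ℂ}
    (hPm : HasOrder P m) (hP : CondH P m) : CondHWith P (gammaOf P m) := by
  rw [condHWith_iff_hasse hPm]
  intro α hα
  set γ₀ := gammaOf P m with hγ₀
  have hmγ : (m : ℝ) ≤ γ₀ := le_gammaOf hP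
  have hm' : (0 : ℝ) < m := by exact_mod_cast hm
  have hγpos : 0 < γ₀ := hm'.trans_le hmγ
  set k : ℝ := ((α.degree : ℕ) : ℝ) with hk
  have hk0 : 0 ≤ k := Nat.cast_nonneg _
  have hkm : k ≤ m := Nat.cast_le.2 hα
  -- The growth theorem needs real polynomials, so moduli are replaced by their squares. Since `F =
  -- 1 + ∑ |P_j|²` is comparable to `symbSize P ξ ^ 2`, the exponent with respect to `F` is again `1
  -- - k / γ`.
  choose q hq using fun j => exists_eval_eq_norm_sq (P j)
  choose g hg using fun j => exists_eval_eq_norm_sq (hasse α (P j))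
  have hFev : ∀ ξ : EuclideanSpace ℝ (Fin n), eval (fun i => ξ i) (1 + ∑ j, q j) =
      1 + ∑ j, ‖symb (P j) ξ‖ ^ 2 := fun ξ => by simp [hq]
  have hGev : ∀ ξ : EuclideanSpace ℝ (Fin n), eval (fun i => ξ i) (∑ j, g j) =
      ∑ j, ‖symb (hasse α (P j)) ξ‖ ^ 2 := fun ξ => by simp [hg]
  have hF1 : ∀ ξ : EuclideanSpace ℝ (Fin n), 1 ≤ 1 + ∑ j, ‖symb (P j) ξ‖ ^ 2 := fun ξ =>
    le_add_of_nonneg_right (Finset.sum_nonneg fun _ _ => sq_nonneg _)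
  have hfF : ∀ ξ, symbSize P ξ ^ 2 ≤ 2 * (N + 1) * (1 + ∑ j, ‖symb (P j) ξ‖ ^ 2) := by
    intro ξ
    have h1 := sq_sum_le_card_mul_sum_sq (s := Finset.univ) (f := fun j => ‖symb (P j) ξ‖)
    rw [Finset.card_univ, Fintype.card_fin] at h1
    have h2 : 0 ≤ ∑ j, ‖symb (P j) ξ‖ ^ 2 := Finset.sum_nonneg fun _ _ => sq_nonneg _
    have h3 : (0 : ℝ) ≤ N := Nat.cast_nonneg _
    rw [symbSize]
    nlinarith [sq_nonneg (1 - ∑ j, ‖symb (P j) ξ‖)]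
  have hFf : ∀ ξ, 1 + ∑ j, ‖symb (P j) ξ‖ ^ 2 ≤ symbSize P ξ ^ 2 := by
    intro ξ
    have h1 := Finset.sum_sq_le_sq_sum_of_nonneg (s := Finset.univ)
      (f := fun j => ‖symb (P j) ξ‖) fun _ _ => norm_nonneg _
    have h2 : 0 ≤ ∑ j, ‖symb (P j) ξ‖ := Finset.sum_nonneg fun _ _ => norm_nonneg _
    rw [symbSize]
    nlinarith
  have hθ : 0 ≤ 1 - k / γ₀ := by
    rw [sub_nonneg, div_le_one hγpos]; linarith
  obtain ⟨C, hC, hCb⟩ := exists_bound_rpow_of_forall_pos (1 + ∑ j, q j) (∑ j, g j)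
    (fun x => by rw [hFev (WithLp.toLp 2 x)]; exact hF1 _) (1 - k / γ₀) fun ε hε => by
      -- The slack `ε * m` is chosen because `k / γ₀ - k / γ = k (γ - γ₀) / (γ₀ γ)`, where `k ≤ m`
      -- and both exponents are at least `m`; the difference is then at most `ε`.
      obtain ⟨γ, ⟨hγm, hγ⟩, hγlt⟩ := exists_lt_of_csInf_lt hP
        (show gammaOf P m < γ₀ + ε * m by rw [← hγ₀]; nlinarith)
      have hγ0γ : γ₀ ≤ γ := csInf_le bddBelow_condHWith ⟨hγm, hγ⟩
      have hγp : 0 < γ := hγpos.trans_le hγ0γ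
      obtain ⟨C, hC, h⟩ := (condHWith_iff_hasse hPm γ).1 hγ α hα
      have he0 : 0 ≤ 1 - k / γ := by
        rw [sub_nonneg, div_le_one hγp]; linarith
      have heε : 1 - k / γ ≤ 1 - k / γ₀ + ε := by
        have : k / γ₀ - k / γ ≤ ε := by
          rw [div_sub_div _ _ hγpos.ne' hγp.ne', div_le_iff₀ (by positivity)]
          have h1 : k * γ - γ₀ * k ≤ m * (ε * m) := by nlinarith
          have h2 : (m : ℝ) * m ≤ γ₀ * γ := mul_le_mul hmγ hγm hm'.le hγpos.le
          nlinarith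
        linarith
      refine ⟨N * (C ^ 2 * (2 * (N + 1)) ^ (1 - k / γ)), fun x => ?_⟩
      rw [hFev (WithLp.toLp 2 x), hGev (WithLp.toLp 2 x)]
      set ξ : EuclideanSpace ℝ (Fin n) := WithLp.toLp 2 x
      have hterm : ∀ j ∈ Finset.univ, ‖symb (hasse α (P j)) ξ‖ ^ 2 ≤
          C ^ 2 * (2 * (N + 1)) ^ (1 - k / γ) *
            (1 + ∑ j, ‖symb (P j) ξ‖ ^ 2) ^ (1 - k / γ₀ + ε) := by
        intro j _
        have hf0 : 0 ≤ symbSize P ξ := by linarith [one_le_symbSize P ξ]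
        calc ‖symb (hasse α (P j)) ξ‖ ^ 2 ≤ (C * symbSize P ξ ^ (1 - k / γ)) ^ 2 :=
              pow_le_pow_left₀ (norm_nonneg _) (h ξ j) 2
          _ = C ^ 2 * (symbSize P ξ ^ 2) ^ (1 - k / γ) := by
              rw [mul_pow, Real.rpow_pow_comm hf0]
          _ ≤ C ^ 2 * (2 * (N + 1) * (1 + ∑ j, ‖symb (P j) ξ‖ ^ 2)) ^ (1 - k / γ) := by
              refine mul_le_mul_of_nonneg_left ?_ (sq_nonneg _)
              exact Real.rpow_le_rpow (sq_nonneg _) (hfF ξ) he0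
          _ = C ^ 2 * (2 * (N + 1)) ^ (1 - k / γ) * (1 + ∑ j, ‖symb (P j) ξ‖ ^ 2) ^ (1 - k / γ) := by
              rw [Real.mul_rpow (by positivity) (by linarith [hF1 ξ]), mul_assoc]
          _ ≤ _ := by
              refine mul_le_mul_of_nonneg_left ?_ (by positivity)
              exact Real.rpow_le_rpow_of_exponent_le (hF1 ξ) heε
      refine (Finset.sum_le_card_nsmul _ _ _ hterm).trans ?_
      rw [Finset.card_univ, Fintype.card_fin, nsmul_eq_mul]
      exact (mul_assoc _ _ _).symm.le
  refine ⟨Real.sqrt C, Real.sqrt_pos.2 hC, fun ξ j => ?_⟩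
  have hf0 : 0 ≤ symbSize P ξ := by linarith [one_le_symbSize P ξ]
  have h1 := hCb fun i => ξ i
  rw [hFev, hGev] at h1
  have h2 := Finset.single_le_sum (f := fun j => ‖symb (hasse α (P j)) ξ‖ ^ 2)
    (fun _ _ => sq_nonneg _) (Finset.mem_univ j)
  refine (pow_le_pow_iff_left₀ (norm_nonneg _) (by positivity) two_ne_zero).1 ?_
  calc ‖symb (hasse α (P j)) ξ‖ ^ 2 ≤ C * (1 + ∑ j, ‖symb (P j) ξ‖ ^ 2) ^ (1 - k / γ₀) :=
        h2.trans h1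
    _ ≤ C * (symbSize P ξ ^ 2) ^ (1 - k / γ₀) := by
        refine mul_le_mul_of_nonneg_left ?_ hC.le
        exact Real.rpow_le_rpow (by linarith [hF1 ξ]) (hFf ξ) hθ
    _ = _ := by
        rw [mul_pow, Real.sq_sqrt hC.le, Real.rpow_pow_comm hf0]

end IterateSystems

end

/-! ### Slow variation of symbols and invariance of the exponents. -/

noncomputable section

namespace IterateSystems

open MvPolynomial

variable {n N M m : ℕ}

theorem symb_add_eq_sum_hasse (p : MvPolynomial (Fin n) ℂ) (ξ η : EuclideanSpace ℝ (Fin n)) :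
    symb p (ξ + η) =
      ∑ α ∈ (taylorShift n p).support, (∏ i, (η i : ℂ) ^ α i) * symb (hasse α p) ξ := by
  have := eval_add_eq_sum_hasse (fun i => (ξ i : ℂ)) (fun i => (η i : ℂ)) p
  simp only [symb, ← this]
  congr 2
  funext i
  simp

theorem degree_le_of_mem_support_taylorShift {p : MvPolynomial (Fin n) ℂ} {α : Fin n →₀ ℕ}
    (hα : α ∈ (taylorShift n p).support) : α.degree ≤ p.totalDegree := by
  by_contra! h
  exact (mem_support_iff.1 hα) (hasse_eq_zero_of_totalDegree_lt h)

theorem norm_prod_pow_le (η : EuclideanSpace ℝ (Fin n)) (α : Fin n →₀ ℕ) :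
    ‖∏ i, (η i : ℂ) ^ α i‖ ≤ ‖η‖ ^ α.degree := by
  rw [norm_prod, Finsupp.degree_eq_sum, ← Finset.prod_pow_eq_pow_sum]
  refine Finset.prod_le_prod (fun _ _ => norm_nonneg _) fun i _ => ?_
  rw [norm_pow, Complex.norm_real]
  exact pow_le_pow_left₀ (norm_nonneg _) (PiLp.norm_apply_le η i) _

/-- Under `(ℋ)` the size of the symbols varies slowly. -/
theorem exists_symbSize_add_le {P : Fin N → MvPolynomial (Fin n) ℂ} (hPm : HasOrder P m)
    {γ : ℝ} (hγ : 0 < γ) (hP : CondHWith P γ) :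
    ∃ C : ℝ, 0 < C ∧ ∀ ξ η, ‖η‖ ≤ symbSize P ξ ^ (1 / γ) →
      symbSize P (ξ + η) ≤ C * symbSize P ξ := by
  rw [condHWith_iff_hasse hPm] at hP
  have h' : ∀ α : Fin n →₀ ℕ, ∃ C : ℝ, 0 < C ∧ (α.degree ≤ m → ∀ ξ j,
      ‖symb (hasse α (P j)) ξ‖ ≤ C * symbSize P ξ ^ (1 - (α.degree : ℝ) / γ)) := by
    intro α
    by_cases hα : α.degree ≤ m
    · obtain ⟨C, hC, h⟩ := hP α hα
      exact ⟨C, hC, fun _ => h⟩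
    · exact ⟨1, one_pos, fun h => absurd h hα⟩
  choose C hC h' using h'
  refine ⟨1 + ∑ j, ∑ α ∈ (taylorShift n (P j)).support, C α, ?_, fun ξ η hη => ?_⟩
  · have : 0 ≤ ∑ j, ∑ α ∈ (taylorShift n (P j)).support, C α :=
      Finset.sum_nonneg fun _ _ => Finset.sum_nonneg fun α _ => (hC α).le
    linarith
  · have hf := one_le_symbSize P ξ
    have hf0 : 0 < symbSize P ξ := by linarith
    rw [symbSize, add_mul, one_mul, Finset.sum_mul]
    refine add_le_add hf (Finset.sum_le_sum fun j _ => ?_)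
    rw [symb_add_eq_sum_hasse, Finset.sum_mul]
    refine (norm_sum_le _ _).trans (Finset.sum_le_sum fun α hα => ?_)
    have hdeg : α.degree ≤ m := (degree_le_of_mem_support_taylorShift hα).trans (hPm j).le
    rw [norm_mul]
    -- At this scale of `η` the gain `‖η‖ ^ |α|` exactly compensates the loss `-|α| / γ` in the
    -- exponent, for every `α`.
    calc _ ≤ (symbSize P ξ ^ (1 / γ)) ^ α.degree *
          (C α * symbSize P ξ ^ (1 - (α.degree : ℝ) / γ)) := by
            refine mul_le_mul ((norm_prod_pow_le η α).trans ?_) (h' α hdeg ξ j) (norm_nonneg _)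
              (by positivity)
            exact pow_le_pow_left₀ (norm_nonneg _) hη _
      _ = C α * symbSize P ξ := by
            rw [← Real.rpow_natCast, ← Real.rpow_mul hf0.le, mul_left_comm, ← Real.rpow_add hf0]
            congr 1
            conv_rhs => rw [← Real.rpow_one (symbSize P ξ)]
            congr 1
            field_simp
            ring

/-- The point of the integer grid with given coordinates. -/
def gridPoint (κ : Fin n → Fin (m + 1)) : EuclideanSpace ℝ (Fin n) :=
  WithLp.toLp 2 fun i => ((κ i : ℕ) : ℝ)

/-- Taylor coefficients are recovered from finitely many values. -/
theorem exists_weights_hasse (m : ℕ) (α : Fin n →₀ ℕ) (hα : α.degree ≤ m) :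
    ∃ w : (Fin n → Fin (m + 1)) → ℂ, ∀ p : MvPolynomial (Fin n) ℂ, p.totalDegree ≤ m →
      ∀ (ξ : EuclideanSpace ℝ (Fin n)) (r : ℝ),
        ∑ κ, w κ * symb p (ξ + r • gridPoint κ) = (r : ℂ) ^ α.degree * symb (hasse α p) ξ := by
  classical
  -- `W` is the inverse of the Vandermonde matrix with nodes `0, …, m`: its rows extract
  -- coefficients in one variable. Products of its entries do so in `n` variables, as each single
  -- exponent is at most `m`.
  obtain ⟨W, hW⟩ : ∃ W : Fin (m + 1) → Fin (m + 1) → ℂ, ∀ a l : Fin (m + 1),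
      ∑ k, W a k * ((k : ℕ) : ℂ) ^ (l : ℕ) = if a = l then 1 else 0 := by
    let V : Matrix (Fin (m + 1)) (Fin (m + 1)) ℂ := Matrix.vandermonde fun k => ((k : ℕ) : ℂ)
    have hdet : IsUnit V.det := isUnit_iff_ne_zero.2 (Matrix.det_vandermonde_ne_zero_iff.2
      fun a b hab => Fin.ext (by exact_mod_cast hab))
    refine ⟨(V⁻¹ : Matrix (Fin (m + 1)) (Fin (m + 1)) ℂ), fun a l => ?_⟩
    have := congrFun (congrFun (Matrix.nonsing_inv_mul V hdet) a) l
    rw [Matrix.mul_apply, Matrix.one_apply] at this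
    simpa [V, Matrix.vandermonde_apply] using this
  have hαm : ∀ i, α i < m + 1 := fun i => Nat.lt_succ_of_le ((Finsupp.le_degree i α).trans hα)
  refine ⟨fun κ => ∏ i, W ⟨α i, hαm i⟩ (κ i), fun p hp ξ r => ?_⟩
  have h1 : ∀ β ∈ (taylorShift n p).support, ∑ κ : Fin n → Fin (m + 1),
      (∏ i, W ⟨α i, hαm i⟩ (κ i)) * ∏ i, (((r • gridPoint κ : EuclideanSpace ℝ (Fin n)) i : ℝ) : ℂ) ^ β i =
        if α = β then (r : ℂ) ^ α.degree else 0 := by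
    intro β hβ
    have hβm : ∀ i, β i < m + 1 := fun i => Nat.lt_succ_of_le
      ((Finsupp.le_degree i β).trans ((degree_le_of_mem_support_taylorShift hβ).trans hp))
    have h2 : ∀ κ : Fin n → Fin (m + 1), (∏ i, W ⟨α i, hαm i⟩ (κ i)) *
        ∏ i, (((r • gridPoint κ : EuclideanSpace ℝ (Fin n)) i : ℝ) : ℂ) ^ β i =
        (r : ℂ) ^ β.degree * ∏ i, W ⟨α i, hαm i⟩ (κ i) * ((κ i : ℕ) : ℂ) ^ β i := by
      intro κ
      rw [Finsupp.degree_eq_sum, ← Finset.prod_pow_eq_pow_sum, ← Finset.prod_mul_distrib,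
        ← Finset.prod_mul_distrib]
      refine Finset.prod_congr rfl fun i _ => ?_
      simp only [gridPoint, PiLp.smul_apply, smul_eq_mul, Complex.ofReal_mul, mul_pow,
        Complex.ofReal_natCast]
      ring
    simp only [h2]
    have h5 := Finset.prod_univ_sum (fun _ : Fin n => (Finset.univ : Finset (Fin (m + 1))))
      fun i k => W ⟨α i, hαm i⟩ k * ((k : ℕ) : ℂ) ^ β i
    rw [Fintype.piFinset_univ] at h5
    rw [← Finset.mul_sum, ← h5]
    have h3 : ∀ i, ∑ k, W ⟨α i, hαm i⟩ k * ((k : ℕ) : ℂ) ^ β i = if α i = β i then 1 else 0 := by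
      intro i
      have := hW ⟨α i, hαm i⟩ ⟨β i, hβm i⟩
      simpa only [Fin.mk.injEq] using this
    simp only [h3]
    split_ifs with h
    · subst h; simp
    · obtain ⟨i, hi⟩ := DFunLike.ne_iff.1 h
      rw [Finset.prod_eq_zero (Finset.mem_univ i) (if_neg hi), mul_zero]
  simp only [symb_add_eq_sum_hasse, Finset.mul_sum]
  rw [Finset.sum_comm]
  have h4 : ∀ β ∈ (taylorShift n p).support, ∑ κ : Fin n → Fin (m + 1),
      (∏ i, W ⟨α i, hαm i⟩ (κ i)) * ((∏ i, (((r • gridPoint κ : EuclideanSpace ℝ (Fin n)) i : ℝ) : ℂ) ^ β i) *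
        symb (hasse β p) ξ) = if α = β then (r : ℂ) ^ α.degree * symb (hasse α p) ξ else 0 := by
    intro β hβ
    simp only [← mul_assoc]
    rw [← Finset.sum_mul, h1 β hβ]
    split_ifs with h
    · rw [h]
    · rw [zero_mul]
  rw [Finset.sum_congr rfl h4, Finset.sum_ite_eq]
  split_ifs with h
  · rfl
  · have : hasse α p = 0 := by simpa [hasse] using h
    simp [this, symb]

theorem HWeaker.exists_symbSize_le {P : Fin N → MvPolynomial (Fin n) ℂ}
    {Q : Fin M → MvPolynomial (Fin n) ℂ} (h : HWeaker 1 Q P) :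
    ∃ C : ℝ, 0 < C ∧ ∀ ξ, symbSize Q ξ ≤ C * symbSize P ξ := by
  obtain ⟨C, hC, h⟩ := h
  refine ⟨1 + C, by linarith, fun ξ => ?_⟩
  have h1 := h ξ
  rw [Real.rpow_one] at h1
  have h2 := one_le_symbSize P ξ
  rw [add_mul, one_mul]
  exact add_le_add h2 h1

/-- Condition `(ℋ)` with a given exponent only depends on the strength of the system. -/
theorem CondHWith.of_equallyStrong {P : Fin N → MvPolynomial (Fin n) ℂ}
    {Q : Fin M → MvPolynomial (Fin n) ℂ} (hPm : HasOrder P m) (hQm : HasOrder Q m)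
    (hPQ : EquallyStrong 1 P Q) {γ : ℝ} (hγ : 0 < γ) (hP : CondHWith P γ) : CondHWith Q γ := by
  rw [condHWith_iff_hasse hQm]
  intro α hα
  obtain ⟨C₁, hC₁, h₁⟩ := HWeaker.exists_symbSize_le hPQ.2
  obtain ⟨C₂, hC₂, h₂⟩ := exists_symbSize_add_le hPm hγ hP
  obtain ⟨C₃, hC₃, h₃⟩ := HWeaker.exists_symbSize_le hPQ.1
  obtain ⟨w, hw⟩ := exists_weights_hasse m α hα
  set Y : ℝ := ∑ κ : Fin n → Fin (m + 1), ‖(gridPoint κ : EuclideanSpace ℝ (Fin n))‖ with hY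
  have hY0 : 0 ≤ Y := Finset.sum_nonneg fun _ _ => norm_nonneg _
  -- Chosen so that every displacement `r • gridPoint κ`, with `r = c * symbSize Q ξ ^ (1 / γ)`, has
  -- norm at most `symbSize P ξ ^ (1 / γ)`, the range of slow variation.
  set c : ℝ := (C₁ ^ (1 / γ) * (1 + Y))⁻¹ with hc
  have hcpos : 0 < c := by positivity
  set S : ℝ := ∑ κ, ‖w κ‖ with hS
  have hS0 : 0 ≤ S := Finset.sum_nonneg fun _ _ => norm_nonneg _
  refine ⟨(c ^ α.degree)⁻¹ * ((1 + S) * (C₁ * (C₂ * C₃))), by positivity, fun ξ j => ?_⟩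
  have hfP := one_le_symbSize P ξ
  have hfQ := one_le_symbSize Q ξ
  have hfQ0 : 0 < symbSize Q ξ := by linarith
  set r : ℝ := c * symbSize Q ξ ^ (1 / γ) with hr
  have hrpos : 0 < r := mul_pos hcpos (Real.rpow_pos_of_pos hfQ0 _)
  have hval : ∀ κ : Fin n → Fin (m + 1), ‖symb (Q j) (ξ + r • gridPoint κ)‖ ≤
      C₁ * (C₂ * C₃) * symbSize Q ξ := by
    intro κ
    have hη : ‖r • (gridPoint κ : EuclideanSpace ℝ (Fin n))‖ ≤ symbSize P ξ ^ (1 / γ) := by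
      rw [norm_smul, Real.norm_of_nonneg hrpos.le]
      have h5 : ‖(gridPoint κ : EuclideanSpace ℝ (Fin n))‖ ≤ 1 + Y := by
        have := Finset.single_le_sum
          (f := fun κ : Fin n → Fin (m + 1) => ‖(gridPoint κ : EuclideanSpace ℝ (Fin n))‖)
          (fun _ _ => norm_nonneg _) (Finset.mem_univ κ)
        linarith
      have h6 : symbSize Q ξ ^ (1 / γ) ≤ C₁ ^ (1 / γ) * symbSize P ξ ^ (1 / γ) := by
        rw [← Real.mul_rpow hC₁.le (by linarith)]
        exact Real.rpow_le_rpow hfQ0.le (h₁ ξ) (by positivity)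
      calc r * ‖(gridPoint κ : EuclideanSpace ℝ (Fin n))‖
          ≤ c * (C₁ ^ (1 / γ) * symbSize P ξ ^ (1 / γ)) * (1 + Y) :=
            mul_le_mul (mul_le_mul_of_nonneg_left h6 hcpos.le) h5 (norm_nonneg _) (by
              have : 0 ≤ symbSize P ξ ^ (1 / γ) := Real.rpow_nonneg (by linarith) _
              positivity)
        _ = symbSize P ξ ^ (1 / γ) := by
            have : C₁ ^ (1 / γ) ≠ 0 := (Real.rpow_pos_of_pos hC₁ _).ne'
            rw [hc]; field_simp
    calc _ ≤ symbSize Q (ξ + r • gridPoint κ) := norm_symb_le_symbSize Q j _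
      _ ≤ C₁ * symbSize P (ξ + r • gridPoint κ) := h₁ _
      _ ≤ C₁ * (C₂ * symbSize P ξ) := mul_le_mul_of_nonneg_left (h₂ ξ _ hη) hC₁.le
      _ ≤ C₁ * (C₂ * (C₃ * symbSize Q ξ)) := by gcongr; exact h₃ ξ
      _ = _ := by ring
  have h7 := hw (Q j) (hQm j).le ξ r
  have h8 : r ^ α.degree * ‖symb (hasse α (Q j)) ξ‖ ≤ S * (C₁ * (C₂ * C₃) * symbSize Q ξ) := by
    have : ‖(r : ℂ) ^ α.degree * symb (hasse α (Q j)) ξ‖ =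
        r ^ α.degree * ‖symb (hasse α (Q j)) ξ‖ := by
      rw [norm_mul, norm_pow, Complex.norm_real, Real.norm_of_nonneg hrpos.le]
    rw [← this, ← h7, hS, Finset.sum_mul]
    refine (norm_sum_le _ _).trans (Finset.sum_le_sum fun κ _ => ?_)
    rw [norm_mul]
    exact mul_le_mul_of_nonneg_left (hval κ) (norm_nonneg _)
  have h9 : r ^ α.degree = c ^ α.degree * symbSize Q ξ ^ ((α.degree : ℝ) / γ) := by
    rw [hr, mul_pow, ← Real.rpow_natCast (symbSize Q ξ ^ (1 / γ)), ← Real.rpow_mul hfQ0.le]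
    congr 2; ring
  rw [Real.rpow_sub hfQ0, Real.rpow_one, ← mul_div_assoc, le_div_iff₀ (Real.rpow_pos_of_pos hfQ0 _),
    mul_assoc, inv_mul_eq_div, le_div_iff₀ (by positivity)]
  rw [h9] at h8
  have : 0 ≤ C₁ * (C₂ * C₃) * symbSize Q ξ := by positivity
  nlinarith

theorem EquallyStrong.symm {h : ℝ} {P : Fin N → MvPolynomial (Fin n) ℂ}
    {Q : Fin M → MvPolynomial (Fin n) ℂ} (hPQ : EquallyStrong h P Q) : EquallyStrong h Q P :=
  ⟨hPQ.2, hPQ.1⟩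

/-- The two sets of admissible exponents are equal, so attainment of the infimum plays no role here.
-/
theorem gammaOf_eq_of_equallyStrong (hm : 0 < m) {P : Fin N → MvPolynomial (Fin n) ℂ}
    {Q : Fin M → MvPolynomial (Fin n) ℂ} (hPm : HasOrder P m) (hQm : HasOrder Q m)
    (hPQ : EquallyStrong 1 P Q) : gammaOf P m = gammaOf Q m := by
  have hm' : (0 : ℝ) < m := by exact_mod_cast hm
  rw [gammaOf, gammaOf]
  congr 1
  ext γ
  exact ⟨fun h => ⟨h.1, h.2.of_equallyStrong hPm hQm hPQ (hm'.trans_le h.1)⟩,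
    fun h => ⟨h.1, h.2.of_equallyStrong hQm hPm hPQ.symm (hm'.trans_le h.1)⟩⟩

end IterateSystems

end

/-! ### Weight functions and their Young conjugates. -/

noncomputable section

namespace IterateSystems

open Filter Topology MeasureTheory

/-- By monotonicity `∫_t^{2t} ω(x) / x² dx ≥ ω(t) / (4t)`, and the left side tends to zero by `(β)`.
Hence `ω(t) = o(t)`. -/
theorem IsNQWeight.le_mul_add {ω : ℝ → ℝ} (hω : IsNQWeight ω) {ε : ℝ} (hε : 0 < ε) :
    ∃ A : ℝ, 0 ≤ A ∧ ∀ t, 0 ≤ t → ω t ≤ ε * t + A := by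
  set g : ℝ → ℝ := fun t => ω t / t ^ 2 with hg
  have hlim := intervalIntegral_tendsto_integral_Ioi 1 hω.beta tendsto_id
  have hlim2 := intervalIntegral_tendsto_integral_Ioi 1 hω.beta
    (tendsto_id.const_mul_atTop (r := (2 : ℝ)) two_pos)
  have hdiff := hlim2.sub hlim
  rw [sub_self] at hdiff
  obtain ⟨T, hT⟩ := eventually_atTop.1 (hdiff.eventually (gt_mem_nhds (show (0 : ℝ) < ε / 4 by linarith)))
  set T' := max T 1 with hT'
  have hT'1 : 1 ≤ T' := le_max_right _ _
  refine ⟨ω T', hω.nonneg _ (by linarith), fun t ht => ?_⟩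
  by_cases h : t ≤ T'
  · have := hω.monotoneOn (Set.mem_Ici.2 ht) (Set.mem_Ici.2 (by linarith : (0 : ℝ) ≤ T')) h
    nlinarith
  · push Not at h
    have ht1 : 1 < t := by linarith
    have hii : ∀ a b : ℝ, 1 ≤ a → 1 ≤ b → IntervalIntegrable g volume a b := fun a b ha hb =>
      (intervalIntegrable_iff.2 (hω.beta.mono_set fun x hx =>
        Set.mem_Ioi.2 ((le_min ha hb).trans_lt hx.1)))
    have h1 := hT t ((le_max_left _ _).trans h.le)
    simp only [id] at h1
    rw [intervalIntegral.integral_interval_sub_left (hii 1 (2 * t) le_rfl (by linarith))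
      (hii 1 t le_rfl ht1.le)] at h1
    have h2 : ∫ _ in t..(2 * t), ω t / (4 * t ^ 2) ≤ ∫ x in t..(2 * t), g x := by
      refine intervalIntegral.integral_mono_on (by linarith) (by simp)
        (hii t (2 * t) ht1.le (by linarith)) fun x hx => ?_
      have hx0 : 0 < x := by linarith [hx.1]
      have h3 := hω.monotoneOn (Set.mem_Ici.2 ht) (Set.mem_Ici.2 hx0.le) hx.1
      have h4 := hω.nonneg t ht
      have h5 : x ^ 2 ≤ 4 * t ^ 2 := by nlinarith [hx.2]
      exact div_le_div₀ (h4.trans h3) h3 (by positivity) h5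
    rw [intervalIntegral.integral_const, smul_eq_mul] at h2
    have h6 : (2 * t - t) * (ω t / (4 * t ^ 2)) = ω t / (4 * t) := by
      field_simp; ring
    rw [h6] at h2
    have h7 := h2.trans_lt h1
    rw [div_lt_iff₀ (by linarith)] at h7
    have := hω.nonneg T' (by linarith)
    linarith

theorem IsNQWeight.two_pow_mul_le {ω : ℝ → ℝ} (hω : IsNQWeight ω) (q : ℕ) :
    ∃ L : ℝ, 1 ≤ L ∧ ∀ t, 0 ≤ t → ω (2 ^ q * t) ≤ L * (ω t + 1) := by
  induction q with
  | zero => exact ⟨1, le_rfl, fun t _ => by simp⟩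
  | succ q ih =>
    obtain ⟨L, hL, h⟩ := ih
    obtain ⟨L', hL', h'⟩ := hω.alpha
    refine ⟨(L' + 1) * (L + 1), by nlinarith, fun t ht => ?_⟩
    have h1 := h' (2 ^ q * t) (by positivity)
    have h2 := h t ht
    have h3 := hω.nonneg t ht
    rw [pow_succ, mul_comm (2 ^ q), mul_assoc]
    have h4 : ω (2 ^ q * t) + 1 ≤ (L + 1) * (ω t + 1) := by nlinarith
    have h5 := mul_le_mul_of_nonneg_left h4 hL'.le
    have h6 : 0 ≤ (L + 1) * (ω t + 1) := by positivity
    nlinarith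

theorem exp_rpow_one_div (t s : ℝ) : Real.exp t ^ (1 / s) = Real.exp (t / s) := by
  rw [← Real.exp_mul]; congr 1; ring

section youngConj

variable {ω : ℝ → ℝ} {s : ℝ}

/-- By `(γ)`, `(s y + 1) log x ≤ ω(x)` for large `x`; with `x = exp (t / s)` this dominates `y t`.
Boundedness is essential because a real `⨆` over an unbounded family takes the default value `0`. -/
theorem IsNQWeight.bddAbove_youngConj (hω : IsNQWeight ω) (hs : 0 < s) {y : ℝ} (hy : 0 ≤ y) :
    BddAbove (Set.range fun t : Set.Ici (0 : ℝ) =>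
      y * (t : ℝ) - (fun t => ω (t ^ (1 / s))) (Real.exp t)) := by
  obtain ⟨T, hT⟩ := eventually_atTop.1
    (hω.gamma.bound (c := 1 / (s * y + 1)) (by positivity))
  refine ⟨y * (s * |Real.log (max T 1)|), ?_⟩
  rintro _ ⟨⟨t, ht⟩, rfl⟩
  have ht : 0 ≤ t := ht
  simp only [exp_rpow_one_div]
  have hω0 := hω.nonneg (Real.exp (t / s)) (Real.exp_pos _).le
  by_cases h : max T 1 ≤ Real.exp (t / s)
  · have h1 := hT _ ((le_max_left _ _).trans h)
    rw [Real.log_exp, Real.norm_of_nonneg (by positivity), Real.norm_of_nonneg hω0,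
      div_mul_eq_mul_div, le_div_iff₀ (by positivity), one_mul] at h1
    have h2 : t / s * (s * y + 1) = y * t + t / s := by field_simp
    have : 0 ≤ t / s := by positivity
    have : 0 ≤ y * (s * |Real.log (max T 1)|) := by positivity
    linarith
  · push Not at h
    have h1 : t / s < Real.log (max T 1) := by
      rwa [Real.lt_log_iff_exp_lt (lt_of_lt_of_le one_pos (le_max_right _ _))]
    rw [div_lt_iff₀ hs] at h1
    have h2 : t ≤ s * |Real.log (max T 1)| := by
      have := mul_le_mul_of_nonneg_left (le_abs_self (Real.log (max T 1))) hs.le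
      linarith
    have := mul_le_mul_of_nonneg_left h2 hy
    linarith

theorem IsNQWeight.le_youngConj (hω : IsNQWeight ω) (hs : 0 < s) {y : ℝ} (hy : 0 ≤ y) {t : ℝ}
    (ht : 0 ≤ t) : y * t - ω (Real.exp (t / s)) ≤ youngConj (fun t => ω (t ^ (1 / s))) y := by
  have := le_ciSup (hω.bddAbove_youngConj hs hy) ⟨t, ht⟩
  simp only [exp_rpow_one_div] at this
  simpa only [youngConj, exp_rpow_one_div] using this

theorem youngConj_le {y B : ℝ} (h : ∀ t, 0 ≤ t → y * t - ω (Real.exp (t / s)) ≤ B) :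
    youngConj (fun t => ω (t ^ (1 / s))) y ≤ B := by
  have : Nonempty (Set.Ici (0 : ℝ)) := ⟨⟨0, Set.mem_Ici.2 le_rfl⟩⟩
  refine ciSup_le fun t => ?_
  simp only [exp_rpow_one_div]
  exact h t t.2

/-- For two competitors `t, t'` the larger one can be used for both slopes, and one of the two
nonnegative terms `ω` is dropped. -/
theorem IsNQWeight.youngConj_add_le (hω : IsNQWeight ω) (hs : 0 < s) {a b : ℝ} (ha : 0 ≤ a)
    (hb : 0 ≤ b) : youngConj (fun t => ω (t ^ (1 / s))) a + youngConj (fun t => ω (t ^ (1 / s))) b ≤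
      youngConj (fun t => ω (t ^ (1 / s))) (a + b) := by
  rw [← le_sub_iff_add_le]
  refine youngConj_le fun t ht => ?_
  rw [le_sub_comm]
  refine youngConj_le fun t' ht' => ?_
  have h0 := hω.nonneg (Real.exp (t / s)) (Real.exp_pos _).le
  have h0' := hω.nonneg (Real.exp (t' / s)) (Real.exp_pos _).le
  rcases le_total t t' with h | h
  · have := hω.le_youngConj hs (add_nonneg ha hb) ht'
    nlinarith
  · have := hω.le_youngConj hs (add_nonneg ha hb) ht
    nlinarith

/-- Exponential factors are absorbed by shrinking the parameter. -/
theorem IsNQWeight.exists_mul_youngConj_add_le (hω : IsNQWeight ω) (hs : 0 < s) {c : ℝ}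
    (hc : 0 ≤ c) : ∃ L : ℝ, 1 ≤ L ∧ ∀ μ y : ℝ, 0 < μ → 0 ≤ y →
      μ * youngConj (fun t => ω (t ^ (1 / s))) (y / μ) + c * y - μ ≤
        μ / L * youngConj (fun t => ω (t ^ (1 / s))) (y / (μ / L)) := by
  obtain ⟨q, hq⟩ := pow_unbounded_of_one_lt (Real.exp (c / s)) one_lt_two
  obtain ⟨L, hL, h⟩ := hω.two_pow_mul_le q
  refine ⟨L, hL, fun μ y hμ hy => ?_⟩
  have hL0 : 0 < L := by linarith
  set J := youngConj (fun t => ω (t ^ (1 / s))) with hJ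
  have hμL : 0 < μ / L := by positivity
  have key : J (y / μ) ≤ (μ / L * J (y / (μ / L)) - c * y + μ) / μ := by
    refine youngConj_le fun t ht => ?_
    rw [le_div_iff₀ hμ]
    -- Testing at `t + c` in place of `t` gains `c * y`, while `(α)` bounds the weight there by `L
    -- (ω + 1)`. The factor `L` is cancelled by the parameter `μ / L`.
    have h1 := hω.le_youngConj hs (y := y / (μ / L)) (by positivity) (add_nonneg ht hc)
    have h2 : ω (Real.exp ((t + c) / s)) ≤ L * (ω (Real.exp (t / s)) + 1) := by
      refine le_trans (hω.monotoneOn (Set.mem_Ici.2 (Real.exp_pos _).le)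
        (Set.mem_Ici.2 (by positivity)) ?_) (h _ (Real.exp_pos _).le)
      rw [add_div, Real.exp_add, mul_comm]
      exact mul_le_mul_of_nonneg_right hq.le (Real.exp_pos _).le
    have h3 := mul_le_mul_of_nonneg_left h1 hμL.le
    have h4 := mul_le_mul_of_nonneg_left h2 hμL.le
    have h5 : μ / L * (y / (μ / L) * (t + c)) = y * (t + c) := by field_simp
    have h6 : μ / L * (L * (ω (Real.exp (t / s)) + 1)) = μ * (ω (Real.exp (t / s)) + 1) := by
      field_simp
    have h7 : (y / μ * t - ω (Real.exp (t / s))) * μ = y * t - μ * ω (Real.exp (t / s)) := by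
      field_simp
    rw [h7]
    rw [mul_sub, h5] at h3
    rw [h6] at h4
    linarith
  rw [le_div_iff₀ hμ] at key
  linarith

/-- Testing the conjugate at `t = s log k`, where `exp (t / s) = k`, bounds `(k - l) m s log k` by
`μ φ*((k - l) m / μ) + μ ω(k)`. Since `ω(k) = o(k)`, the last term costs only `exp k` up to a
constant; superadditivity merges the conjugates, and `C ^ k exp k` is paid for by passing to `μ /
L`. That `L` does not depend on `μ` is what the Beurling case requires. -/
theorem IsNQWeight.exists_absorb (hω : IsNQWeight ω) (hs : 0 < s) {m : ℕ} (hm : 0 < m) {γ : ℝ}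
    (hγ : γ ≤ s * m) (C : ℝ) (hC : 0 ≤ C) :
    ∃ L : ℝ, 1 ≤ L ∧ ∀ μ : ℝ, 0 < μ → ∃ B : ℝ, 0 < B ∧ ∀ k l : ℕ, l ≤ k →
      C ^ k * (k : ℝ) ^ (γ * ((k : ℝ) - l)) *
        Real.exp (μ * youngConj (fun t => ω (t ^ (1 / s))) ((l : ℝ) * m / μ)) ≤
      B * Real.exp (μ / L * youngConj (fun t => ω (t ^ (1 / s))) ((k : ℝ) * m / (μ / L))) := by
  set J := youngConj (fun t => ω (t ^ (1 / s))) with hJ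
  set c := Real.log (max C 1) + 1 with hc
  have hlog : 0 ≤ Real.log (max C 1) := Real.log_nonneg (le_max_right _ _)
  obtain ⟨L, hL, h⟩ := hω.exists_mul_youngConj_add_le hs (c := c) (by linarith)
  refine ⟨L, hL, fun μ hμ => ?_⟩
  obtain ⟨A, hA, hAω⟩ := hω.le_mul_add (ε := 1 / μ) (by positivity)
  refine ⟨Real.exp (μ * A + μ), Real.exp_pos _, fun k l hlk => ?_⟩
  have hm1 : (1 : ℝ) ≤ m := by exact_mod_cast hm
  have hk0 : (0 : ℝ) ≤ k := Nat.cast_nonneg _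
  have hlk' : (l : ℝ) ≤ k := by exact_mod_cast hlk
  have h1 := h μ ((k : ℝ) * m) hμ (by positivity)
  have hCk : C ^ k ≤ Real.exp (Real.log (max C 1) * k) := by
    rw [mul_comm, Real.exp_nat_mul, Real.exp_log (lt_of_lt_of_le one_pos (le_max_right _ _))]
    exact pow_le_pow_left₀ hC (le_max_left _ _) _
  have hmain : (k : ℝ) ^ (γ * ((k : ℝ) - l)) * Real.exp (μ * J ((l : ℝ) * m / μ)) ≤
      Real.exp (μ * J ((k : ℝ) * m / μ) + k + μ * A) := by
    rcases Nat.eq_zero_or_pos k with rfl | hk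
    · obtain rfl : l = 0 := by omega
      simp only [Nat.cast_zero, sub_self, mul_zero, Real.rpow_zero, one_mul, Real.exp_le_exp]
      nlinarith
    · have hk1 : (1 : ℝ) ≤ k := by exact_mod_cast hk
      have hlogk : 0 ≤ Real.log k := Real.log_nonneg hk1
      have h2 : (k : ℝ) ^ (γ * ((k : ℝ) - l)) ≤
          Real.exp (μ * J (((k : ℝ) - l) * m / μ) + k + μ * A) := by
        rw [Real.rpow_def_of_pos (by linarith), Real.exp_le_exp]
        have h3 := hω.le_youngConj hs (y := ((k : ℝ) - l) * m / μ) (t := s * Real.log k)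
          (div_nonneg (mul_nonneg (by linarith) (by linarith)) hμ.le) (by positivity)
        rw [mul_div_cancel_left₀ _ hs.ne', Real.exp_log (by linarith)] at h3
        have h4 := hAω k hk0
        have h5 := mul_le_mul_of_nonneg_left h3 hμ.le
        have h6 := mul_le_mul_of_nonneg_left h4 hμ.le
        have h7 : μ * (((k : ℝ) - l) * m / μ * (s * Real.log k) - ω k) =
            Real.log k * ((s * m) * ((k : ℝ) - l)) - μ * ω k := by field_simp
        have h8 : μ * (1 / μ * k + A) = k + μ * A := by field_simp
        rw [h7] at h5
        rw [h8] at h6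
        have h9 : Real.log k * (γ * ((k : ℝ) - l)) ≤ Real.log k * ((s * m) * ((k : ℝ) - l)) :=
          mul_le_mul_of_nonneg_left (mul_le_mul_of_nonneg_right hγ (by linarith)) hlogk
        linarith
      have h10 := hω.youngConj_add_le hs (a := ((k : ℝ) - l) * m / μ) (b := (l : ℝ) * m / μ)
        (div_nonneg (mul_nonneg (by linarith) (by linarith)) hμ.le) (by positivity)
      have h11 : ((k : ℝ) - l) * m / μ + (l : ℝ) * m / μ = (k : ℝ) * m / μ := by
        field_simp; ring
      rw [h11] at h10
      refine (mul_le_mul_of_nonneg_right h2 (Real.exp_pos _).le).trans ?_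
      rw [← Real.exp_add, Real.exp_le_exp]
      have := mul_le_mul_of_nonneg_left h10 hμ.le
      rw [mul_add] at this
      linarith
  rw [mul_assoc]
  refine (mul_le_mul hCk hmain (by positivity) (Real.exp_pos _).le).trans ?_
  rw [← Real.exp_add, ← Real.exp_add, Real.exp_le_exp]
  have h12 : (k : ℝ) * c ≤ c * (k * m) := by
    have : 0 ≤ c := by linarith
    have := mul_nonneg hk0 this
    nlinarith
  rw [hc] at h12
  linarith

end youngConj

end IterateSystems

end

/-! ### Constant-coefficient operators as a polynomial algebra. -/

noncomputable section

namespace IterateSystems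

open MvPolynomial

/-- The space of smooth complex-valued functions. -/
def smoothFun (n : ℕ) : Submodule ℂ (EuclideanSpace ℝ (Fin n) → ℂ) where
  carrier := {u | ContDiff ℝ ((⊤ : ℕ∞) : WithTop ℕ∞) u}
  add_mem' h h' := by
    rw [Set.mem_ofPred_eq] at h h' ⊢
    exact h.add h'
  zero_mem' := by
    rw [Set.mem_ofPred_eq]
    exact contDiff_const
  smul_mem' c _ h := by
    rw [Set.mem_ofPred_eq] at h ⊢
    exact h.const_smul c

variable {n : ℕ}

theorem contDiff_coe (u : smoothFun n) :
    ContDiff ℝ ((⊤ : ℕ∞) : WithTop ℕ∞) (u : EuclideanSpace ℝ (Fin n) → ℂ) := u.2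

theorem differentiable_coe (u : smoothFun n) :
    Differentiable ℝ (u : EuclideanSpace ℝ (Fin n) → ℂ) := (contDiff_coe u).differentiable (by simp)

theorem continuous_coe (u : smoothFun n) :
    Continuous (u : EuclideanSpace ℝ (Fin n) → ℂ) := (contDiff_coe u).continuous

theorem contDiff_D (j : Fin n) (u : smoothFun n) :
    ContDiff ℝ ((⊤ : ℕ∞) : WithTop ℕ∞) (D j (u : EuclideanSpace ℝ (Fin n) → ℂ)) :=
  contDiff_const.mul (((contDiff_coe u).fderiv_right (by simp)).clm_apply contDiff_const)

/-- The operator `D_j` on smooth functions. -/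
def dOp (j : Fin n) : smoothFun n →ₗ[ℂ] smoothFun n where
  toFun u := ⟨D j u, contDiff_D j u⟩
  map_add' u v := by
    ext x
    change -Complex.I * fderiv ℝ (u.1 + v.1) x _ = -Complex.I * fderiv ℝ u.1 x _ +
      -Complex.I * fderiv ℝ v.1 x _
    rw [fderiv_add (differentiable_coe u x) (differentiable_coe v x)]
    simp [mul_add]
  map_smul' c u := by
    ext x
    change -Complex.I * fderiv ℝ (c • u.1) x _ = c * (-Complex.I * fderiv ℝ u.1 x _)
    rw [fderiv_const_smul (differentiable_coe u x)]
    simp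
    ring

theorem dOp_comm (i j : Fin n) : dOp i * dOp j = dOp j * dOp (n := n) i := by
  have key : ∀ (i j : Fin n) (u : smoothFun n) x, D i (D j u) x =
      -(fderiv ℝ (fderiv ℝ u) x (EuclideanSpace.single i 1) (EuclideanSpace.single j 1)) := by
    intro i j u x
    have h1 : DifferentiableAt ℝ (fderiv ℝ (u : EuclideanSpace ℝ (Fin n) → ℂ)) x :=
      ((contDiff_coe u).fderiv_right (m := 1) (WithTop.coe_le_coe.2 (le_top : (1 + 1 : ℕ∞) ≤ ⊤))).differentiable (by simp) x
    have h2 : DifferentiableAt ℝ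
        (fun y => fderiv ℝ (u : EuclideanSpace ℝ (Fin n) → ℂ) y (EuclideanSpace.single j 1)) x :=
      h1.clm_apply (differentiableAt_const _)
    change -Complex.I * fderiv ℝ (fun y => -Complex.I * fderiv ℝ u.1 y (EuclideanSpace.single j 1)) x
      (EuclideanSpace.single i 1) = _
    rw [fderiv_const_mul h2, fderiv_clm_apply h1 (differentiableAt_const _)]
    simp only [fderiv_fun_const]
    simp
    rw [← mul_assoc, Complex.I_mul_I]
    ring
  ext u x
  change D i (D j u) x = D j (D i u) x
  rw [key, key]
  have hs : IsSymmSndFDerivAt ℝ (u : EuclideanSpace ℝ (Fin n) → ℂ) x :=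
    (contDiff_coe u).contDiffAt.isSymmSndFDerivAt (by
      rw [minSmoothness_of_isRCLikeNormedField]; exact WithTop.coe_le_coe.2 (le_top : (2 : ℕ∞) ≤ ⊤))
  rw [hs.eq]

-- Polynomial evaluation needs a commutative target; commuting elements generate one inside `A`.
open scoped IsMulCommutative in
theorem exists_algHom_of_commute {ι A : Type*} [Ring A] [Algebra ℂ A] (d : ι → A)
    (hd : ∀ i j, d i * d j = d j * d i) :
    ∃ φ : MvPolynomial ι ℂ →ₐ[ℂ] A, ∀ j, φ (X j) = d j := by
  have := Algebra.isMulCommutative_adjoin ℂ (s := Set.range d) (by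
    rintro _ ⟨i, rfl⟩ _ ⟨j, rfl⟩
    exact hd i j)
  let φ := aeval (R := ℂ) fun j : ι =>
    (⟨d j, Algebra.subset_adjoin ⟨j, rfl⟩⟩ : Algebra.adjoin ℂ (Set.range d))
  exact ⟨(Algebra.adjoin ℂ (Set.range d)).val.comp φ, fun j => by simp [φ]⟩

/-- The operators `p(D)` on smooth functions. -/
def opHom (n : ℕ) :
    MvPolynomial (Fin n) ℂ →ₐ[ℂ] Module.End ℂ (smoothFun n) :=
  (exists_algHom_of_commute (dOp (n := n)) dOp_comm).choose

theorem opHom_X (j : Fin n) : opHom n (X j) = dOp j :=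
  (exists_algHom_of_commute (dOp (n := n)) dOp_comm).choose_spec j

theorem opHom_mul (p q : MvPolynomial (Fin n) ℂ) (u : smoothFun n) :
    opHom n (p * q) u = opHom n p (opHom n q u) := by
  rw [map_mul]; rfl

/-- Transfer principle for arbitrary relations. With equality it moves iterates from raw functions
to `smoothFun`; with agreement on an open set it gives locality. -/
theorem iterComp_rel {k : ℕ} {X Y : Type*} (r : X → Y → Prop) (f : Fin k → X → X)
    (g : Fin k → Y → Y) (h : ∀ j x y, r x y → r (f j x) (g j y)) (e : Fin k → ℕ) {x : X} {y : Y}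
    (hxy : r x y) : r (iterComp f e x) (iterComp g e y) := by
  have hit : ∀ j i x y, r x y → r ((f j)^[i] x) ((g j)^[i] y) := by
    intro j i
    induction i with
    | zero => exact fun x y h => h
    | succ i ih => exact fun x y hxy => ih _ _ (h j x y hxy)
  rw [iterComp, iterComp, List.ofFn_eq_map, List.ofFn_eq_map]
  induction List.finRange k with
  | nil => exact hxy
  | cons j l ih => exact hit j _ _ _ ih

/-- Iterates become products of polynomials, so the order of the operators in `P^β` no longer
matters. -/
theorem iterComp_eq_opHom {k : ℕ} (p : Fin k → MvPolynomial (Fin n) ℂ) (e : Fin k → ℕ)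
    (u : smoothFun n) :
    iterComp (fun j v => opHom n (p j) v) e u = opHom n (∏ j, p j ^ e j) u := by
  have hit : ∀ j i v, (fun v => opHom n (p j) v)^[i] v = opHom n (p j ^ i) v := by
    intro j i v
    rw [map_pow, Module.End.coe_pow]
  have key : ∀ l : List (Fin k), (l.map fun j => (fun v => opHom n (p j) v)^[e j]).foldr
      (fun g h => g ∘ h) id u = opHom n (l.map fun j => p j ^ e j).prod u := by
    intro l
    induction l with
    | nil => simp
    | cons j l ih =>
      rw [List.map_cons, List.foldr_cons, Function.comp_apply, ih, hit, List.map_cons,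
        List.prod_cons, opHom_mul]
  rw [iterComp, List.ofFn_eq_map, key, ← List.ofFn_eq_map, List.prod_ofFn]

theorem polyOp_eq_opHom (p : MvPolynomial (Fin n) ℂ) (u : smoothFun n) :
    polyOp p (u : EuclideanSpace ℝ (Fin n) → ℂ) = opHom n p u := by
  have h1 : ∀ α : Fin n →₀ ℕ, iterComp D (fun j => α j) (u : EuclideanSpace ℝ (Fin n) → ℂ) =
      opHom n (∏ j, X j ^ α j) u := by
    intro α
    rw [← iterComp_eq_opHom]
    exact iterComp_rel (fun (x : EuclideanSpace ℝ (Fin n) → ℂ) (y : smoothFun n) => x = y) D _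
      (fun j x y hxy => by rw [hxy, opHom_X]; rfl) _ rfl
  funext x
  simp only [polyOp, h1]
  have h2 : opHom n p u = ∑ α ∈ p.support, p.coeff α • opHom n (∏ j, X j ^ α j) u := by
    conv_lhs => rw [p.as_sum]
    rw [map_sum, LinearMap.sum_apply]
    refine Finset.sum_congr rfl fun α _ => ?_
    rw [monomial_eq, ← smul_eq_C_mul, map_smul, Finsupp.prod_fintype _ _ fun _ => pow_zero _]
    rfl
  rw [h2, AddSubmonoidClass.coe_finsetSum, Finset.sum_apply]
  rfl

theorem sysIter_eq_opHom {N : ℕ} (P : Fin N → MvPolynomial (Fin n) ℂ) (β : Fin N → ℕ)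
    (u : smoothFun n) :
    sysIter P β (u : EuclideanSpace ℝ (Fin n) → ℂ) = opHom n (∏ j, P j ^ β j) u := by
  rw [← iterComp_eq_opHom]
  exact iterComp_rel (fun (x : EuclideanSpace ℝ (Fin n) → ℂ) (y : smoothFun n) => x = y) _ _
    (fun j x y hxy => by rw [hxy, polyOp_eq_opHom]) _ rfl

section Local

variable {U : Set (EuclideanSpace ℝ (Fin n))}

theorem D_eqOn (hU : IsOpen U) {u v : EuclideanSpace ℝ (Fin n) → ℂ} (h : Set.EqOn u v U)
    (j : Fin n) : Set.EqOn (D j u) (D j v) U := by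
  intro x hx
  simp only [D]
  rw [(h.eventuallyEq_of_mem (hU.mem_nhds hx)).fderiv_eq]

theorem polyOp_eqOn (hU : IsOpen U) {u v : EuclideanSpace ℝ (Fin n) → ℂ} (h : Set.EqOn u v U)
    (p : MvPolynomial (Fin n) ℂ) : Set.EqOn (polyOp p u) (polyOp p v) U := by
  intro x hx
  simp only [polyOp]
  refine Finset.sum_congr rfl fun α _ => ?_
  rw [iterComp_rel (fun u v => Set.EqOn u v U) D D (fun j u v h => D_eqOn hU h j) _ h hx]

theorem sysIter_eqOn (hU : IsOpen U) {u v : EuclideanSpace ℝ (Fin n) → ℂ} (h : Set.EqOn u v U)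
    {N : ℕ} (P : Fin N → MvPolynomial (Fin n) ℂ) (β : Fin N → ℕ) :
    Set.EqOn (sysIter P β u) (sysIter P β v) U :=
  iterComp_rel (fun u v => Set.EqOn u v U) _ _ (fun j _ _ h => polyOp_eqOn hU h (P j)) _ h

theorem opHom_eqOn (hU : IsOpen U) {u v : smoothFun n}
    (h : Set.EqOn (u : EuclideanSpace ℝ (Fin n) → ℂ) v U) (p : MvPolynomial (Fin n) ℂ) :
    Set.EqOn (opHom n p u : EuclideanSpace ℝ (Fin n) → ℂ) (opHom n p v) U := by
  rw [← polyOp_eq_opHom, ← polyOp_eq_opHom]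
  exact polyOp_eqOn hU h p

end Local

/-- Multiplication by a smooth function. -/
def mulOp (χ : smoothFun n) : smoothFun n →ₗ[ℂ] smoothFun n where
  toFun v := ⟨fun x => χ.1 x * v.1 x, (contDiff_coe χ).mul (contDiff_coe v)⟩
  map_add' u v := by ext x; simp [mul_add]
  map_smul' c v := by ext x; simp; ring

theorem mulOp_apply (χ v : smoothFun n) (x : EuclideanSpace ℝ (Fin n)) :
    (mulOp χ v).1 x = χ.1 x * v.1 x := rfl

theorem dOp_mulOp (i : Fin n) (χ v : smoothFun n) :
    dOp i (mulOp χ v) = mulOp (dOp i χ) v + mulOp χ (dOp i v) := by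
  ext x
  change -Complex.I * fderiv ℝ (fun x => χ.1 x * v.1 x) x _ =
    (-Complex.I * fderiv ℝ χ.1 x _) * v.1 x + χ.1 x * (-Complex.I * fderiv ℝ v.1 x _)
  rw [fderiv_fun_mul (differentiable_coe χ x) (differentiable_coe v x)]
  simp
  ring

/-- Leibniz rule for differential operators with constant coefficients. -/
theorem opHom_mulOp (p : MvPolynomial (Fin n) ℂ) (χ v : smoothFun n) :
    opHom n p (mulOp χ v) = ∑ α ∈ (taylorShift n p).support,
      mulOp (opHom n (monomial α 1) χ) (opHom n (hasse α p) v) := by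
  refine leibniz_abstract
    (fun α => (mulOp (opHom n (monomial α 1) χ)).comp
      ((LinearMap.applyₗ v).comp (opHom n).toLinearMap))
    ((LinearMap.applyₗ (mulOp χ v)).comp (opHom n).toLinearMap) dOp ?_ ?_ ?_ p
  · intro i p
    change opHom n (p * X i) _ = dOp i (opHom n p _)
    rw [mul_comm, opHom_mul, opHom_X]
  · change opHom n 1 _ = mulOp (opHom n (monomial 0 1) χ) (opHom n 1 v)
    rw [show (monomial 0 1 : MvPolynomial (Fin n) ℂ) = 1 from rfl, map_one]
    rfl
  · intro α i p
    change dOp i (mulOp (opHom n (monomial α 1) χ) (opHom n p v)) =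
      mulOp (opHom n (monomial (α + Finsupp.single i 1) 1) χ) (opHom n p v) +
        mulOp (opHom n (monomial α 1) χ) (opHom n (X i * p) v)
    have h : (monomial (α + Finsupp.single i 1) 1 : MvPolynomial (Fin n) ℂ) =
        X i * monomial α 1 := by
      rw [X, monomial_mul, one_mul, add_comm]
    rw [dOp_mulOp, h, opHom_mul, opHom_mul, opHom_X]

end IterateSystems

end

/-! ### Cutoff functions with scaled derivative bounds. -/

noncomputable section

namespace IterateSystems

open MvPolynomial MeasureTheory Metric

open scoped Convolution

variable {n : ℕ}

theorem finsupp_induction_add_single {ι : Type*} {p : (ι →₀ ℕ) → Prop} (h0 : p 0)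
    (h1 : ∀ α i, p α → p (α + Finsupp.single i 1)) (α : ι →₀ ℕ) : p α := by
  have key : ∀ β : ι →₀ ℕ, ∀ α, p α → p (α + β) := by
    intro β
    refine Finsupp.induction_linear β (fun α h => by rwa [add_zero])
      (fun f g hf hg α h => by rw [← add_assoc]; exact hg _ (hf _ h)) fun i k => ?_
    induction k with
    | zero => intro α h; rwa [Finsupp.single_zero, add_zero]
    | succ k ih =>
      intro α h
      rw [Finsupp.single_add, ← add_assoc]
      exact h1 _ _ (ih _ h)
  simpa using key α 0 h0

theorem monomial_add_single_one (α : Fin n →₀ ℕ) (i : Fin n) :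
    (monomial (α + Finsupp.single i 1) 1 : MvPolynomial (Fin n) ℂ) = X i * monomial α 1 := by
  rw [X, monomial_mul, one_mul, add_comm]

theorem opHom_monomial_zero (u : smoothFun n) : opHom n (monomial 0 1) u = u := by
  rw [show (monomial 0 1 : MvPolynomial (Fin n) ℂ) = 1 from rfl, map_one]
  rfl

theorem opHom_monomial_add_single (α : Fin n →₀ ℕ) (i : Fin n) (u : smoothFun n) :
    opHom n (monomial (α + Finsupp.single i 1) 1) u = dOp i (opHom n (monomial α 1) u) := by
  rw [monomial_add_single_one, opHom_mul, opHom_X]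

theorem opHom_eqOn_zero {U : Set (EuclideanSpace ℝ (Fin n))} (hU : IsOpen U) {u : smoothFun n}
    (h : Set.EqOn (u : EuclideanSpace ℝ (Fin n) → ℂ) 0 U) (p : MvPolynomial (Fin n) ℂ) :
    Set.EqOn (opHom n p u : EuclideanSpace ℝ (Fin n) → ℂ) 0 U := by
  have := opHom_eqOn hU (u := u) (v := 0) h p
  rwa [map_zero] at this

theorem hasCompactSupport_opHom {u : smoothFun n}
    (hu : HasCompactSupport (u : EuclideanSpace ℝ (Fin n) → ℂ)) (p : MvPolynomial (Fin n) ℂ) :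
    HasCompactSupport (opHom n p u : EuclideanSpace ℝ (Fin n) → ℂ) :=
  HasCompactSupport.intro hu fun _ hx =>
    opHom_eqOn_zero (isClosed_tsupport _).isOpen_compl
      (fun _ hy => image_eq_zero_of_notMem_tsupport hy) p hx

/-- Convolution of a locally integrable function with a test function. -/
def convFun {f : EuclideanSpace ℝ (Fin n) → ℂ} (hf : LocallyIntegrable f)
    {g : smoothFun n} (hg : HasCompactSupport (g : EuclideanSpace ℝ (Fin n) → ℂ)) : smoothFun n :=
  ⟨f ⋆[ContinuousLinearMap.mul ℝ ℂ] g.1, by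
    change ContDiff ℝ ((⊤ : ℕ∞) : WithTop ℕ∞) (f ⋆[ContinuousLinearMap.mul ℝ ℂ] g.1)
    exact hg.contDiff_convolution_right _ hf (contDiff_coe g)⟩

theorem convFun_apply {f : EuclideanSpace ℝ (Fin n) → ℂ} (hf : LocallyIntegrable f)
    {g : smoothFun n} (hg : HasCompactSupport (g : EuclideanSpace ℝ (Fin n) → ℂ))
    (x : EuclideanSpace ℝ (Fin n)) : (convFun hf hg).1 x = ∫ y, f y * g.1 (x - y) := rfl

theorem dOp_convFun {f : EuclideanSpace ℝ (Fin n) → ℂ} (hf : LocallyIntegrable f)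
    {g : smoothFun n} (hg : HasCompactSupport (g : EuclideanSpace ℝ (Fin n) → ℂ)) (i : Fin n)
    (hg' : HasCompactSupport (dOp i g : EuclideanSpace ℝ (Fin n) → ℂ)) :
    dOp i (convFun hf hg) = convFun hf hg' := by
  ext x
  have h1 : ContDiff ℝ 1 g.1 := (contDiff_coe g).of_le (WithTop.coe_le_coe.2 le_top)
  have h2 := hg.hasFDerivAt_convolution_right (ContinuousLinearMap.mul ℝ ℂ) hf h1 x
  rw [convFun_apply]
  change -Complex.I * fderiv ℝ (f ⋆[ContinuousLinearMap.mul ℝ ℂ] g.1) x _ =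
    ∫ y, f y * (-Complex.I * fderiv ℝ g.1 (x - y) _)
  rw [h2.fderiv, convolution_precompR_apply _ hf (hg.fderiv ℝ)
    (h1.continuous_fderiv one_ne_zero), convolution_def, ← integral_const_mul]
  refine integral_congr_ae (.of_forall fun y => ?_)
  simp only [ContinuousLinearMap.mul_apply']
  ring

theorem opHom_monomial_convFun {f : EuclideanSpace ℝ (Fin n) → ℂ} (hf : LocallyIntegrable f)
    {g : smoothFun n} (hg : HasCompactSupport (g : EuclideanSpace ℝ (Fin n) → ℂ))
    (α : Fin n →₀ ℕ) :
    opHom n (monomial α 1) (convFun hf hg) =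
      convFun hf (hasCompactSupport_opHom hg (monomial α 1)) := by
  induction α using finsupp_induction_add_single with
  | h0 =>
    rw [opHom_monomial_zero]
    ext x
    simp only [convFun_apply, opHom_monomial_zero]
  | h1 α i ih =>
    rw [opHom_monomial_add_single, ih]
    have h := hasCompactSupport_opHom hg (monomial (α + Finsupp.single i 1) 1)
    rw [opHom_monomial_add_single] at h
    rw [dOp_convFun hf _ i h]
    ext x
    simp only [convFun_apply, opHom_monomial_add_single]

/-- The dilation `u ↦ u (t⁻¹ ·)`. -/
def dilate (t : ℝ) (u : smoothFun n) : smoothFun n :=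
  ⟨fun x => u.1 (t⁻¹ • x), (contDiff_coe u).comp (contDiff_id.const_smul t⁻¹)⟩

theorem opHom_monomial_dilate (t : ℝ) (u : smoothFun n) (α : Fin n →₀ ℕ) :
    opHom n (monomial α 1) (dilate t u) =
      ((t⁻¹ ^ α.degree : ℝ) : ℂ) • dilate t (opHom n (monomial α 1) u) := by
  induction α using finsupp_induction_add_single with
  | h0 => simp
  | h1 α i ih =>
    have h : ∀ v : smoothFun n, dOp i (dilate t v) = ((t⁻¹ : ℝ) : ℂ) • dilate t (dOp i v) := by
      intro v
      ext x
      change -Complex.I * fderiv ℝ (fun x => v.1 (t⁻¹ • x)) x _ =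
        ((t⁻¹ : ℝ) : ℂ) * (-Complex.I * fderiv ℝ v.1 (t⁻¹ • x) _)
      rw [fderiv_comp_smul]
      simp
      ring
    rw [opHom_monomial_add_single, ih, map_smul, h, opHom_monomial_add_single, smul_smul,
      map_add, Finsupp.degree_single, pow_succ]
    push_cast
    rfl

/-- Cutoff functions of unit scale with uniformly bounded derivatives. -/
theorem exists_cutoff_one (n : ℕ) : ∃ C : (Fin n →₀ ℕ) → ℝ, ∀ A : Set (EuclideanSpace ℝ (Fin n)),
    ∃ χ : smoothFun n, (∀ x ∈ thickening (1 / 4) A, χ.1 x = 1) ∧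
      (∀ x, χ.1 x ≠ 0 → x ∈ thickening 1 A) ∧
      ∀ α x, ‖(opHom n (monomial α 1) χ).1 x‖ ≤ C α := by
  let b : ContDiffBump (0 : EuclideanSpace ℝ (Fin n)) := ⟨1 / 8, 1 / 4, by norm_num, by norm_num⟩
  let g : smoothFun n := ⟨fun x => (b.normed volume x : ℂ),
    Complex.ofRealCLM.contDiff.comp b.contDiff_normed⟩
  have hg : HasCompactSupport g.1 :=
    b.hasCompactSupport_normed.comp_left (g := fun x : ℝ => (x : ℂ)) Complex.ofReal_zero
  have hg0 : ∀ x, g.1 x ≠ 0 → ‖x‖ < 1 / 4 := by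
    intro x hx
    have h : x ∈ Function.support (b.normed volume) := fun h => hx (by simp [g, h])
    rw [b.support_normed_eq] at h
    rwa [mem_ball_zero_iff] at h
  have hg1 : ∫ x, g.1 x = 1 := by
    change ∫ x, (b.normed volume x : ℂ) = 1
    rw [integral_complex_ofReal, b.integral_normed, Complex.ofReal_one]
  -- The cutoff is the indicator of the `1/2`-neighbourhood of `A` convolved with a bump of radius
  -- `1/4`. All derivatives fall on the bump, so the bounds do not depend on `A`.
  refine ⟨fun α => ∫ x, ‖(opHom n (monomial α 1) g).1 x‖, fun A => ?_⟩
  let f : EuclideanSpace ℝ (Fin n) → ℂ := (thickening (1 / 2) A).indicator fun _ => 1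
  have hf : LocallyIntegrable f :=
    (locallyIntegrable_const 1).indicator isOpen_thickening.measurableSet
  have hf1 : ∀ x ∈ thickening (1 / 2) A, f x = 1 := fun x h => Set.indicator_of_mem h _
  have hf0 : ∀ x ∉ thickening (1 / 2) A, f x = 0 := fun x h => Set.indicator_of_notMem h _
  have hfn : ∀ x, ‖f x‖ ≤ 1 := fun x => by
    by_cases h : x ∈ thickening (1 / 2) A
    · simp [hf1 x h]
    · simp [hf0 x h]
  refine ⟨convFun hf hg, fun x hx => ?_, fun x hx => ?_, fun α x => ?_⟩
  · rw [convFun_apply, ← hg1, ← integral_sub_left_eq_self (fun y => g.1 y) volume x]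
    refine integral_congr_ae (.of_forall fun y => ?_)
    change f y * g.1 (x - y) = g.1 (x - y)
    by_cases hy : g.1 (x - y) = 0
    · rw [hy, mul_zero]
    · have h1 := hg0 _ hy
      obtain ⟨a, ha, hxa⟩ := mem_thickening_iff.1 hx
      have h2 : y ∈ thickening (1 / 2) A := by
        refine mem_thickening_iff.2 ⟨a, ha, ?_⟩
        have := dist_triangle_left y a x
        rw [dist_eq_norm x y] at this
        linarith
      rw [hf1 y h2, one_mul]
  · rw [convFun_apply] at hx
    obtain ⟨y, hy⟩ : ∃ y, f y * g.1 (x - y) ≠ 0 := by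
      by_contra! h
      exact hx (by simp [h])
    have h1 := hg0 _ (right_ne_zero_of_mul hy)
    have h2 : y ∈ thickening (1 / 2) A := by
      by_contra h
      exact left_ne_zero_of_mul hy (hf0 y h)
    obtain ⟨a, ha, hya⟩ := mem_thickening_iff.1 h2
    refine mem_thickening_iff.2 ⟨a, ha, ?_⟩
    have := dist_triangle x y a
    rw [dist_eq_norm x y] at this
    linarith
  · dsimp only
    rw [opHom_monomial_convFun, convFun_apply,
      ← integral_sub_left_eq_self (fun y => ‖(opHom n (monomial α 1) g).1 y‖) volume x]
    have hi : Integrable fun y => ‖(opHom n (monomial α 1) g).1 y‖ :=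
      ((continuous_coe _).integrable_of_hasCompactSupport (hasCompactSupport_opHom hg _)).norm
    refine norm_integral_le_of_norm_le (hi.comp_sub_left x) (.of_forall fun y => ?_)
    rw [norm_mul]
    exact mul_le_of_le_one_left (norm_nonneg _) (hfn y)

/-- Cutoff functions at scale `t`, with derivatives of order `k` bounded by `C t ^ (-k)`. -/
theorem exists_cutoff (n : ℕ) : ∃ C : (Fin n →₀ ℕ) → ℝ, (∀ α, 0 ≤ C α) ∧
    ∀ (A : Set (EuclideanSpace ℝ (Fin n))) (t : ℝ), 0 < t →
    ∃ χ : smoothFun n, (∀ x ∈ thickening (t / 4) A, χ.1 x = 1) ∧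
      (∀ x, χ.1 x ≠ 0 → x ∈ thickening t A) ∧
      ∀ α x, ‖(opHom n (monomial α 1) χ).1 x‖ ≤ C α * t⁻¹ ^ α.degree := by
  obtain ⟨C, hC⟩ := exists_cutoff_one n
  have hC0 : ∀ α, 0 ≤ C α := fun α => by
    obtain ⟨χ, -, -, h⟩ := hC ∅
    exact (norm_nonneg _).trans (h α 0)
  refine ⟨C, hC0, fun A t ht => ?_⟩
  obtain ⟨χ, h1, h2, h3⟩ := hC ((fun x => t⁻¹ • x) '' A)
  have hd : ∀ x y : EuclideanSpace ℝ (Fin n), dist (t⁻¹ • x) (t⁻¹ • y) = t⁻¹ * dist x y := by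
    intro x y
    rw [dist_smul₀, Real.norm_of_nonneg (inv_nonneg.2 ht.le)]
  refine ⟨dilate t χ, fun x hx => h1 (t⁻¹ • x) ?_, fun x hx => ?_, fun α x => ?_⟩
  · obtain ⟨a, ha, hxa⟩ := mem_thickening_iff.1 hx
    refine mem_thickening_iff.2 ⟨_, ⟨a, ha, rfl⟩, ?_⟩
    rw [hd, inv_mul_lt_iff₀ ht]
    linarith
  · obtain ⟨_, ⟨a, ha, rfl⟩, hxa⟩ := mem_thickening_iff.1 (h2 (t⁻¹ • x) hx)
    refine mem_thickening_iff.2 ⟨a, ha, ?_⟩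
    rwa [hd, inv_mul_lt_iff₀ ht, mul_one] at hxa
  · rw [opHom_monomial_dilate]
    change ‖((t⁻¹ ^ α.degree : ℝ) : ℂ) * (opHom n (monomial α 1) χ).1 (t⁻¹ • x)‖ ≤ _
    rw [norm_mul, Complex.norm_real, Real.norm_of_nonneg (by positivity), mul_comm]
    exact mul_le_mul_of_nonneg_right (h3 _ _) (by positivity)

/-- A function that is smooth on an open set agrees near any compact subset with a function that
is smooth everywhere. -/
theorem exists_smoothFun_eqOn {Ω K : Set (EuclideanSpace ℝ (Fin n))} (hΩ : IsOpen Ω)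
    (hK : IsCompact K) (hKΩ : K ⊆ Ω) {u : EuclideanSpace ℝ (Fin n) → ℂ}
    (hu : ContDiffOn ℝ ((⊤ : ℕ∞) : WithTop ℕ∞) u Ω) :
    ∃ (U : Set (EuclideanSpace ℝ (Fin n))) (v : smoothFun n), IsOpen U ∧ K ⊆ U ∧
      Set.EqOn u v U := by
  obtain ⟨δ, hδ, hKδ⟩ := hK.exists_cthickening_subset_open hΩ hKΩ
  obtain ⟨C, -, hC⟩ := exists_cutoff n
  obtain ⟨χ, h1, h2, -⟩ := hC K δ hδ
  refine ⟨thickening (δ / 4) K, ⟨fun x => χ.1 x * u x, ?_⟩, isOpen_thickening,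
    self_subset_thickening (by positivity) K, fun x hx => by simp [h1 x hx]⟩
  change ContDiff ℝ ((⊤ : ℕ∞) : WithTop ℕ∞) fun x => χ.1 x * u x
  rw [contDiff_iff_contDiffAt]
  intro x
  by_cases hx : x ∈ Ω
  · exact (contDiff_coe χ).contDiffAt.mul (hu.contDiffAt (hΩ.mem_nhds hx))
  · have hx' : x ∈ (cthickening δ K)ᶜ := fun h => hx (hKδ h)
    refine contDiffAt_const (c := (0 : ℂ)) |>.congr_of_eventuallyEq ?_
    filter_upwards [isClosed_cthickening.isOpen_compl.mem_nhds hx'] with y hy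
    have : χ.1 y = 0 := by
      by_contra h
      exact hy (thickening_subset_cthickening _ _ (h2 y h))
    simp [this]

end IterateSystems

end

/-! ### `L²` norms, Fourier transform and Plancherel. -/

noncomputable section

namespace IterateSystems

open MvPolynomial MeasureTheory Metric

open scoped FourierTransform

variable {n : ℕ}

/-- The `L²` norm over a set, as a real number. -/
def l2 {F : Type*} [NormedAddCommGroup F] (A : Set (EuclideanSpace ℝ (Fin n)))
    (f : EuclideanSpace ℝ (Fin n) → F) : ℝ :=
  (eLpNorm f 2 (volume.restrict A)).toReal

theorem l2_nonneg {F : Type*} [NormedAddCommGroup F] (A : Set (EuclideanSpace ℝ (Fin n)))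
    (f : EuclideanSpace ℝ (Fin n) → F) : 0 ≤ l2 A f := ENNReal.toReal_nonneg

theorem toReal_eLpNorm_le_sum {X ι F G : Type*} [NormedAddCommGroup F] [NormedAddCommGroup G]
    [MeasurableSpace X] {μ : Measure X} (s : Finset ι)
    {f : X → F} {g : ι → X → G} {c : ι → ℝ} (hc : ∀ i ∈ s, 0 ≤ c i)
    (hg : ∀ i ∈ s, MemLp (g i) 2 μ) (h : ∀ᵐ x ∂μ, ‖f x‖ ≤ ∑ i ∈ s, c i * ‖g i x‖) :
    (eLpNorm f 2 μ).toReal ≤ ∑ i ∈ s, c i * (eLpNorm (g i) 2 μ).toReal := by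
  have h1 : eLpNorm f 2 μ ≤ ∑ i ∈ s, ENNReal.ofReal (c i) * eLpNorm (g i) 2 μ := by
    calc eLpNorm f 2 μ ≤ eLpNorm (∑ i ∈ s, fun x => c i * ‖g i x‖) 2 μ := by
          refine eLpNorm_mono_ae_real ?_
          filter_upwards [h] with x hx
          rwa [Finset.sum_apply]
      _ ≤ ∑ i ∈ s, eLpNorm (fun x => c i * ‖g i x‖) 2 μ :=
          eLpNorm_sum_le (fun i hi => (hg i hi).1.norm.const_mul _) one_le_two
      _ ≤ _ := Finset.sum_le_sum fun i hi => eLpNorm_le_mul_eLpNorm_of_ae_le_mul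
          (.of_forall fun x => by
            rw [norm_mul, norm_norm, Real.norm_of_nonneg (hc i hi)]) 2
  refine (ENNReal.toReal_mono (ENNReal.sum_ne_top.2 fun i hi =>
    ENNReal.mul_ne_top ENNReal.ofReal_ne_top (hg i hi).2.ne) h1).trans_eq ?_
  rw [ENNReal.toReal_sum fun i hi => ENNReal.mul_ne_top ENNReal.ofReal_ne_top (hg i hi).2.ne]
  exact Finset.sum_congr rfl fun i hi => by
    rw [ENNReal.toReal_mul, ENNReal.toReal_ofReal (hc i hi)]

theorem memLp_restrict (u : smoothFun n) {A : Set (EuclideanSpace ℝ (Fin n))} (hA : IsCompact A) :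
    MemLp u.1 2 (volume.restrict A) := by
  have : Fact (volume A < ⊤) := ⟨hA.measure_lt_top⟩
  obtain ⟨C, hC⟩ := hA.exists_bound_of_continuousOn (continuous_coe u).continuousOn
  exact MemLp.of_bound (continuous_coe u).aestronglyMeasurable C
    (ae_restrict_of_forall_mem hA.measurableSet hC)

theorem l2_mono (u : smoothFun n) {A B : Set (EuclideanSpace ℝ (Fin n))} (hB : IsCompact B)
    (h : A ⊆ B) : l2 A u.1 ≤ l2 B u.1 :=
  ENNReal.toReal_mono (memLp_restrict u hB).2.ne
    (eLpNorm_mono_measure _ (Measure.restrict_mono h le_rfl))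

theorem l2_eq_univ {F : Type*} [NormedAddCommGroup F] {f : EuclideanSpace ℝ (Fin n) → F}
    {A : Set (EuclideanSpace ℝ (Fin n))} (h : Function.support f ⊆ A) : l2 Set.univ f = l2 A f := by
  rw [l2, l2, Measure.restrict_univ, eLpNorm_restrict_eq_of_support_subset h]

theorem l2_congr {F : Type*} [NormedAddCommGroup F] {f g : EuclideanSpace ℝ (Fin n) → F}
    {A : Set (EuclideanSpace ℝ (Fin n))} (hA : MeasurableSet A) (h : Set.EqOn f g A) :
    l2 A f = l2 A g := by
  rw [l2, l2, eLpNorm_congr_ae (ae_restrict_of_forall_mem hA h)]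

/-- A test function as a Schwartz function. -/
def toSchwartz (u : smoothFun n) (hu : HasCompactSupport u.1) :
    SchwartzMap (EuclideanSpace ℝ (Fin n)) ℂ :=
  hu.toSchwartzMap (contDiff_coe u)

theorem toSchwartz_apply (u : smoothFun n) (hu : HasCompactSupport u.1)
    (x : EuclideanSpace ℝ (Fin n)) : toSchwartz u hu x = u.1 x := rfl

/-- The Fourier transform of a test function. -/
def testFourier (u : smoothFun n) (hu : HasCompactSupport u.1) :
    SchwartzMap (EuclideanSpace ℝ (Fin n)) ℂ := 𝓕 (toSchwartz u hu)

/-- The transform has kernel `exp (-2πi x·ξ)`, so `D_i` becomes multiplication by `2π ξ_i` and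
symbols appear at `2π ξ`. This is harmless, as the symbol bounds hold at all points. -/
theorem fourier_toSchwartz_dOp (u : smoothFun n) (hu : HasCompactSupport u.1) (i : Fin n)
    (hu' : HasCompactSupport (dOp i u).1) (ξ : EuclideanSpace ℝ (Fin n)) :
    𝓕 (toSchwartz (dOp i u) hu') ξ = ((2 * Real.pi * ξ i : ℝ) : ℂ) * 𝓕 (toSchwartz u hu) ξ := by
  have h1 : toSchwartz (dOp i u) hu' = (-Complex.I) •
      LineDeriv.lineDerivOp (EuclideanSpace.single i (1 : ℝ)) (toSchwartz u hu) := by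
    ext x
    rw [smul_apply, SchwartzMap.lineDerivOp_apply_eq_fderiv]
    rfl
  have h2 : (fun x : EuclideanSpace ℝ (Fin n) =>
      inner ℝ x (EuclideanSpace.single i (1 : ℝ))).HasTemperateGrowth :=
    ((innerSL ℝ).flip (EuclideanSpace.single i (1 : ℝ))).hasTemperateGrowth
  rw [h1, FourierTransform.fourier_smul, SchwartzMap.fourier_lineDerivOp_eq]
  simp only [smul_apply, SchwartzMap.smulLeftCLM_apply_apply h2, smul_eq_mul]
  rw [EuclideanSpace.inner_single_right]
  simp
  ring_nf
  rw [Complex.I_sq]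
  ring

theorem fourier_toSchwartz_opHom (p : MvPolynomial (Fin n) ℂ) :
    ∀ (u : smoothFun n) (hu : HasCompactSupport u.1) (hu' : HasCompactSupport (opHom n p u).1)
      (ξ : EuclideanSpace ℝ (Fin n)),
    𝓕 (toSchwartz (opHom n p u) hu') ξ =
      symb p ((2 * Real.pi) • ξ) * 𝓕 (toSchwartz u hu) ξ := by
  induction p using MvPolynomial.induction_on with
  | C a =>
    intro u hu hu' ξ
    have h : toSchwartz (opHom n (C a) u) hu' = a • toSchwartz u hu := by
      ext x
      rw [smul_apply, toSchwartz_apply, toSchwartz_apply, ← algebraMap_eq,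
        AlgHom.commutes]
      rfl
    rw [h, FourierTransform.fourier_smul, smul_apply, symb, eval_C, smul_eq_mul]
  | add p q hp hq =>
    intro u hu hu' ξ
    have h : toSchwartz (opHom n (p + q) u) hu' =
        toSchwartz (opHom n p u) (hasCompactSupport_opHom hu p) +
        toSchwartz (opHom n q u) (hasCompactSupport_opHom hu q) := by
      ext x
      rw [add_apply, toSchwartz_apply, toSchwartz_apply, toSchwartz_apply, map_add]
      rfl
    rw [h, FourierTransform.fourier_add, add_apply, hp u hu, hq u hu, symb, symb, symb,
      map_add, add_mul]
  | mul_X p i hp =>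
    intro u hu hu' ξ
    have h0 := hasCompactSupport_opHom hu (X i)
    have h : toSchwartz (opHom n (p * X i) u) hu' =
        toSchwartz (opHom n p (opHom n (X i) u)) (hasCompactSupport_opHom h0 p) := by
      ext x
      rw [toSchwartz_apply, toSchwartz_apply, opHom_mul]
    rw [h, hp _ h0]
    have h1 : toSchwartz (opHom n (X i) u) h0 =
        toSchwartz (dOp i u) (by rwa [opHom_X] at h0) := by
      ext x
      rw [toSchwartz_apply, toSchwartz_apply, opHom_X]
    rw [h1, fourier_toSchwartz_dOp u hu, symb, symb, map_mul, eval_X, ← mul_assoc]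
    simp

theorem testFourier_opHom (p : MvPolynomial (Fin n) ℂ) (u : smoothFun n)
    (hu : HasCompactSupport u.1) (ξ : EuclideanSpace ℝ (Fin n)) :
    testFourier (opHom n p u) (hasCompactSupport_opHom hu p) ξ =
      symb p ((2 * Real.pi) • ξ) * testFourier u hu ξ :=
  fourier_toSchwartz_opHom p u hu _ ξ

theorem l2_eq_fourier (u : smoothFun n) (hu : HasCompactSupport u.1) :
    l2 Set.univ u.1 = (eLpNorm (testFourier u hu) 2 volume).toReal := by
  rw [l2, Measure.restrict_univ, testFourier, ← SchwartzMap.norm_toLp,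
    SchwartzMap.norm_fourier_toL2_eq, SchwartzMap.norm_toLp]
  rfl

/-- Pointwise bounds between symbols give `L²` bounds between operators on test functions. -/
theorem l2_opHom_le {N : ℕ} {p : MvPolynomial (Fin n) ℂ} {q : Fin N → MvPolynomial (Fin n) ℂ}
    {a b : ℝ} (ha : 0 ≤ a) (hb : 0 ≤ b)
    (h : ∀ ξ, ‖symb p ξ‖ ≤ a * ∑ j, ‖symb (q j) ξ‖ + b)
    {u : smoothFun n} (hu : HasCompactSupport u.1) :
    l2 Set.univ (opHom n p u).1 ≤
      a * ∑ j, l2 Set.univ (opHom n (q j) u).1 + b * l2 Set.univ u.1 := by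
  rw [l2_eq_fourier _ (hasCompactSupport_opHom hu p), l2_eq_fourier u hu]
  simp only [fun j => l2_eq_fourier _ (hasCompactSupport_opHom hu (q j))]
  -- The index `none` carries the term with `u`, and `some j` the term with `q j`.
  refine (toReal_eLpNorm_le_sum (ι := Option (Fin N)) Finset.univ
    (c := fun o => o.elim b fun _ => a)
    (g := fun o => o.elim (testFourier u hu : EuclideanSpace ℝ (Fin n) → ℂ) fun j =>
      testFourier (opHom n (q j) u) (hasCompactSupport_opHom hu (q j))) ?_ ?_ ?_).trans_eq ?_
  · rintro (_ | j) -
    exacts [hb, ha]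
  · rintro (_ | j) -
    exacts [SchwartzMap.memLp _ _ _, SchwartzMap.memLp _ _ _]
  · refine .of_forall fun ξ => ?_
    rw [Fintype.sum_option]
    simp only [Option.elim]
    rw [testFourier_opHom p u hu]
    simp only [fun j => testFourier_opHom (q j) u hu, norm_mul]
    rw [← Finset.mul_sum, ← Finset.sum_mul]
    nlinarith [mul_le_mul_of_nonneg_right (h ((2 * Real.pi) • ξ))
      (norm_nonneg (testFourier u hu ξ))]
  · rw [Fintype.sum_option]
    simp only [Option.elim]
    rw [← Finset.mul_sum, add_comm]

end IterateSystems

end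

/-! ### The local `L²` estimate. -/

noncomputable section

namespace IterateSystems

open MvPolynomial MeasureTheory Metric

variable {n N : ℕ}

/-- Scaled form of condition `(ℋ)`, for the Taylor coefficients of the symbols. -/
theorem CondHWith.exists_hasse_le {P : Fin N → MvPolynomial (Fin n) ℂ} {m : ℕ} {γ : ℝ}
    (hPm : HasOrder P m) (hm : 0 < m) (hγ : (m : ℝ) ≤ γ) (h : CondHWith P γ)
    {α : Fin n →₀ ℕ} (hα0 : α ≠ 0) (hα : α.degree ≤ m) {ε : ℝ} (hε : 0 < ε) :
    ∃ C, 0 ≤ C ∧ ∀ j t, 0 < t → t ≤ 1 → ∀ ξ,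
      t⁻¹ ^ α.degree * ‖symb (hasse α (P j)) ξ‖ ≤ ε * ∑ i, ‖symb (P i) ξ‖ + C * t ^ (-γ) := by
  obtain ⟨C, hC, hCα⟩ := (condHWith_iff_hasse hPm γ).1 h α hα
  have hm' : (0 : ℝ) < m := Nat.cast_pos.2 hm
  have hγ0 : 0 < γ := hm'.trans_le hγ
  set d := α.degree
  have hd : (0 : ℝ) < d := Nat.cast_pos.2 (Nat.pos_of_ne_zero fun h => hα0 ((Finsupp.degree_eq_zero_iff α).1 h))
  set θ : ℝ := d / γ with hθ
  have hθ0 : 0 < θ := div_pos hd hγ0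
  have hθ1 : θ ≤ 1 := (div_le_one hγ0).2 ((Nat.cast_le.2 hα).trans hγ)
  -- Chosen so that the geometric mean of `ε f` and `C' t ^ (-γ)`, with weights `1 - θ` and `θ = |α|
  -- / γ`, is exactly `t ^ (-|α|) C f ^ (1 - θ)`. The condition `|α| ≤ m ≤ γ` makes `θ ≤ 1`.
  set C' : ℝ := (C * ε ^ (-(1 - θ))) ^ (1 / θ) with hC'
  have hC'0 : 0 ≤ C' := by positivity
  refine ⟨ε + C', by positivity, fun j t ht ht1 ξ => ?_⟩
  have ht' : 1 ≤ t ^ (-γ) := Real.one_le_rpow_of_pos_of_le_one_of_nonpos ht ht1 (by linarith)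
  set f := symbSize P ξ with hf
  have hf0 : 0 < f := zero_lt_one.trans_le (one_le_symbSize P ξ)
  have h1 := Real.geom_mean_le_arith_mean2_weighted (w₁ := 1 - θ) (w₂ := θ) (p₁ := ε * f)
    (p₂ := C' * t ^ (-γ)) (by linarith) hθ0.le (by positivity) (by positivity) (by ring)
  have h2 : (ε * f) ^ (1 - θ) * (C' * t ^ (-γ)) ^ θ = t⁻¹ ^ d * (C * f ^ (1 - θ)) := by
    have e1 : C' ^ θ = C * ε ^ (-(1 - θ)) := by
      rw [hC', ← Real.rpow_mul (by positivity), one_div_mul_cancel hθ0.ne', Real.rpow_one]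
    have e2 : (t ^ (-γ)) ^ θ = t⁻¹ ^ d := by
      rw [← Real.rpow_mul ht.le, hθ, neg_mul, mul_div_cancel₀ _ hγ0.ne', Real.rpow_neg ht.le,
        Real.rpow_natCast, inv_pow]
    rw [Real.mul_rpow hε.le hf0.le, Real.mul_rpow hC'0 (by positivity), e1, e2,
      Real.rpow_neg hε.le]
    field_simp
  have h3 : t⁻¹ ^ d * ‖symb (hasse α (P j)) ξ‖ ≤ t⁻¹ ^ d * (C * f ^ (1 - θ)) :=
    mul_le_mul_of_nonneg_left (hCα ξ j) (by positivity)
  have h4 : (1 - θ) * (ε * f) ≤ 1 * (ε * f) :=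
    mul_le_mul_of_nonneg_right (by linarith) (by positivity)
  have h5 : θ * (C' * t ^ (-γ)) ≤ 1 * (C' * t ^ (-γ)) :=
    mul_le_mul_of_nonneg_right hθ1 (by positivity)
  have h6 : f = 1 + ∑ i, ‖symb (P i) ξ‖ := rfl
  have h7 : ε * 1 ≤ ε * t ^ (-γ) := mul_le_mul_of_nonneg_left ht' hε.le
  rw [h6] at h4
  rw [h2, h6] at h1
  rw [h6] at h3
  nlinarith

/-- The sum of the scaled `L²` norms of the Taylor coefficients of positive order. -/
def lowNorm (P : Fin N → MvPolynomial (Fin n) ℂ) (v : smoothFun n)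
    (A : Set (EuclideanSpace ℝ (Fin n))) (t : ℝ) : ℝ :=
  ∑ j, ∑ α ∈ (taylorShift n (P j)).support.erase 0,
    t⁻¹ ^ α.degree * l2 A (opHom n (hasse α (P j)) v).1

/-- The sum of the `L²` norms of the `P_j(D) v`. -/
def sysNorm (P : Fin N → MvPolynomial (Fin n) ℂ) (v : smoothFun n)
    (A : Set (EuclideanSpace ℝ (Fin n))) : ℝ :=
  ∑ j, l2 A (opHom n (P j) v).1

theorem sysNorm_nonneg (P : Fin N → MvPolynomial (Fin n) ℂ) (v : smoothFun n)
    (A : Set (EuclideanSpace ℝ (Fin n))) : 0 ≤ sysNorm P v A :=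
  Finset.sum_nonneg fun _ _ => l2_nonneg _ _

theorem sysNorm_mono (P : Fin N → MvPolynomial (Fin n) ℂ) (v : smoothFun n)
    {A B : Set (EuclideanSpace ℝ (Fin n))} (hB : IsCompact B) (h : A ⊆ B) :
    sysNorm P v A ≤ sysNorm P v B :=
  Finset.sum_le_sum fun _ _ => l2_mono _ hB h

theorem lowNorm_mono (P : Fin N → MvPolynomial (Fin n) ℂ) (v : smoothFun n)
    {A B : Set (EuclideanSpace ℝ (Fin n))} (hB : IsCompact B) (h : A ⊆ B) {t t' : ℝ}
    (ht : 0 < t') (htt : t' ≤ t) :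
    lowNorm P v A t ≤ lowNorm P v B t' :=
  Finset.sum_le_sum fun _ _ => Finset.sum_le_sum fun _ _ =>
    mul_le_mul (pow_le_pow_left₀ (inv_nonneg.2 (ht.le.trans htt)) (inv_anti₀ ht htt) _)
      (l2_mono _ hB h) (l2_nonneg _ _) (by positivity)

/-- Plancherel is applied to `χ v` with a cutoff `χ` of scale `t`. By the Leibniz rule `P_j(D)(χ v)`
is `χ P_j(D) v` plus terms in which `D^α χ = O(t ^ (-|α|))` multiplies a Taylor coefficient of `P_j`
applied to `v`; these make up `lowNorm`. -/
theorem exists_l2_opHom_le (P : Fin N → MvPolynomial (Fin n) ℂ) :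
    ∃ C, 0 ≤ C ∧ ∀ (A : Set (EuclideanSpace ℝ (Fin n))) (t : ℝ) (v : smoothFun n)
      (p : MvPolynomial (Fin n) ℂ) (a b : ℝ), IsCompact A → 0 < t → 0 ≤ a → 0 ≤ b →
      (∀ ξ, ‖symb p ξ‖ ≤ a * ∑ j, ‖symb (P j) ξ‖ + b) →
      l2 A (opHom n p v).1 ≤
        C * (a * (sysNorm P v (cthickening t A) + lowNorm P v (cthickening t A) t) +
          b * l2 (cthickening t A) v.1) := by
  obtain ⟨c, hc0, hc⟩ := exists_cutoff n
  let S : Finset (Fin n →₀ ℕ) := insert 0 (Finset.univ.biUnion fun j => (taylorShift n (P j)).support)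
  let C := ∑ α ∈ S, c α
  have hcC : ∀ α ∈ S, c α ≤ C := fun α h => Finset.single_le_sum (fun β _ => hc0 β) h
  have hcS : ∀ j, ∀ α ∈ (taylorShift n (P j)).support, c α ≤ C := fun j α h =>
    hcC α (Finset.mem_insert_of_mem (Finset.mem_biUnion.2 ⟨j, Finset.mem_univ _, h⟩))
  have hC0 : 0 ≤ C := Finset.sum_nonneg fun α _ => hc0 α
  refine ⟨C, hC0, fun A t v p a b hA ht ha hb hp => ?_⟩
  obtain ⟨χ, h1, h2, h3⟩ := hc A t ht
  set B := cthickening t A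
  have hB : IsCompact B := hA.cthickening
  set w := mulOp χ v
  have hw0 : Set.EqOn w.1 0 Bᶜ := by
    intro x hx
    have : χ.1 x = 0 := by
      by_contra h
      exact hx (thickening_subset_cthickening _ _ (h2 x h))
    rw [mulOp_apply, this, zero_mul]
    rfl
  have hBo : IsOpen Bᶜ := hB.isClosed.isOpen_compl
  have hw : HasCompactSupport w.1 := HasCompactSupport.intro hB fun x hx => hw0 hx
  have hsupp : ∀ q, Function.support (opHom n q w).1 ⊆ B := fun q x hx => by
    by_contra h
    exact hx (opHom_eqOn_zero hBo hw0 q h)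
  have hwA : Set.EqOn (opHom n p v).1 (opHom n p w).1 (thickening (t / 4) A) := by
    refine opHom_eqOn isOpen_thickening (fun x hx => ?_) p
    rw [mulOp_apply, h1 x hx, one_mul]
  have e1 : l2 A (opHom n p v).1 ≤ l2 Set.univ (opHom n p w).1 := by
    rw [l2_congr hA.measurableSet (hwA.mono (self_subset_thickening (by positivity) A)),
      l2_eq_univ (hsupp p)]
    exact l2_mono _ hB (self_subset_cthickening A)
  have e2 := l2_opHom_le ha hb hp hw
  have e3 : l2 Set.univ w.1 ≤ C * l2 B v.1 := by
    rw [l2_eq_univ (A := B) fun x hx => by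
      by_contra h
      exact hx (hw0 h)]
    refine (toReal_eLpNorm_le_sum (Finset.univ : Finset Unit) (c := fun _ => C)
      (g := fun _ => v.1) (fun _ _ => hC0) (fun _ _ => memLp_restrict v hB)
      (.of_forall fun x => ?_)).trans_eq (by simp [l2])
    rw [Finset.univ_unique, Finset.sum_singleton, mulOp_apply, norm_mul]
    refine mul_le_mul_of_nonneg_right ?_ (norm_nonneg _)
    have := h3 0 x
    rw [opHom_monomial_zero, map_zero, pow_zero, mul_one] at this
    exact this.trans (hcC 0 (Finset.mem_insert_self _ _))
  have e4 : ∀ j, l2 Set.univ (opHom n (P j) w).1 ≤ C * (l2 B (opHom n (P j) v).1 +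
      ∑ α ∈ (taylorShift n (P j)).support.erase 0,
        t⁻¹ ^ α.degree * l2 B (opHom n (hasse α (P j)) v).1) := by
    intro j
    rw [l2_eq_univ (hsupp (P j))]
    have hL : l2 B (opHom n (P j) w).1 ≤ ∑ α ∈ (taylorShift n (P j)).support,
        (C * t⁻¹ ^ α.degree) * l2 B (opHom n (hasse α (P j)) v).1 := by
      refine toReal_eLpNorm_le_sum _ (fun _ _ => by positivity)
        (fun α _ => memLp_restrict (opHom n (hasse α (P j)) v) hB) (.of_forall fun x => ?_)
      rw [opHom_mulOp, AddSubmonoidClass.coe_finsetSum, Finset.sum_apply]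
      refine (norm_sum_le _ _).trans (Finset.sum_le_sum fun α hα => ?_)
      rw [mulOp_apply, norm_mul]
      exact mul_le_mul_of_nonneg_right ((h3 α x).trans
        (mul_le_mul_of_nonneg_right (hcS j α hα) (by positivity))) (norm_nonneg _)
    refine hL.trans ?_
    simp only [mul_assoc]
    rw [← Finset.mul_sum]
    refine mul_le_mul_of_nonneg_left ?_ hC0
    by_cases h0 : 0 ∈ (taylorShift n (P j)).support
    · rw [← Finset.add_sum_erase _ _ h0, hasse_zero_left, map_zero, pow_zero, one_mul]
    · rw [Finset.erase_eq_of_notMem h0]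
      exact le_add_of_nonneg_left (l2_nonneg _ _)
  have e5 : ∑ j, l2 Set.univ (opHom n (P j) w).1 ≤ C * (sysNorm P v B + lowNorm P v B t) := by
    rw [sysNorm, lowNorm, ← Finset.sum_add_distrib, Finset.mul_sum]
    exact Finset.sum_le_sum fun j _ => e4 j
  calc _ ≤ _ := e1.trans e2
    _ ≤ a * (C * (sysNorm P v B + lowNorm P v B t)) + b * (C * l2 B v.1) := by gcongr
    _ = _ := by ring

/-- The preceding bound, applied to the Taylor coefficients themselves, uses the interpolated form
of `(ℋ)` to put an arbitrarily small factor before the commutator terms. They reappear on a larger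
set, so they cannot yet be absorbed. -/
theorem CondHWith.exists_lowNorm_le {P : Fin N → MvPolynomial (Fin n) ℂ} {m : ℕ} {γ : ℝ}
    (hPm : HasOrder P m) (hm : 0 < m) (hγ : (m : ℝ) ≤ γ) (h : CondHWith P γ)
    {ε : ℝ} (hε : 0 < ε) :
    ∃ K, 0 ≤ K ∧ ∀ (A : Set (EuclideanSpace ℝ (Fin n))) (t : ℝ) (v : smoothFun n),
      IsCompact A → 0 < t → t ≤ 1 →
      lowNorm P v A t ≤ ε * (sysNorm P v (cthickening t A) + lowNorm P v (cthickening t A) t) +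
        K * t ^ (-γ) * l2 (cthickening t A) v.1 := by
  obtain ⟨C, hC0, hC⟩ := exists_l2_opHom_le P
  obtain ⟨k, hk⟩ : ∃ k : ℝ, k = ∑ j, (((taylorShift n (P j)).support.erase 0).card : ℝ) := ⟨_, rfl⟩
  have hk0 : 0 ≤ k := hk ▸ Finset.sum_nonneg fun _ _ => Nat.cast_nonneg _
  -- `k` counts the terms of `lowNorm`, each contributing `δ * C` times the same quantity.
  set δ := ε / (k * C + 1) with hδ
  have hδ0 : 0 < δ := div_pos hε (by positivity)
  have hH : ∀ α : Fin n →₀ ℕ, ∃ c, 0 ≤ c ∧ (α ≠ 0 → α.degree ≤ m → ∀ j t, 0 < t → t ≤ 1 → ∀ ξ,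
      t⁻¹ ^ α.degree * ‖symb (hasse α (P j)) ξ‖ ≤ δ * ∑ i, ‖symb (P i) ξ‖ + c * t ^ (-γ)) := by
    intro α
    by_cases hα : α ≠ 0 ∧ α.degree ≤ m
    · obtain ⟨c, hc, hc'⟩ := h.exists_hasse_le hPm hm hγ hα.1 hα.2 hδ0
      exact ⟨c, hc, fun _ _ => hc'⟩
    · exact ⟨0, le_rfl, fun h1 h2 => absurd ⟨h1, h2⟩ hα⟩
  choose c hc0 hc using hH
  refine ⟨∑ j, ∑ α ∈ (taylorShift n (P j)).support.erase 0, C * c α,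
    Finset.sum_nonneg fun _ _ => Finset.sum_nonneg fun α _ => mul_nonneg hC0 (hc0 α),
    fun A t v hA ht ht1 => ?_⟩
  set B := cthickening t A
  set T := sysNorm P v B + lowNorm P v B t with hT
  have hT0 : 0 ≤ T := add_nonneg (sysNorm_nonneg _ _ _)
    (Finset.sum_nonneg fun _ _ => Finset.sum_nonneg fun _ _ =>
      mul_nonneg (by positivity) (l2_nonneg _ _))
  have key : ∀ j, ∀ α ∈ (taylorShift n (P j)).support.erase 0,
      t⁻¹ ^ α.degree * l2 A (opHom n (hasse α (P j)) v).1 ≤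
        δ * C * T + C * c α * (t ^ (-γ) * l2 B v.1) := by
    intro j α hα
    obtain ⟨hα0, hα⟩ := Finset.mem_erase.1 hα
    have hd : α.degree ≤ m := (degree_le_of_mem_support_taylorShift hα).trans_eq (hPm j)
    have htd : 0 < t ^ α.degree := by positivity
    have h1 : l2 A (opHom n (hasse α (P j)) v).1 ≤ C * (t ^ α.degree * δ * T +
        t ^ α.degree * (c α * t ^ (-γ)) * l2 B v.1) :=
      hC A t v (hasse α (P j)) (t ^ α.degree * δ) (t ^ α.degree * (c α * t ^ (-γ))) hA ht
      (by positivity) (mul_nonneg htd.le (mul_nonneg (hc0 α) (by positivity))) fun ξ => by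
        have := mul_le_mul_of_nonneg_left (hc α hα0 hd j t ht ht1 ξ) htd.le
        rw [← mul_assoc, inv_pow, mul_inv_cancel₀ htd.ne', one_mul] at this
        linarith
    have h2 := mul_le_mul_of_nonneg_left h1 (inv_nonneg.2 htd.le)
    rw [inv_pow]
    refine h2.trans_eq ?_
    field_simp
  calc lowNorm P v A t ≤ ∑ j, ∑ α ∈ (taylorShift n (P j)).support.erase 0,
        (δ * C * T + C * c α * (t ^ (-γ) * l2 B v.1)) :=
        Finset.sum_le_sum fun j _ => Finset.sum_le_sum fun α hα => key j α hα
    _ = δ * (k * C) * T + (∑ j, ∑ α ∈ (taylorShift n (P j)).support.erase 0, C * c α) *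
        (t ^ (-γ) * l2 B v.1) := by
        simp only [Finset.sum_add_distrib, Finset.sum_const, nsmul_eq_mul, ← Finset.sum_mul, hk]
        ring
    _ ≤ ε * T + _ := by
        refine add_le_add (mul_le_mul_of_nonneg_right ?_ hT0) (mul_assoc _ _ _).ge
        rw [hδ, div_mul_eq_mul_div, div_le_iff₀ (by positivity)]
        nlinarith

/-- The supremum `S` of `g` satisfies `S ≤ S / 2 + e`. The bound `B` is needed only to know that `S`
is finite. -/
theorem le_two_mul_of_forall_le_half_add {g : ℝ → ℝ} {t B e : ℝ}
    (hB : ∀ r, 0 < r → r ≤ t → g r ≤ B)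
    (hg : ∀ r, 0 < r → r ≤ t → g r ≤ g (r / 2) / 2 + e) {r : ℝ} (hr : 0 < r) (hrt : r ≤ t) :
    g r ≤ 2 * e := by
  have hbdd : BddAbove (g '' Set.Ioc 0 t) := ⟨B, by rintro _ ⟨r, hr, rfl⟩; exact hB r hr.1 hr.2⟩
  have hle : ∀ r, 0 < r → r ≤ t → g r ≤ sSup (g '' Set.Ioc 0 t) := fun r h1 h2 =>
    le_csSup hbdd ⟨r, ⟨h1, h2⟩, rfl⟩
  have h1 : sSup (g '' Set.Ioc 0 t) ≤ sSup (g '' Set.Ioc 0 t) / 2 + e := by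
    refine csSup_le ⟨_, r, ⟨hr, hrt⟩, rfl⟩ ?_
    rintro _ ⟨r, ⟨h1, h2⟩, rfl⟩
    have := hle (r / 2) (by positivity) (by linarith)
    linarith [hg r h1 h2]
  linarith [hle r hr hrt]

/-- The local `L²` estimate of an operator by a stronger system satisfying `(ℋ)`. -/
theorem CondHWith.exists_l2_le {P : Fin N → MvPolynomial (Fin n) ℂ} {m : ℕ} {γ : ℝ}
    (hPm : HasOrder P m) (hm : 0 < m) (hγ : (m : ℝ) ≤ γ) (h : CondHWith P γ) :
    ∃ C, 0 ≤ C ∧ ∀ (p : MvPolynomial (Fin n) ℂ) (a : ℝ), 0 ≤ a →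
      (∀ ξ, ‖symb p ξ‖ ≤ a * symbSize P ξ) →
      ∀ (A : Set (EuclideanSpace ℝ (Fin n))) (t : ℝ) (v : smoothFun n),
      IsCompact A → 0 < t → t ≤ 1 →
      l2 A (opHom n p v).1 ≤
        C * a * (sysNorm P v (cthickening t A) + t ^ (-γ) * l2 (cthickening t A) v.1) := by
  have hm' : (0 : ℝ) < m := Nat.cast_pos.2 hm
  have hγ0 : 0 < γ := hm'.trans_le hγ
  have h2γ : (1 : ℝ) ≤ 2 ^ γ := Real.one_le_rpow (by norm_num) hγ0.le
  obtain ⟨C, hC0, hC⟩ := exists_l2_opHom_le P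
  -- Since `r ^ γ = 2 ^ γ (r / 2) ^ γ`, this `ε` yields the factor `1/2` in front of `g (r / 2)`
  -- below.
  obtain ⟨K, hK0, hK⟩ := h.exists_lowNorm_le hPm hm hγ (ε := (2 * 2 ^ γ)⁻¹) (by positivity)
  refine ⟨C * (2 * 2 ^ γ + 1 + 2 * 2 ^ γ * (K * 2 ^ γ)), by positivity,
    fun p a ha hp A t v hA ht ht1 => ?_⟩
  set B := cthickening t A with hB
  have hBc : IsCompact B := hA.cthickening
  set S := sysNorm P v B
  set U := l2 B v.1
  have hS0 : 0 ≤ S := sysNorm_nonneg _ _ _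
  have hU0 : 0 ≤ U := l2_nonneg _ _
  have hsub : ∀ r, 0 ≤ r → cthickening (t - r) A ⊆ B := fun r hr =>
    cthickening_mono (by linarith) A
  -- Halving `r` enlarges the neighbourhood of `A` from `t - r` to `t - r / 2`, exactly the room
  -- consumed by a cutoff of scale `r / 2`. The weight `r ^ γ` cancels the factor `r ^ (-γ)` and
  -- keeps `g` bounded near `0`, because `|α| ≤ m ≤ γ`.
  let g : ℝ → ℝ := fun r => r ^ γ * lowNorm P v (cthickening (t - r) A) r
  have hg : g (t / 2) ≤ 2 * (t ^ γ * S + K * 2 ^ γ * U) := by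
    refine le_two_mul_of_forall_le_half_add (t := t) (B := lowNorm P v B 1)
      (fun r hr hrt => ?_) (fun r hr hrt => ?_) (by positivity) (by linarith)
    · refine (mul_le_mul_of_nonneg_left (lowNorm_mono P v hBc (hsub r hr.le) hr le_rfl)
        (by positivity)).trans ?_
      rw [lowNorm, lowNorm, Finset.mul_sum]
      refine Finset.sum_le_sum fun j _ => ?_
      rw [Finset.mul_sum]
      refine Finset.sum_le_sum fun α hα => ?_
      rw [← mul_assoc]
      refine mul_le_mul_of_nonneg_right ?_ (l2_nonneg _ _)
      have hd : α.degree ≤ m :=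
        (degree_le_of_mem_support_taylorShift (Finset.mem_of_mem_erase hα)).trans_eq (hPm j)
      rw [inv_one, one_pow, inv_pow, ← div_eq_mul_inv, div_le_one (by positivity),
        ← Real.rpow_natCast]
      exact Real.rpow_le_rpow_of_exponent_ge hr (hrt.trans ht1) ((Nat.cast_le.2 hd).trans hγ)
    · have hr2 : 0 < r / 2 := by positivity
      have hc : cthickening (r / 2) (cthickening (t - r) A) ⊆ cthickening (t - r / 2) A :=
        (cthickening_cthickening_subset hr2.le (by linarith) A).trans
          (cthickening_mono (by linarith) A)
      have hAc : ∀ s, IsCompact (cthickening s A) := fun s => hA.cthickening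
      have i1 : lowNorm P v (cthickening (t - r) A) r ≤
          lowNorm P v (cthickening (t - r) A) (r / 2) :=
        lowNorm_mono P v (hAc _) le_rfl hr2 (by linarith)
      have i2 := hK (cthickening (t - r) A) (r / 2) v (hAc _) hr2 (by linarith)
      have i3 := sysNorm_mono P v hBc (hc.trans (hsub _ hr2.le))
      have i4 := lowNorm_mono P v (hAc _) hc hr2 le_rfl
      have i5 := l2_mono v hBc (hc.trans (hsub _ hr2.le))
      have i6 : lowNorm P v (cthickening (t - r) A) r ≤ (2 * 2 ^ γ)⁻¹ * (S +
          lowNorm P v (cthickening (t - r / 2) A) (r / 2)) + K * (r / 2) ^ (-γ) * U := by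
        refine (i1.trans i2).trans ?_
        gcongr
      have i7 : r ^ γ ≤ t ^ γ := Real.rpow_le_rpow hr.le hrt hγ0.le
      have i8 : (r / 2) ^ γ = r ^ γ / 2 ^ γ := Real.div_rpow hr.le (by norm_num) γ
      have i9 : 0 < r ^ γ := by positivity
      have i10 : (2 * 2 ^ γ : ℝ)⁻¹ ≤ 1 := inv_le_one_of_one_le₀ (by linarith)
      calc g r ≤ r ^ γ * ((2 * 2 ^ γ)⁻¹ * (S +
          lowNorm P v (cthickening (t - r / 2) A) (r / 2)) + K * (r / 2) ^ (-γ) * U) :=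
            mul_le_mul_of_nonneg_left i6 i9.le
        _ = (2 * 2 ^ γ)⁻¹ * (r ^ γ * S) + g (r / 2) / 2 + K * 2 ^ γ * U := by
            simp only [g]
            rw [Real.rpow_neg hr2.le, i8]
            field_simp
        _ ≤ 1 * (t ^ γ * S) + g (r / 2) / 2 + K * 2 ^ γ * U := by gcongr
        _ = _ := by ring
  have ht2 : 0 < t / 2 := by positivity
  have htγ : 0 < t ^ γ := by positivity
  have hlow : lowNorm P v (cthickening (t / 2) A) (t / 2) ≤
      2 * 2 ^ γ * (S + K * 2 ^ γ * (t ^ (-γ) * U)) := by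
    have e : g (t / 2) = t ^ γ / 2 ^ γ * lowNorm P v (cthickening (t / 2) A) (t / 2) := by
      simp only [g]
      rw [Real.div_rpow ht.le (by norm_num), sub_half]
    rw [e, div_mul_eq_mul_div, div_le_iff₀ (by positivity), mul_comm] at hg
    rw [← le_div_iff₀ htγ] at hg
    refine hg.trans_eq ?_
    rw [Real.rpow_neg ht.le]
    field_simp
  have j1 := hC A (t / 2) v p a a hA ht2 ha ha fun ξ => (hp ξ).trans_eq (by rw [symbSize]; ring)
  have j2 := sysNorm_mono P v hBc (hsub (t / 2) ht2.le)
  have j3 := l2_mono v hBc (hsub (t / 2) ht2.le)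
  rw [sub_half] at j2 j3
  have j4 : 1 ≤ t ^ (-γ) := Real.one_le_rpow_of_pos_of_le_one_of_nonpos ht ht1 (by linarith)
  have j5 : U ≤ t ^ (-γ) * U := le_mul_of_one_le_left hU0 j4
  calc _ ≤ _ := j1
    _ ≤ C * (a * (S + 2 * 2 ^ γ * (S + K * 2 ^ γ * (t ^ (-γ) * U))) + a * (t ^ (-γ) * U)) := by
        gcongr
        exact j3.trans j5
    _ = C * a * ((2 * 2 ^ γ + 1) * S + (2 * 2 ^ γ * (K * 2 ^ γ) + 1) * (t ^ (-γ) * U)) := by ring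
    _ ≤ C * a * ((2 * 2 ^ γ + 1 + 2 * 2 ^ γ * (K * 2 ^ γ)) * S +
        (2 * 2 ^ γ + 1 + 2 * 2 ^ γ * (K * 2 ^ γ)) * (t ^ (-γ) * U)) := by
        have k1 : 0 ≤ 2 * 2 ^ γ * (K * 2 ^ γ) := by positivity
        exact mul_le_mul_of_nonneg_left (add_le_add
          (mul_le_mul_of_nonneg_right (by linarith) hS0)
          (mul_le_mul_of_nonneg_right (by linarith) (hU0.trans j5))) (by positivity)
    _ = _ := by ring

end IterateSystems

end

/-! ### Iterating the local estimate. -/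

noncomputable section

namespace IterateSystems

open MvPolynomial MeasureTheory Metric

variable {n N M : ℕ}

theorem exists_eq_add_single_of_sum_eq_succ {β : Fin M → ℕ} {j : ℕ} (h : ∑ i, β i = j + 1) :
    ∃ (i : Fin M) (β' : Fin M → ℕ), ∑ i, β' i = j ∧ β = β' + Pi.single i 1 := by
  obtain ⟨i, hi⟩ : ∃ i, β i ≠ 0 := by
    by_contra! h0
    simp [h0] at h
  have hβ : β = (β - Pi.single i 1) + Pi.single i 1 := by
    funext l
    by_cases hl : l = i
    · subst hl
      simp
      omega
    · simp [hl]
  refine ⟨i, β - Pi.single i 1, ?_, hβ⟩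
  rw [hβ] at h
  simp only [Pi.add_apply, Finset.sum_add_distrib] at h
  rw [Finset.sum_pi_single'] at h
  simpa using h

theorem prod_pow_add_single {R : Type*} [CommMonoid R] (q : Fin M → R) (β : Fin M → ℕ)
    (i : Fin M) :
    ∏ l, q l ^ (β + Pi.single i 1 : Fin M → ℕ) l = q i * ∏ l, q l ^ β l := by
  simp only [Pi.add_apply, pow_add, Finset.prod_mul_distrib]
  rw [mul_comm]
  congr 1
  rw [Finset.prod_eq_single i]
  · simp
  · intro l _ hl
    simp [hl]
  · simp

/-- Bounds for the iterates of a system, from bounds for the iterates of a stronger system. -/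
theorem CondHWith.exists_iterate_le {P : Fin N → MvPolynomial (Fin n) ℂ} {m : ℕ} {γ : ℝ}
    (hPm : HasOrder P m) (hm : 0 < m) (hγ : (m : ℝ) ≤ γ) (h : CondHWith P γ)
    {Q : Fin M → MvPolynomial (Fin n) ℂ} {a : ℝ} (ha : 0 ≤ a)
    (hQ : ∀ i ξ, ‖symb (Q i) ξ‖ ≤ a * symbSize P ξ) {δ : ℝ} (hδ : 0 < δ) (hδ1 : δ ≤ 1) :
    ∃ C, 0 < C ∧ ∀ (K : Set (EuclideanSpace ℝ (Fin n))) (v : smoothFun n) (k : ℕ) (X : ℝ),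
      IsCompact K →
      (∀ α : Fin N → ℕ, ∑ i, α i ≤ k → (k : ℝ) ^ (γ * ((k : ℝ) - (∑ i, α i : ℕ))) *
        l2 (cthickening δ K) (opHom n (∏ i, P i ^ α i) v).1 ≤ X) →
      ∀ β : Fin M → ℕ, ∑ i, β i = k → l2 K (opHom n (∏ i, Q i ^ β i) v).1 ≤ C ^ k * X := by
  obtain ⟨C₀, hC₀, hC⟩ := h.exists_l2_le hPm hm hγ
  have hδγ : 0 < δ ^ (-γ) := by positivity
  refine ⟨C₀ * a * (N + δ ^ (-γ)) + 1, by positivity, fun K v k X hK hX β hβ => ?_⟩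
  set C := C₀ * a * (N + δ ^ (-γ)) + 1 with hCdef
  have hX0 : 0 ≤ X := (mul_nonneg (by positivity) (l2_nonneg _ _)).trans (hX 0 (by simp))
  have hC0 : 0 ≤ C := by positivity
  -- Each of the `k` steps uses up `δ / k` of the neighbourhood and costs `t ^ (-γ) = δ ^ (-γ) k ^
  -- γ`. For `k = 0` the quotient is `0`, and only the base case of the induction occurs.
  set t := δ / k with ht
  -- Induction on the number `j` of factors from `Q`: one such factor is either exchanged for a
  -- factor from `P`, leaving the exponent of `k` unchanged, or dropped at the cost `k ^ γ`, which
  -- the exponent records.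
  have key : ∀ j, ∀ β : Fin M → ℕ, ∑ i, β i = j → ∀ α : Fin N → ℕ, j + ∑ i, α i ≤ k →
      (k : ℝ) ^ (γ * ((k : ℝ) - (j + ∑ i, α i : ℕ))) *
        l2 (cthickening (δ - j * t) K)
          (opHom n ((∏ i, Q i ^ β i) * ∏ i, P i ^ α i) v).1 ≤ C ^ j * X := by
    intro j
    induction j with
    | zero =>
      intro β hβ α hα
      have hβ0 : ∀ i, β i = 0 := fun i => (Finset.sum_eq_zero_iff.1 hβ) i (Finset.mem_univ i)
      simp only [hβ0, pow_zero, Finset.prod_const_one, one_mul, Nat.cast_zero, zero_mul, sub_zero,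
        zero_add]
      exact hX α (by omega)
    | succ j ih =>
      intro β hβ α hα
      obtain ⟨i, β', hβ', rfl⟩ := exists_eq_add_single_of_sum_eq_succ hβ
      have hk : 0 < k := by omega
      have hk0 : (0 : ℝ) < k := Nat.cast_pos.2 hk
      have hk1 : (1 : ℝ) ≤ k := Nat.one_le_cast.2 hk
      have ht0 : 0 < t := by positivity
      have htδ : t ≤ δ := div_le_self hδ.le hk1
      have hjk : ((j + 1 : ℕ) : ℝ) * t ≤ δ := by
        rw [ht, mul_div_assoc', div_le_iff₀ hk0, mul_comm]
        exact mul_le_mul_of_nonneg_left (Nat.cast_le.2 (by omega)) hδ.le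
      set A := cthickening (δ - (j + 1 : ℕ) * t) K with hA
      set B := cthickening (δ - j * t) K with hB
      have hBc : IsCompact B := hK.cthickening
      have hAB : cthickening t A ⊆ B :=
        (cthickening_cthickening_subset ht0.le (by linarith) K).trans
          (cthickening_mono (by push_cast; linarith) K)
      set w := opHom n ((∏ i, Q i ^ β' i) * ∏ i, P i ^ α i) v with hw
      have hQw : opHom n ((∏ l, Q l ^ (β' + Pi.single i 1 : Fin M → ℕ) l) * ∏ i, P i ^ α i) v =
          opHom n (Q i) w := by
        rw [prod_pow_add_single, mul_assoc, opHom_mul]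
      have hPw : ∀ l, opHom n (P l) w =
          opHom n ((∏ i, Q i ^ β' i) * ∏ r, P r ^ (α + Pi.single l 1 : Fin N → ℕ) r) v := by
        intro l
        rw [prod_pow_add_single, ← mul_assoc, mul_comm _ (P l), mul_assoc, opHom_mul]
      have hsum : ∀ l, ∑ r, (α + Pi.single l 1 : Fin N → ℕ) r = ∑ r, α r + 1 := by
        intro l
        simp [Finset.sum_add_distrib]
      set E : ℝ := (k : ℝ) ^ (γ * ((k : ℝ) - (j + 1 + ∑ i, α i : ℕ))) with hE
      have hE0 : 0 ≤ E := by positivity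
      have h1 := hC (Q i) a ha (hQ i) A t w hK.cthickening ht0 (htδ.trans hδ1)
      have h2 : E * sysNorm P w (cthickening t A) ≤ N * (C ^ j * X) := by
        rw [sysNorm, Finset.mul_sum]
        refine (Finset.sum_le_card_nsmul _ _ (C ^ j * X) fun l _ => ?_).trans_eq (by simp)
        have := ih β' hβ' (α + Pi.single l 1) (by rw [hsum]; omega)
        rw [hsum, ← add_assoc, add_right_comm, ← hPw] at this
        exact (mul_le_mul_of_nonneg_left (l2_mono _ hBc hAB) hE0).trans this
      have h3 : E * (t ^ (-γ) * l2 (cthickening t A) w.1) ≤ δ ^ (-γ) * (C ^ j * X) := by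
        have h4 := ih β' hβ' α (by omega)
        have h5 : (k : ℝ) ^ (γ * ((k : ℝ) - (j + ∑ i, α i : ℕ))) = E * (k : ℝ) ^ γ := by
          rw [hE, ← Real.rpow_add hk0]
          congr 1
          push_cast
          ring
        have h6 : t ^ (-γ) = δ ^ (-γ) * (k : ℝ) ^ γ := by
          rw [ht, Real.div_rpow hδ.le hk0.le, Real.rpow_neg hk0.le, div_inv_eq_mul]
        rw [h5] at h4
        rw [h6]
        calc E * (δ ^ (-γ) * (k : ℝ) ^ γ * l2 (cthickening t A) w.1)
            = δ ^ (-γ) * (E * (k : ℝ) ^ γ * l2 (cthickening t A) w.1) := by ring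
          _ ≤ δ ^ (-γ) * (E * (k : ℝ) ^ γ * l2 B w.1) := by
              gcongr
              exact l2_mono _ hBc hAB
          _ ≤ _ := mul_le_mul_of_nonneg_left h4 hδγ.le
      rw [hQw]
      calc E * l2 A (opHom n (Q i) w).1
          ≤ E * (C₀ * a * (sysNorm P w (cthickening t A) +
              t ^ (-γ) * l2 (cthickening t A) w.1)) := mul_le_mul_of_nonneg_left h1 hE0
        _ = C₀ * a * (E * sysNorm P w (cthickening t A) +
              E * (t ^ (-γ) * l2 (cthickening t A) w.1)) := by ring
        _ ≤ C₀ * a * (N * (C ^ j * X) + δ ^ (-γ) * (C ^ j * X)) :=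
            mul_le_mul_of_nonneg_left (add_le_add h2 h3) (by positivity)
        _ = C ^ (j + 1) * X - C ^ j * X := by rw [pow_succ]; nth_rw 4 [hCdef]; ring
        _ ≤ C ^ (j + 1) * X := sub_le_self _ (by positivity)
  have h0 := key k β hβ 0 (by simp)
  simp only [Pi.zero_apply, Finset.sum_const_zero, add_zero, sub_self, mul_zero, Real.rpow_zero,
    pow_zero, Finset.prod_const_one, mul_one, one_mul] at h0
  exact (l2_mono _ hK.cthickening (self_subset_cthickening K)).trans h0

end IterateSystems

end

/-! ### Comparison of seminorms and conclusion. -/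

noncomputable section

namespace IterateSystems

open MvPolynomial MeasureTheory Metric

variable {n N M : ℕ}

/-- After scaling, `μ φ*(y / μ)` is the supremum of `y t - μ ω(exp (t / s))`, visibly decreasing in
`μ`. -/
theorem IsNQWeight.mul_youngConj_antitone {ω : ℝ → ℝ} {s : ℝ} (hω : IsNQWeight ω) (hs : 0 < s)
    {μ μ' y : ℝ} (hμ' : 0 < μ') (hμ : μ' ≤ μ) (hy : 0 ≤ y) :
    μ * youngConj (fun t => ω (t ^ (1 / s))) (y / μ) ≤
      μ' * youngConj (fun t => ω (t ^ (1 / s))) (y / μ') := by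
  have hμ0 : 0 < μ := hμ'.trans_le hμ
  rw [mul_comm, ← le_div_iff₀ hμ0]
  refine youngConj_le fun t ht => ?_
  have h1 := hω.le_youngConj hs (y := y / μ') (by positivity) ht
  have h2 := hω.nonneg (Real.exp (t / s)) (Real.exp_pos _).le
  rw [le_div_iff₀ hμ0]
  have h3 := mul_le_mul_of_nonneg_left h1 hμ'.le
  have h4 := mul_le_mul_of_nonneg_right hμ h2
  have e1 : (y / μ * t - ω (Real.exp (t / s))) * μ = y * t - μ * ω (Real.exp (t / s)) := by
    field_simp
  have e2 : μ' * (y / μ' * t - ω (Real.exp (t / s))) = y * t - μ' * ω (Real.exp (t / s)) := by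
    field_simp
  rw [e2] at h3
  rw [e1]
  linarith

/-- Finiteness of the norms is a separate hypothesis because `l2` turns an infinite norm into `0`.
-/
theorem seminormP_lt_top_of_le {P : Fin N → MvPolynomial (Fin n) ℂ} {m : ℕ} {σ : ℝ → ℝ}
    {K : Set (EuclideanSpace ℝ (Fin n))} {μ : ℝ} {u : EuclideanSpace ℝ (Fin n) → ℂ} {B : ℝ}
    (hu : ∀ β, eLpNorm (sysIter P β u) 2 (volume.restrict K) ≠ ⊤)
    (h : ∀ β : Fin N → ℕ, l2 K (sysIter P β u) ≤
      B * Real.exp (μ * youngConj σ (((∑ j, β j : ℕ) : ℝ) * m / μ))) :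
    seminormP P m σ K μ u < ⊤ := by
  refine lt_of_le_of_lt (iSup_le fun β => ?_) (ENNReal.ofReal_lt_top (r := B))
  rw [← ENNReal.ofReal_toReal (hu β), ← ENNReal.ofReal_mul ENNReal.toReal_nonneg]
  refine ENNReal.ofReal_le_ofReal ?_
  rw [Real.exp_neg, ← div_eq_mul_inv, div_le_iff₀ (Real.exp_pos _)]
  exact h β

theorem l2_le_of_seminormP_lt_top {P : Fin N → MvPolynomial (Fin n) ℂ} {m : ℕ} {σ : ℝ → ℝ}
    {K : Set (EuclideanSpace ℝ (Fin n))} {μ : ℝ} {u : EuclideanSpace ℝ (Fin n) → ℂ}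
    (h : seminormP P m σ K μ u < ⊤) (β : Fin N → ℕ) :
    l2 K (sysIter P β u) ≤ (seminormP P m σ K μ u).toReal *
      Real.exp (μ * youngConj σ (((∑ j, β j : ℕ) : ℝ) * m / μ)) := by
  have h1 := ENNReal.toReal_mono h.ne (le_iSup (fun β : Fin N → ℕ =>
    eLpNorm (sysIter P β u) 2 (volume.restrict K) *
      ENNReal.ofReal (Real.exp (-(μ * youngConj σ (((∑ j, β j : ℕ) : ℝ) * m / μ))))) β)
  rw [ENNReal.toReal_mul, ENNReal.toReal_ofReal (Real.exp_pos _).le, Real.exp_neg,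
    ← div_eq_mul_inv, div_le_iff₀ (Real.exp_pos _)] at h1
  exact h1

/-- Comparison of the semi-norms of two systems. -/
theorem CondHWith.exists_seminormP_lt_top {P : Fin N → MvPolynomial (Fin n) ℂ}
    {Q : Fin M → MvPolynomial (Fin n) ℂ} {m : ℕ} {γ s : ℝ}
    (hPm : HasOrder P m) (hm : 0 < m) (hγ : (m : ℝ) ≤ γ) (h : CondHWith P γ)
    (hQP : HWeaker 1 Q P) {ω : ℝ → ℝ} (hω : IsNQWeight ω) (hs : 0 < s) (hγs : γ ≤ s * m)
    {Ω K : Set (EuclideanSpace ℝ (Fin n))} (hΩ : IsOpen Ω) (hK : IsCompact K) (hKΩ : K ⊆ Ω) :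
    ∃ K' : Set (EuclideanSpace ℝ (Fin n)), IsCompact K' ∧ K' ⊆ Ω ∧ ∃ L : ℕ, 0 < L ∧
      ∀ u : EuclideanSpace ℝ (Fin n) → ℂ, ContDiffOn ℝ ((⊤ : ℕ∞) : WithTop ℕ∞) u Ω →
      ∀ μ : ℝ, 0 < μ → seminormP P m (fun t => ω (t ^ (1 / s))) K' μ u < ⊤ →
        seminormP Q m (fun t => ω (t ^ (1 / s))) K (μ / L) u < ⊤ := by
  obtain ⟨δ₀, hδ₀, hδΩ⟩ := hK.exists_cthickening_subset_open hΩ hKΩ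
  set δ := min δ₀ 1 with hδ
  have hδ0 : 0 < δ := lt_min hδ₀ one_pos
  have hK'Ω : cthickening δ K ⊆ Ω := (cthickening_mono (min_le_left _ _) K).trans hδΩ
  have hK' : IsCompact (cthickening δ K) := hK.cthickening
  obtain ⟨a, ha, haQ⟩ := hQP.exists_symbSize_le
  obtain ⟨C, hC0, hC⟩ := h.exists_iterate_le hPm hm hγ ha.le
    (fun i ξ => (norm_symb_le_symbSize Q i ξ).trans (haQ ξ)) hδ0 (min_le_right _ _)
  obtain ⟨L, hL, hLC⟩ := hω.exists_absorb hs hm hγs C hC0.le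
  -- An integer divisor keeps the parameters of the form `1 / l` in the Roumieu case. Neither it nor
  -- the larger compact set depends on `u` or `μ`.
  obtain ⟨L', hL'⟩ := exists_nat_ge L
  have hL0 : 0 < L := by linarith
  have hL'0 : (0 : ℝ) < L' := by linarith
  refine ⟨cthickening δ K, hK', hK'Ω, L', Nat.cast_pos.1 hL'0, fun u hu μ hμ hsem => ?_⟩
  obtain ⟨B, hB, hBk⟩ := hLC μ hμ
  -- Only the values of `u` near the larger compact set matter, so `u` may be replaced by a globally
  -- smooth function.
  obtain ⟨U, v, hU, hKU, huv⟩ := exists_smoothFun_eqOn hΩ hK' hK'Ω hu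
  have heq : ∀ {r : ℕ} (R : Fin r → MvPolynomial (Fin n) ℂ) (β : Fin r → ℕ),
      Set.EqOn (sysIter R β u) (opHom n (∏ j, R j ^ β j) v).1 (cthickening δ K) := by
    intro r R β
    rw [← sysIter_eq_opHom]
    exact (sysIter_eqOn hU huv R β).mono hKU
  have hKK : K ⊆ cthickening δ K := self_subset_cthickening K
  set σ : ℝ → ℝ := fun t => ω (t ^ (1 / s)) with hσ
  obtain ⟨S, hS0, hS⟩ : ∃ S : ℝ, 0 ≤ S ∧ ∀ α, l2 (cthickening δ K) (sysIter P α u) ≤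
      S * Real.exp (μ * youngConj σ (((∑ i, α i : ℕ) : ℝ) * m / μ)) :=
    ⟨_, ENNReal.toReal_nonneg, l2_le_of_seminormP_lt_top hsem⟩
  refine seminormP_lt_top_of_le (B := S * B) (fun β => ?_) fun β => ?_
  · rw [eLpNorm_congr_ae (ae_restrict_of_forall_mem hK.measurableSet ((heq Q β).mono hKK))]
    exact (memLp_restrict _ hK).2.ne
  · rw [l2_congr hK.measurableSet ((heq Q β).mono hKK)]
    obtain ⟨k, hk⟩ : ∃ k, k = ∑ j, β j := ⟨_, rfl⟩
    rw [← hk]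
    obtain ⟨Y, hY⟩ : ∃ Y, Y = B * Real.exp (μ / L * youngConj σ ((k : ℝ) * m / (μ / L))) :=
      ⟨_, rfl⟩
    have hCk0 : 0 < C ^ k := by positivity
    -- The division by `C ^ k` anticipates the factor `C ^ k` produced by the iteration, which
    -- `exists_absorb` has already included in `Y`.
    have h1 := hC K v k (S * Y / C ^ k) hK (fun α hα => by
      rw [← l2_congr hK'.measurableSet (heq P α), le_div_iff₀ hCk0]
      have h2 := hS α
      have h3 := hBk k (∑ i, α i) hα
      rw [← hY] at h3
      have h4 : 0 ≤ (k : ℝ) ^ (γ * ((k : ℝ) - (∑ i, α i : ℕ))) := by positivity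
      calc _ = (C ^ k * (k : ℝ) ^ (γ * ((k : ℝ) - (∑ i, α i : ℕ)))) *
            l2 (cthickening δ K) (sysIter P α u) := by ring
        _ ≤ (C ^ k * (k : ℝ) ^ (γ * ((k : ℝ) - (∑ i, α i : ℕ)))) * (S *
            Real.exp (μ * youngConj σ (((∑ i, α i : ℕ) : ℝ) * m / μ))) := by
            gcongr
        _ = S * (C ^ k * (k : ℝ) ^ (γ * ((k : ℝ) - (∑ i, α i : ℕ))) *
            Real.exp (μ * youngConj σ (((∑ i, α i : ℕ) : ℝ) * m / μ))) := by ring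
        _ ≤ S * Y := mul_le_mul_of_nonneg_left h3 hS0) β hk.symm
    rw [mul_div_cancel₀ _ hCk0.ne'] at h1
    refine h1.trans ?_
    rw [hY, ← mul_assoc]
    refine mul_le_mul_of_nonneg_left (Real.exp_le_exp.2 ?_) (by positivity)
    exact hω.mul_youngConj_antitone hs (by positivity)
      (div_le_div_of_nonneg_left hμ.le hL0 hL') (by positivity)

theorem CondHWith.beurling_subset {P : Fin N → MvPolynomial (Fin n) ℂ}
    {Q : Fin M → MvPolynomial (Fin n) ℂ} {m : ℕ} {γ s : ℝ}
    (hPm : HasOrder P m) (hm : 0 < m) (hγ : (m : ℝ) ≤ γ) (h : CondHWith P γ)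
    (hQP : HWeaker 1 Q P) {ω : ℝ → ℝ} (hω : IsNQWeight ω) (hs : 0 < s) (hγs : γ ≤ s * m)
    {Ω : Set (EuclideanSpace ℝ (Fin n))} (hΩ : IsOpen Ω) :
    beurling P m (fun t => ω (t ^ (1 / s))) Ω ⊆ beurling Q m (fun t => ω (t ^ (1 / s))) Ω := by
  rintro u ⟨hu, huP⟩
  refine ⟨hu, fun K hK hKΩ μ hμ => ?_⟩
  obtain ⟨K', hK', hK'Ω, L, hL, hLu⟩ := h.exists_seminormP_lt_top hPm hm hγ hQP hω hs hγs hΩ hK hKΩ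
  have hL0 : (0 : ℝ) < L := Nat.cast_pos.2 hL
  have := hLu u hu (μ * L) (by positivity) (huP K' hK' hK'Ω _ (by positivity))
  rwa [mul_div_cancel_right₀ _ hL0.ne'] at this

theorem CondHWith.roumieu_subset {P : Fin N → MvPolynomial (Fin n) ℂ}
    {Q : Fin M → MvPolynomial (Fin n) ℂ} {m : ℕ} {γ s : ℝ}
    (hPm : HasOrder P m) (hm : 0 < m) (hγ : (m : ℝ) ≤ γ) (h : CondHWith P γ)
    (hQP : HWeaker 1 Q P) {ω : ℝ → ℝ} (hω : IsNQWeight ω) (hs : 0 < s) (hγs : γ ≤ s * m)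
    {Ω : Set (EuclideanSpace ℝ (Fin n))} (hΩ : IsOpen Ω) :
    roumieu P m (fun t => ω (t ^ (1 / s))) Ω ⊆ roumieu Q m (fun t => ω (t ^ (1 / s))) Ω := by
  rintro u ⟨hu, huP⟩
  refine ⟨hu, fun K hK hKΩ => ?_⟩
  obtain ⟨K', hK', hK'Ω, L, hL, hLu⟩ := h.exists_seminormP_lt_top hPm hm hγ hQP hω hs hγs hΩ hK hKΩ
  obtain ⟨l, hl, hlu⟩ := huP K' hK' hK'Ω
  have hl0 : (0 : ℝ) < l := Nat.cast_pos.2 hl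
  refine ⟨l * L, Nat.mul_pos hl hL, ?_⟩
  have := hLu u hu (1 / l) (by positivity) hlu
  rwa [div_div, ← Nat.cast_mul] at this

end IterateSystems

end

theorem corollary0 {n N M : ℕ} (m : ℕ) (hm : 0 < m)
    (P : Fin N → MvPolynomial (Fin n) ℂ) (Q : Fin M → MvPolynomial (Fin n) ℂ)
    (hPm : IterateSystems.HasOrder P m) (hQm : IterateSystems.HasOrder Q m)
    (hP : IterateSystems.CondH P m) (hQ : IterateSystems.CondH Q m)
    (hPQ : IterateSystems.EquallyStrong 1 P Q)
    (Ω : Set (EuclideanSpace ℝ (Fin n))) (hΩ : IsOpen Ω)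
    (ω : ℝ → ℝ) (hω : IterateSystems.IsNQWeight ω)
    (s : ℝ) (hs : IterateSystems.gammaOf P m / (m : ℝ) ≤ s) :
    IterateSystems.gammaOf P m = IterateSystems.gammaOf Q m ∧
    IterateSystems.beurling P m (fun t => ω (t ^ (1 / s))) Ω
      = IterateSystems.beurling Q m (fun t => ω (t ^ (1 / s))) Ω ∧
    IterateSystems.roumieu P m (fun t => ω (t ^ (1 / s))) Ω
      = IterateSystems.roumieu Q m (fun t => ω (t ^ (1 / s))) Ω := by
  have hγ := IterateSystems.gammaOf_eq_of_equallyStrong hm hPm hQm hPQ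
  have hm' : (0 : ℝ) < m := Nat.cast_pos.2 hm
  have hmP := IterateSystems.le_gammaOf hP
  have hmQ := IterateSystems.le_gammaOf hQ
  have hs0 : 0 < s := (div_pos (hm'.trans_le hmP) hm').trans_le hs
  have hsP := (div_le_iff₀ hm').1 hs
  have hsQ := hsP
  rw [hγ] at hsQ
  -- Attainment is what covers the endpoint `s = γ_P / m`: the inclusions need `(ℋ)` with some
  -- exponent at most `s m`.
  have hPγ := IterateSystems.condHWith_gammaOf hm hPm hP
  have hQγ := IterateSystems.condHWith_gammaOf hm hQm hQ
  exact ⟨hγ,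
    (hPγ.beurling_subset hPm hm hmP hPQ.2 hω hs0 hsP hΩ).antisymm
      (hQγ.beurling_subset hQm hm hmQ hPQ.1 hω hs0 hsQ hΩ),
    (hPγ.roumieu_subset hPm hm hmP hPQ.2 hω hs0 hsP hΩ).antisymm
      (hQγ.roumieu_subset hQm hm hmQ hPQ.1 hω hs0 hsQ hΩ)⟩
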